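/- Let $M=(|M|,\mathcal O_M)$ be a supermanifold of dimension $n|m$ with a graded Riemannian metric (an even, graded-symmetric, non-degenerate $\mathcal O_M$-bilinear form on the tangent sheaf) and its Levi-Civita connection $\nabla$ (torsionless and metric). Let $M_{\rm red}$ be the underlying manifold with the induced pseudo-Riemannian metric. For an open set $I\subseteq\mathbf R$ let $I^{1|1}$ be the open subspace of $\mathbf R^{1|1}$ over $I$, with coordinates $(t,\xi)$. A supercurve on $I^{1|1}$ is a morphism $\gamma:I^{1|1}\to M$, with underlying curve $\widetilde\gamma:I\to M_{\rm red}$. For a vector field $X=\sum_j f_j\,(\gamma^*\circ\partial_{\eta_j})$ along $\gamma$, in coordinates $\eta=(x_i,\xi_\alpha)$ of $M$ with Christoffel symbols $\Gamma_{ij}^k$, put $$\frac{\nabla}{dt}X=\sum_k\Big(\partial_tf_k+\sum_{i,j}f_j\,\partial_t(\gamma^*\eta_i)\,\gamma^*\Gamma_{ij}^k\Big)\,(\gamma^*\circ\partial_{\eta_k}),$$ and let $\widetilde X$ denote the induced field $t\mapsto\big(f\mapsto (Xf)(t)\big)$ of tangent vectors of $M$ along $\widetilde\gamma$. The supercurve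 $\gamma$ is a supergeodesic if $\big(\frac{\nabla}{dt}d\gamma(\partial_t)\big)^{\sim}=\big(\frac{\nabla}{dt}d\gamma(\partial_\xi)\big)^{\sim}=0$, where $d\gamma(Y)=Y\circ\gamma^*$. 1. A supercurve $\gamma$ on $I^{1|1}$ (in particular on $\mathbf R^{1|1}$) is a supergeodesic if and only if $\widetilde\gamma$ is a geodesic of $M_{\rm red}$ and $\big(\frac{\nabla}{dt}d\gamma(\partial_\xi)\big)^{\sim}=0$. In coordinates $(x_i,\xi_\alpha)$ on $U$ one has $\gamma^*x_i=g_i$ and $\gamma^*\xi_\alpha=h_\alpha\xi$ with smooth functions $g_i,h_\alpha$ on $\widetilde\gamma^{-1}(U)$, and over $U$ the second condition is equivalent to the odd geodesic equations $$h_\delta'+\sum_{i,\beta}g_i'\,h_\beta\,\gamma^*\Gamma_{i\beta}^\delta=0\qquad\text{for all }\delta .$$ 2. For every $p\in M$ and every $\tau\in T_pM$ there is a unique maximal supergeodesic $\gamma$ with $\gamma(0)=p$ and $d_0\gamma(\partial_t+\partial_\xi)=\tau$: it is defined on $I^{1|1}$ for an open interval $I\ni 0$, and every supergeodesic with these initial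 data on $J^{1|1}$, $J\ni0$ an open interval, satisfies $J\subseteq I$ and is the restriction of $\gamma$. Moreover $I$ contains every open interval $J\ni 0$ on which there is a geodesic of $M_{\rm red}$ starting at $p$ with velocity the even part of $\tau$. Consequently, if the geodesic of $M_{\rm red}$ with these initial data is defined on all of $\mathbf R$ (for instance, if $M_{\rm red}$ is geodesically complete), there is exactly one supergeodesic $\gamma:\mathbf R^{1|1}\to M$ with $\gamma(0)=p$ and $d_0\gamma(\partial_t+\partial_\xi)=\tau$. -/

import Mathlib

open scoped ContDiff Topology
open TopologicalSpace

universe u v w z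

namespace SuperGeometry

/-- The sign `(-1)^{|a||b|}`. -/
def superSign (i j : ZMod 2) : ℝ := if i = 1 ∧ j = 1 then -1 else 1

/-- The Grassmann algebra `Λ_ℝ[ξ_1, …, ξ_m]`; the generator `ξ_α` is `ι (Pi.single α 1)`. -/
abbrev Gr (m : ℕ) : Type := ExteriorAlgebra ℝ (Fin m → ℝ)

/-- The `ℤ/2`-grading of the Grassmann algebra. -/
abbrev grParity (m : ℕ) : ZMod 2 → Submodule ℝ (Gr m) :=
  CliffordAlgebra.evenOdd (0 : QuadraticForm ℝ (Fin m → ℝ))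

/-- The basis of the monomials `ξ_I = ξ_{i_1} ⋯ ξ_{i_k}`. -/
noncomputable def grBasis (m : ℕ) : Module.Basis (Finset (Fin m)) ℝ (Gr m) :=
  (Pi.basisFun ℝ (Fin m)).ExteriorAlgebra

/-- The norm read off from the coefficients in the basis `ξ_I`. As `Λ` is finite-dimensional, a
`Λ`-valued function is smooth for it exactly when all its coefficients `f_I` are smooth. -/
noncomputable instance grNormedAddCommGroup (m : ℕ) : NormedAddCommGroup (Gr m) :=
  NormedAddCommGroup.induced (Gr m) (Finset (Fin m) → ℝ) (grBasis m).equivFun.toLinearMap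
    (grBasis m).equivFun.injective

noncomputable instance grNormedSpace (m : ℕ) : NormedSpace ℝ (Gr m) :=
  NormedSpace.induced ℝ (Gr m) (Finset (Fin m) → ℝ) (grBasis m).equivFun.toLinearMap

instance grFinite (m : ℕ) : Module.Finite ℝ (Gr m) := Module.Finite.of_basis (grBasis m)

theorem gr_gen_mul {m : ℕ} (v : Fin m → ℝ) (b : Gr m) :
    ExteriorAlgebra.ι ℝ v * b = CliffordAlgebra.involute b * ExteriorAlgebra.ι ℝ v := by
  induction b using CliffordAlgebra.left_induction with
  | algebraMap r => rw [AlgHom.commutes]; exact (Algebra.commutes r _).symm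
  | add x y hx hy => simp only [mul_add, map_add, add_mul, hx, hy]
  | ι_mul x w hx =>
    have h : ExteriorAlgebra.ι ℝ v * ExteriorAlgebra.ι ℝ w
        = - (ExteriorAlgebra.ι ℝ w * ExteriorAlgebra.ι ℝ v) :=
      eq_neg_of_add_eq_zero_left (ExteriorAlgebra.ι_add_mul_swap v w)
    change ExteriorAlgebra.ι ℝ v * (ExteriorAlgebra.ι ℝ w * x) = _
    rw [← mul_assoc, h, neg_mul, mul_assoc, hx, map_mul, CliffordAlgebra.involute_ι, neg_mul,
      neg_mul, mul_assoc]

theorem gr_even_mul {m : ℕ} {a : Gr m} (ha : a ∈ grParity m 0) (b : Gr m) : a * b = b * a := by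
  induction a, ha using CliffordAlgebra.even_induction with
  | algebraMap r => exact Algebra.commutes r b
  | add x y hx hy ihx ihy => rw [add_mul, mul_add, ihx, ihy]
  | ι_mul_ι_mul v w x hx ih =>
    have h1 := gr_gen_mul v (CliffordAlgebra.involute b)
    rw [CliffordAlgebra.involute_involute] at h1
    have h2 := gr_gen_mul w b
    change ExteriorAlgebra.ι ℝ v * ExteriorAlgebra.ι ℝ w * x * b
      = b * (ExteriorAlgebra.ι ℝ v * ExteriorAlgebra.ι ℝ w * x)
    rw [mul_assoc _ x b, ih, ← mul_assoc, mul_assoc _ _ b, h2, ← mul_assoc, h1]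
    simp only [mul_assoc]

theorem gr_odd_mul {m : ℕ} {a : Gr m} (ha : a ∈ grParity m 1) (b : Gr m) :
    a * b = CliffordAlgebra.involute b * a := by
  induction a, ha using CliffordAlgebra.odd_induction with
  | ι v => exact gr_gen_mul v b
  | add x y hx hy ihx ihy => rw [add_mul, mul_add, ihx, ihy]
  | ι_mul_ι_mul v w x hx ih =>
    have h0 := gr_even_mul (CliffordAlgebra.ι_mul_ι_mem_evenOdd_zero
      (0 : QuadraticForm ℝ (Fin m → ℝ)) v w) (CliffordAlgebra.involute b)
    rw [mul_assoc _ x b, ih, ← mul_assoc, h0, mul_assoc]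

theorem gr_parity_cases (i : ZMod 2) : i = 0 ∨ i = 1 := by revert i; decide

theorem gr_involute {m : ℕ} {j : ZMod 2} {b : Gr m} (hb : b ∈ grParity m j) :
    CliffordAlgebra.involute b = superSign 1 j • b := by
  rcases gr_parity_cases j with rfl | rfl
  · rw [CliffordAlgebra.involute_eq_of_mem_even hb]; simp [superSign]
  · rw [CliffordAlgebra.involute_eq_of_mem_odd hb]; simp [superSign]

theorem gr_supercomm {m : ℕ} {i j : ZMod 2} {a b : Gr m} (ha : a ∈ grParity m i)
    (hb : b ∈ grParity m j) : a * b = superSign i j • (b * a) := by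
  rcases gr_parity_cases i with rfl | rfl
  · rw [gr_even_mul ha]; simp [superSign]
  · rw [gr_odd_mul ha, gr_involute hb, smul_mul_assoc]

theorem gr_contract_mul {m : ℕ} (d : Module.Dual ℝ (Fin m → ℝ)) (a b : Gr m) :
    CliffordAlgebra.contractLeft d (a * b) = CliffordAlgebra.contractLeft d a * b
      + CliffordAlgebra.involute a * CliffordAlgebra.contractLeft d b := by
  induction a using CliffordAlgebra.left_induction with
  | algebraMap r => simp [CliffordAlgebra.contractLeft_algebraMap_mul]
  | add x y hx hy => simp only [add_mul, map_add, hx, hy]; abel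
  | ι_mul x v hx =>
    rw [mul_assoc, CliffordAlgebra.contractLeft_ι_mul, hx, CliffordAlgebra.contractLeft_ι_mul]
    simp only [map_mul, CliffordAlgebra.involute_ι]
    rw [mul_add, sub_mul, smul_mul_assoc, neg_mul, neg_mul, mul_assoc, mul_assoc]
    abel

theorem gr_contract_mem {m : ℕ} (d : Module.Dual ℝ (Fin m → ℝ)) (i : ZMod 2) (a : Gr m)
    (ha : a ∈ grParity m i) : CliffordAlgebra.contractLeft d a ∈ grParity m (1 + i) := by
  have step : ∀ (j : ZMod 2) (v w : Fin m → ℝ) (x : Gr m), x ∈ grParity m j →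
      CliffordAlgebra.contractLeft d x ∈ grParity m (1 + j) →
      CliffordAlgebra.contractLeft d (CliffordAlgebra.ι 0 v * CliffordAlgebra.ι 0 w * x)
        ∈ grParity m (1 + j) := by
    intro j v w x hx ih
    have hv := CliffordAlgebra.ι_mem_evenOdd_one (0 : QuadraticForm ℝ (Fin m → ℝ)) v
    have hw := CliffordAlgebra.ι_mem_evenOdd_one (0 : QuadraticForm ℝ (Fin m → ℝ)) w
    rw [mul_assoc, CliffordAlgebra.contractLeft_ι_mul, CliffordAlgebra.contractLeft_ι_mul, mul_sub,
      mul_smul_comm]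
    refine Submodule.sub_mem _ (Submodule.smul_mem _ _ (SetLike.mul_mem_graded hw hx))
      (Submodule.sub_mem _ (Submodule.smul_mem _ _ (SetLike.mul_mem_graded hv hx)) ?_)
    have := SetLike.mul_mem_graded hv (SetLike.mul_mem_graded hw ih)
    have e : (1 : ZMod 2) + (1 + (1 + j)) = 1 + j := by
      rw [← add_assoc]; rw [show (1 : ZMod 2) + 1 = 0 from by decide, zero_add]
    rw [e] at this
    exact this
  rcases gr_parity_cases i with rfl | rfl
  · induction a, ha using CliffordAlgebra.even_induction with
    | algebraMap r => rw [CliffordAlgebra.contractLeft_algebraMap]; exact Submodule.zero_mem _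
    | add x y hx hy ihx ihy => rw [map_add]; exact Submodule.add_mem _ ihx ihy
    | ι_mul_ι_mul v w x hx ih => exact step 0 v w x hx ih
  · induction a, ha using CliffordAlgebra.odd_induction with
    | ι v =>
      rw [CliffordAlgebra.contractLeft_ι]
      exact SetLike.algebraMap_mem_graded (grParity m) _
    | add x y hx hy ihx ihy => rw [map_add]; exact Submodule.add_mem _ ihx ihy
    | ι_mul_ι_mul v w x hx ih => exact step 1 v w x hx ih

noncomputable section
variable {X : Type u} [TopologicalSpace X] {E : Type} [NormedAddCommGroup E] [NormedSpace ℝ E]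

/-- A `Λ`-valued function `f` on an open set `V`, written as a function of the coordinates given by
the chart `x` (and extended by `0`). -/
def coordRep (x : OpenPartialHomeomorph X E) {m : ℕ} {V : Opens X} (f : V → Gr m) : E → Gr m :=
  open Classical in fun y => if h : x.symm y ∈ V then f ⟨x.symm y, h⟩ else 0

theorem coordRep_eventually {E : Type} [TopologicalSpace E] (x : OpenPartialHomeomorph X E) {V : Opens X} {p : X} (hp : p ∈ V)
    (hs : p ∈ x.source) : ∀ᶠ y in 𝓝 (x p), x.symm y ∈ V := by
  have hc : ContinuousAt x.symm (x p) := x.continuousAt_symm (x.map_source hs)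
  have : (V : Set X) ∈ 𝓝 (x.symm (x p)) := by
    rw [x.left_inv hs]; exact V.isOpen.mem_nhds hp
  exact hc this

/-- The pull-back along the chart `x` of the sheaf `C^∞ ⊗ Λ[ξ_1, …, ξ_m]` on `E`: its sections on an
open set `V` of the domain of `x` are the functions `V → Λ` that are smooth in the coordinates `x`. -/
def grSections (x : OpenPartialHomeomorph X E) (m : ℕ) (V : Opens X) :
    Subalgebra ℝ (V → Gr m) where
  carrier := {f | ∀ p ∈ V, p ∈ x.source → ContDiffAt ℝ ∞ (coordRep x f) (x p)}
  mul_mem' := by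
    intro f g hf hg p hp hs
    have hb : IsBoundedBilinearMap ℝ (fun q : Gr m × Gr m => q.1 * q.2) :=
      ((LinearMap.mul ℝ (Gr m)).toContinuousBilinearMap).isBoundedBilinearMap
    have := hb.contDiff.contDiffAt.comp (x p) ((hf p hp hs).prodMk (hg p hp hs)) (n := ∞)
    refine this.congr_of_eventuallyEq (Filter.Eventually.of_forall fun y => ?_)
    simp only [coordRep, Function.comp]
    split_ifs <;> simp
  add_mem' := by
    intro f g hf hg p hp hs
    refine ((hf p hp hs).add (hg p hp hs)).congr_of_eventuallyEq
      (Filter.Eventually.of_forall fun y => ?_)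
    simp only [coordRep, Pi.add_apply]
    split_ifs <;> simp
  algebraMap_mem' := by
    intro r p hp hs
    refine (contDiffAt_const (c := algebraMap ℝ (Gr m) r)).congr_of_eventuallyEq ?_
    filter_upwards [coordRep_eventually x hp hs] with y hy
    simp [coordRep, hy]

theorem grSections_map {x : OpenPartialHomeomorph X E} {m : ℕ} {V : Opens X} {f : V → Gr m}
    (hf : f ∈ grSections x m V) (L : Gr m →ₗ[ℝ] Gr m) : (fun p => L (f p)) ∈ grSections x m V := by
  intro p hp hs
  refine ((LinearMap.toContinuousLinearMap L).contDiff.contDiffAt.comp (x p)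
    (hf p hp hs)).congr_of_eventuallyEq (Filter.Eventually.of_forall fun y => ?_)
  simp only [coordRep, Function.comp]
  split_ifs <;> simp

/-- Sections with values in the even, respectively odd, part of `Λ`. -/
def grSections.parity (x : OpenPartialHomeomorph X E) (m : ℕ) (V : Opens X) (i : ZMod 2) :
    Submodule ℝ (grSections x m V) where
  carrier := {f | ∀ p, f.1 p ∈ grParity m i}
  add_mem' := fun hf hg p => Submodule.add_mem _ (hf p) (hg p)
  zero_mem' := fun _ => Submodule.zero_mem _
  smul_mem' := fun r _ hf p => Submodule.smul_mem _ r (hf p)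

/-- Restriction of functions. -/
def grSections.res (x : OpenPartialHomeomorph X E) (m : ℕ) {U V : Opens X} (h : V ≤ U) :
    grSections x m U →ₐ[ℝ] grSections x m V where
  toFun f := ⟨fun p => f.1 ⟨p, h p.2⟩, by
    intro p hp hs
    refine (f.2 p (h hp) hs).congr_of_eventuallyEq ?_
    filter_upwards [coordRep_eventually x hp hs] with y hy
    simp [coordRep, hy, h hy]⟩
  map_one' := rfl
  map_mul' _ _ := rfl
  map_zero' := rfl
  map_add' _ _ := rfl
  commutes' _ := rfl

/-- Pointwise application of a linear map `Λ → Λ`. -/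
def grSections.mapLin (x : OpenPartialHomeomorph X E) (m : ℕ) (V : Opens X)
    (L : Gr m →ₗ[ℝ] Gr m) : grSections x m V →ₗ[ℝ] grSections x m V where
  toFun f := ⟨fun p => L (f.1 p), grSections_map f.2 L⟩
  map_add' f g := by ext p; exact map_add L _ _
  map_smul' r f := by ext p; exact map_smul L _ _

theorem sum_proj {A : Type v} [Ring A] [Algebra ℝ A] (𝒜 : ZMod 2 → Submodule ℝ A)
    [GradedAlgebra 𝒜] (a : A) : ∑ i, GradedAlgebra.proj 𝒜 i a = a := by
  classical
  conv_rhs => rw [← DirectSum.sum_support_decompose 𝒜 a]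
  refine (Finset.sum_subset (Finset.subset_univ _) fun i _ hi => ?_).symm
  simpa using hi

/-- A direct sum decomposition from a family of projections. -/
abbrev decompositionOfProj {A : Type v} [AddCommGroup A] [Module ℝ A] (ℳ : ZMod 2 → Submodule ℝ A)
    (P : ZMod 2 → A →ₗ[ℝ] A) (hmem : ∀ i a, P i a ∈ ℳ i) (hsum : ∀ a, ∑ i, P i a = a)
    (hsame : ∀ i, ∀ a ∈ ℳ i, P i a = a) (hne : ∀ i j, j ≠ i → ∀ a ∈ ℳ i, P j a = 0) :
    DirectSum.Decomposition ℳ :=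
  DirectSum.Decomposition.ofLinearMap ℳ
    (∑ i : ZMod 2, DirectSum.lof ℝ (ZMod 2) (fun i => ℳ i) i ∘ₗ (P i).codRestrict (ℳ i) (hmem i))
    (by
      ext1 f
      rw [LinearMap.comp_apply, LinearMap.sum_apply, map_sum]
      simp only [LinearMap.comp_apply, DirectSum.coeLinearMap_lof]
      exact hsum f)
    (by
      refine DirectSum.linearMap_ext _ fun i => LinearMap.ext fun f => ?_
      rw [LinearMap.comp_apply, LinearMap.comp_apply, DirectSum.coeLinearMap_lof,
        LinearMap.sum_apply, Finset.sum_eq_single i]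
      · rw [LinearMap.comp_apply]
        congr 1
        exact Subtype.ext (hsame i _ f.2)
      · intro j _ hj
        have : (P j).codRestrict (ℳ j) (hmem j) (f : A) = 0 := Subtype.ext (hne i j hj _ f.2)
        rw [LinearMap.comp_apply, this, map_zero]
      · simp)

instance grSections.decomposition (x : OpenPartialHomeomorph X E) (m : ℕ) (V : Opens X) :
    DirectSum.Decomposition (grSections.parity x m V) :=
  decompositionOfProj _ (fun i => grSections.mapLin x m V (GradedAlgebra.proj (grParity m) i))
    (fun i f p => by simp [grSections.mapLin])
    (fun f => by
      ext p
      rw [AddSubmonoidClass.coe_finsetSum, Finset.sum_apply]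
      exact sum_proj (grParity m) (f.1 p))
    (fun i f hf => by ext p; exact DirectSum.decompose_of_mem_same _ (hf p))
    (fun i j hj f hf => by ext p; exact DirectSum.decompose_of_mem_ne _ (hf p) hj.symm)

instance grSections.gradedAlgebra (x : OpenPartialHomeomorph X E) (m : ℕ) (V : Opens X) :
    GradedAlgebra (grSections.parity x m V) where
  one_mem := fun _ => SetLike.GradedOne.one_mem (A := grParity m)
  mul_mem := fun _ _ _ _ hf hg p => SetLike.mul_mem_graded (hf p) (hg p)
  toDecomposition := grSections.decomposition x m V


/-- The coefficientwise partial derivative in the direction `v`. -/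
def grSections.dir (x : OpenPartialHomeomorph X E) (m : ℕ) (V : Opens X)
    (hV : (V : Set X) ⊆ x.source) (v : E) : grSections x m V →ₗ[ℝ] grSections x m V where
  toFun f := ⟨fun p => fderiv ℝ (coordRep x f.1) (x p) v, by
    intro p hp hs
    have h := ((f.2 p hp hs).fderiv_right (m := ∞) (by simp)).clm_apply
      (contDiffAt_const (c := v))
    refine h.congr_of_eventuallyEq ?_
    filter_upwards [coordRep_eventually x hp hs, x.open_target.mem_nhds (x.map_source hs)]
      with y hy hy'
    simp [coordRep, hy, x.right_inv hy']⟩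
  map_add' f g := by
    ext p
    have hf := (f.2 p p.2 (hV p.2)).differentiableAt (by simp)
    have hg := (g.2 p p.2 (hV p.2)).differentiableAt (by simp)
    have e : coordRep x (f + g).1 = coordRep x f.1 + coordRep x g.1 := by
      funext y
      simp only [coordRep, Pi.add_apply]
      split_ifs <;> simp
    change fderiv ℝ (coordRep x (f + g).1) (x p) v = _
    rw [e, fderiv_add hf hg]
    rfl
  map_smul' r f := by
    ext p
    have hf := (f.2 p p.2 (hV p.2)).differentiableAt (by simp)
    have e : coordRep x (r • f).1 = r • coordRep x f.1 := by
      funext y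
      simp only [coordRep, Pi.smul_apply]
      split_ifs <;> simp
    change fderiv ℝ (coordRep x (r • f).1) (x p) v = _
    rw [e, fderiv_const_smul hf]
    rfl

theorem grSections.dir_mul (x : OpenPartialHomeomorph X E) (m : ℕ) (V : Opens X)
    (hV : (V : Set X) ⊆ x.source) (v : E) (f g : grSections x m V) :
    dir x m V hV v (f * g) = dir x m V hV v f * g + f * dir x m V hV v g := by
  ext p
  have hf := (f.2 p p.2 (hV p.2)).differentiableAt (by simp)
  have hg := (g.2 p p.2 (hV p.2)).differentiableAt (by simp)
  have hb : IsBoundedBilinearMap ℝ (fun q : Gr m × Gr m => q.1 * q.2) :=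
    ((LinearMap.mul ℝ (Gr m)).toContinuousBilinearMap).isBoundedBilinearMap
  have e : coordRep x (f * g).1 = fun y => coordRep x f.1 y * coordRep x g.1 y := by
    funext y
    simp only [coordRep]
    split_ifs <;> simp
  have h := (hb.hasFDerivAt (coordRep x f.1 (x p), coordRep x g.1 (x p))).comp (x p)
    (hf.hasFDerivAt.prodMk hg.hasFDerivAt)
  have hp : x.symm (x p) = p := x.left_inv (hV p.2)
  have ef : coordRep x f.1 (x p) = f.1 p := by simp [coordRep, hp]
  have eg : coordRep x g.1 (x p) = g.1 p := by simp [coordRep, hp]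
  change fderiv ℝ (coordRep x (f * g).1) (x p) v
    = fderiv ℝ (coordRep x f.1) (x p) v * g.1 p + f.1 p * fderiv ℝ (coordRep x g.1) (x p) v
  rw [e]
  erw [h.fderiv]
  simp [ef, eg, add_comm]

theorem grSections.dir_mem (x : OpenPartialHomeomorph X E) (m : ℕ) (V : Opens X)
    (hV : (V : Set X) ⊆ x.source) (v : E) (i : ZMod 2) (f : grSections x m V)
    (hf : f ∈ parity x m V i) : dir x m V hV v f ∈ parity x m V i := by
  intro p
  change fderiv ℝ (coordRep x f.1) (x p) v ∈ _
  have hd := (f.2 p p.2 (hV p.2)).differentiableAt (by simp)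
  have hmem : ∀ y, coordRep x f.1 y ∈ grParity m i := by
    intro y
    simp only [coordRep]
    split_ifs
    · exact hf _
    · exact Submodule.zero_mem _
  let L : Gr m →L[ℝ] Gr m := LinearMap.toContinuousLinearMap (GradedAlgebra.proj (grParity m) i)
  have e : coordRep x f.1 = fun y => L (coordRep x f.1 y) := by
    funext y
    exact (DirectSum.decompose_of_mem_same _ (hmem y)).symm
  have h : fderiv ℝ (coordRep x f.1) (x p) = L.comp (fderiv ℝ (coordRep x f.1) (x p)) := by
    conv_lhs => rw [e]
    exact (L.hasFDerivAt.comp (x p) hd.hasFDerivAt).fderiv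
  rw [h]
  exact SetLike.coe_mem (DirectSum.decompose (grParity m) _ i)

theorem grSections.dir_res (x : OpenPartialHomeomorph X E) (m : ℕ) {V W : Opens X}
    (hV : (V : Set X) ⊆ x.source) (h : W ≤ V) (v : E) (f : grSections x m V) :
    res x m h (dir x m V hV v f) = dir x m W (fun _ hp => hV (h hp)) v (res x m h f) := by
  ext p
  change fderiv ℝ (coordRep x f.1) (x p) v = fderiv ℝ (coordRep x (res x m h f).1) (x p) v
  rw [Filter.EventuallyEq.fderiv_eq]
  filter_upwards [coordRep_eventually x p.2 (hV (h p.2))] with y hy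
  simp only [coordRep, hy, h hy, dif_pos]
  rfl

end

/-- A topological space with a sheaf of (supercommutative, unital) super `ℝ`-algebras. The sheaf
`O` is given by its algebras of sections, their `ℤ/2`-gradings and the restriction maps. -/
structure SuperSpace : Type (max (u + 1) (v + 1)) where
  carrier : Type u
  [top : TopologicalSpace carrier]
  O : Opens carrier → Type v
  [ring : ∀ U, Ring (O U)]
  [algebra : ∀ U, Algebra ℝ (O U)]
  parity : ∀ U, ZMod 2 → Submodule ℝ (O U)
  [graded : ∀ U, GradedAlgebra (parity U)]
  supercomm : ∀ {U : Opens carrier} {i j : ZMod 2} {a b : O U},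
    a ∈ parity U i → b ∈ parity U j → a * b = superSign i j • (b * a)
  res : ∀ {U V : Opens carrier}, V ≤ U → O U →ₐ[ℝ] O V
  res_mem : ∀ {U V : Opens carrier} (h : V ≤ U) {i : ZMod 2} {a : O U},
    a ∈ parity U i → res h a ∈ parity V i
  res_self : ∀ {U : Opens carrier} (a : O U), res le_rfl a = a
  res_res : ∀ {U V W : Opens carrier} (h : V ≤ U) (h' : W ≤ V) (a : O U),
    res h' (res h a) = res (h'.trans h) a
  glue : ∀ {ι : Type u} (U : ι → Opens carrier) (s : ∀ i, O (U i)),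
    (∀ i j, res (inf_le_left : U i ⊓ U j ≤ U i) (s i)
      = res (inf_le_right : U i ⊓ U j ≤ U j) (s j)) →
    ∃! t : O (⨆ i, U i), ∀ i, res (le_iSup U i) t = s i

instance : CoeSort SuperSpace.{u, v} (Type u) := ⟨SuperSpace.carrier⟩

attribute [instance] SuperSpace.top SuperSpace.ring SuperSpace.algebra SuperSpace.graded

noncomputable section

theorem grSections.supercomm {X : Type u} [TopologicalSpace X] {E : Type} [NormedAddCommGroup E]
    [NormedSpace ℝ E] {x : OpenPartialHomeomorph X E} {m : ℕ} {V : Opens X} {i j : ZMod 2}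
    {a b : grSections x m V} (ha : a ∈ parity x m V i) (hb : b ∈ parity x m V j) :
    a * b = superSign i j • (b * a) := by
  ext p
  exact gr_supercomm (ha p) (hb p)

theorem grSections.glue {X : Type u} [TopologicalSpace X] {E : Type} [NormedAddCommGroup E]
    [NormedSpace ℝ E] (x : OpenPartialHomeomorph X E) (m : ℕ) {ι : Type u} (U : ι → Opens X)
    (s : ∀ i, grSections x m (U i))
    (hs : ∀ i j, res x m (inf_le_left : U i ⊓ U j ≤ U i) (s i)
      = res x m (inf_le_right : U i ⊓ U j ≤ U j) (s j)) :
    ∃! t : grSections x m (⨆ i, U i), ∀ i, res x m (le_iSup U i) t = s i := by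
  have hex : ∀ p : ↥(⨆ i, U i), ∃ i, p.1 ∈ U i := fun p => Opens.mem_iSup.mp p.2
  choose k hk using hex
  have hag : ∀ (i j : ι) (p : X) (hi : p ∈ U i) (hj : p ∈ U j),
      (s i).1 ⟨p, hi⟩ = (s j).1 ⟨p, hj⟩ := fun i j p hi hj =>
    congrFun (congrArg Subtype.val (hs i j)) ⟨p, hi, hj⟩
  let t : ↥(⨆ i, U i) → Gr m := fun p => (s (k p)).1 ⟨p.1, hk p⟩
  have ht : t ∈ grSections x m (⨆ i, U i) := by
    intro p hp hsrc
    refine ((s (k ⟨p, hp⟩)).2 p (hk ⟨p, hp⟩) hsrc).congr_of_eventuallyEq ?_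
    filter_upwards [coordRep_eventually x (hk ⟨p, hp⟩) hsrc] with y hy
    have hy' : x.symm y ∈ ⨆ i, U i := Opens.mem_iSup.mpr ⟨_, hy⟩
    simp only [coordRep, hy, hy', dif_pos]
    exact hag _ _ _ _ _
  refine ⟨⟨t, ht⟩, fun i => ?_, fun t' ht' => ?_⟩
  · ext p
    exact hag _ _ _ _ _
  · ext p
    exact congrFun (congrArg Subtype.val (ht' (k p))) ⟨p.1, hk p⟩

/-- The model superspace `(E, C^∞ ⊗ Λ[ξ_1, …, ξ_m])`; it is `ℝ^{n|m}` for `E = ℝ^n`. -/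
abbrev stdSuper (E : Type) [NormedAddCommGroup E] [NormedSpace ℝ E] (m : ℕ) : SuperSpace.{0, 0} where
  carrier := E
  O V := grSections (OpenPartialHomeomorph.refl E) m V
  parity V := grSections.parity (OpenPartialHomeomorph.refl E) m V
  supercomm := grSections.supercomm
  res h := grSections.res (OpenPartialHomeomorph.refl E) m h
  res_mem h _ _ ha p := ha ⟨p.1, h p.2⟩
  res_self _ := rfl
  res_res _ _ _ := rfl
  glue := grSections.glue _ m

/-- Coordinates of dimension `n|m` on an open subset of `M`: a homeomorphism `x` of the open set
`U = x.source` with an open subset of `ℝ^n`, and an isomorphism of sheaves of super algebras from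
`O|_U` to the pull-back along `x` of `C^∞ ⊗ Λ[ξ_1, …, ξ_m]`. Together these are an isomorphism of
`(U, O|_U)` with an open subspace of `ℝ^{n|m}`. -/
structure SuperChart (M : SuperSpace.{u, v}) (n m : ℕ) where
  x : OpenPartialHomeomorph M (Fin n → ℝ)
  iso : ∀ V : Opens M, (V : Set M) ⊆ x.source → M.O V ≃ₐ[ℝ] grSections x m V
  iso_mem : ∀ (V : Opens M) (hV : (V : Set M) ⊆ x.source) (i : ZMod 2) (f : M.O V),
    iso V hV f ∈ grSections.parity x m V i ↔ f ∈ M.parity V i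
  iso_res : ∀ (V W : Opens M) (hV : (V : Set M) ⊆ x.source) (h : W ≤ V) (f : M.O V),
    iso W (fun _ hp => hV (h hp)) (M.res h f) = grSections.res x m h (iso V hV f)

/-- `M` is a supermanifold of dimension `n|m`: Hausdorff, with countable base, and locally isomorphic
to `ℝ^{n|m}`. -/
structure IsSupermanifold (M : SuperSpace.{u, v}) (n m : ℕ) : Prop where
  t2 : T2Space M
  secondCountable : SecondCountableTopology M
  chart_at : ∀ p : M, ∃ c : SuperChart M n m, p ∈ c.x.source

section derivations
variable {A : Type v} [Ring A] [Algebra ℝ A] (𝒜 : ZMod 2 → Submodule ℝ A) [GradedAlgebra 𝒜]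

/-- The component of parity `i` of a linear endomorphism of a super vector space. -/
def endComponent (i : ZMod 2) (φ : A →ₗ[ℝ] A) : A →ₗ[ℝ] A :=
  ∑ k : ZMod 2, GradedAlgebra.proj 𝒜 (i + k) ∘ₗ φ ∘ₗ GradedAlgebra.proj 𝒜 k

/-- `φ` is a derivation of the super algebra `A`: each homogeneous component `φ_i` satisfies
`φ_i(ab) = φ_i(a) b + (-1)^{i|a|} a φ_i(b)`. -/
def IsSuperDerivation (φ : A →ₗ[ℝ] A) : Prop :=
  ∀ (i j : ZMod 2) (a b : A), a ∈ 𝒜 j → endComponent 𝒜 i φ (a * b)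
    = endComponent 𝒜 i φ a * b + superSign i j • (a * endComponent 𝒜 i φ b)

variable {𝒜}

theorem endComponent_self {i : ZMod 2} {φ : A →ₗ[ℝ] A}
    (h : ∀ k, ∀ a ∈ 𝒜 k, φ a ∈ 𝒜 (i + k)) : endComponent 𝒜 i φ = φ := by
  ext a
  conv_rhs => rw [← sum_proj 𝒜 a, map_sum]
  rw [endComponent, LinearMap.sum_apply]
  refine Finset.sum_congr rfl fun k _ => ?_
  exact DirectSum.decompose_of_mem_same _ (h k _ (SetLike.coe_mem _))

theorem endComponent_ne {i j : ZMod 2} (hij : j ≠ i) {φ : A →ₗ[ℝ] A}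
    (h : ∀ k, ∀ a ∈ 𝒜 k, φ a ∈ 𝒜 (i + k)) : endComponent 𝒜 j φ = 0 := by
  ext a
  rw [endComponent, LinearMap.sum_apply]
  refine Finset.sum_eq_zero fun k _ => ?_
  exact DirectSum.decompose_of_mem_ne _ (h k _ (SetLike.coe_mem _))
    (fun e => hij (add_right_cancel e).symm)

theorem isSuperDerivation_of_homogeneous {i : ZMod 2} {φ : A →ₗ[ℝ] A}
    (h : ∀ k, ∀ a ∈ 𝒜 k, φ a ∈ 𝒜 (i + k))
    (hl : ∀ j a b, a ∈ 𝒜 j → φ (a * b) = φ a * b + superSign i j • (a * φ b)) :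
    IsSuperDerivation 𝒜 φ := by
  intro i' j a b ha
  by_cases hi : i' = i
  · subst hi
    rw [endComponent_self h]
    exact hl j a b ha
  · rw [endComponent_ne hi h]
    simp

theorem isSuperDerivation_add {φ ψ : A →ₗ[ℝ] A} (hφ : IsSuperDerivation 𝒜 φ)
    (hψ : IsSuperDerivation 𝒜 ψ) : IsSuperDerivation 𝒜 (φ + ψ) := by
  have e : ∀ i, endComponent 𝒜 i (φ + ψ) = endComponent 𝒜 i φ + endComponent 𝒜 i ψ := by
    intro i
    ext a
    simp [endComponent, LinearMap.sum_apply, Finset.sum_add_distrib]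
  intro i j a b ha
  simp only [e, LinearMap.add_apply, hφ i j a b ha, hψ i j a b ha, add_mul, mul_add, smul_add]
  abel

theorem endComponent_mulLeft (f : A) (i : ZMod 2) (φ : A →ₗ[ℝ] A) (a : A) :
    endComponent 𝒜 i (LinearMap.mulLeft ℝ f ∘ₗ φ) a
      = ∑ l, GradedAlgebra.proj 𝒜 l f * endComponent 𝒜 (i - l) φ a := by
  have hp : ∀ (r : ZMod 2) (b : A), GradedAlgebra.proj 𝒜 r (f * b)
      = ∑ l, GradedAlgebra.proj 𝒜 l f * GradedAlgebra.proj 𝒜 (r - l) b := by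
    intro r b
    conv_lhs => rw [← sum_proj 𝒜 f, Finset.sum_mul, map_sum]
    refine Finset.sum_congr rfl fun l _ => ?_
    have := DirectSum.coe_decompose_mul_add_of_left_mem 𝒜 (i := l) (j := r - l) (b := b)
      (a := GradedAlgebra.proj 𝒜 l f) (SetLike.coe_mem _)
    rw [add_sub_cancel] at this
    exact this
  simp only [endComponent, LinearMap.sum_apply, LinearMap.comp_apply, LinearMap.mulLeft_apply, hp,
    Finset.mul_sum]
  rw [Finset.sum_comm]
  simp only [add_sub_right_comm]

theorem isSuperDerivation_mulLeft
    (hc : ∀ {i j : ZMod 2} {a b : A}, a ∈ 𝒜 i → b ∈ 𝒜 j → a * b = superSign i j • (b * a))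
    (f : A) {φ : A →ₗ[ℝ] A} (hφ : IsSuperDerivation 𝒜 φ) :
    IsSuperDerivation 𝒜 (LinearMap.mulLeft ℝ f ∘ₗ φ) := by
  intro i j a b ha
  simp only [endComponent_mulLeft, hφ _ j a b ha, Finset.sum_mul, Finset.mul_sum, Finset.smul_sum]
  rw [← Finset.sum_add_distrib]
  refine Finset.sum_congr rfl fun l _ => ?_
  have hs : superSign (i - l) j * superSign l j = superSign i j := by
    have h2 : ∀ i l j : ZMod 2, ((if i - l = 1 ∧ j = 1 then (-1 : ℤ) else 1)
        * (if l = 1 ∧ j = 1 then (-1 : ℤ) else 1)) = if i = 1 ∧ j = 1 then (-1 : ℤ) else 1 := by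
      decide
    have := congrArg (Int.cast : ℤ → ℝ) (h2 i l j)
    simpa [superSign] using this
  have hcomm := hc (SetLike.coe_mem (DirectSum.decompose 𝒜 f l)) ha
  change GradedAlgebra.proj 𝒜 l f * a = _ • (a * GradedAlgebra.proj 𝒜 l f) at hcomm
  rw [mul_add, mul_smul_comm, ← mul_assoc, ← mul_assoc, hcomm, smul_mul_assoc, smul_smul, hs,
    mul_assoc a]

end derivations

/-- A section over `U` of the tangent sheaf: a derivation of the sheaf `O|_U`, that is, a derivation
of each `O(V)`, `V ⊆ U`, compatible with restriction. -/
structure VectorField (M : SuperSpace.{u, v}) (U : Opens M) where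
  toFun : ∀ V : Opens M, V ≤ U → M.O V →ₗ[ℝ] M.O V
  derivation : ∀ V hV, IsSuperDerivation (M.parity V) (toFun V hV)
  res_comm : ∀ (V W : Opens M) (hV : V ≤ U) (h : W ≤ V) (f : M.O V),
    toFun W (h.trans hV) (M.res h f) = M.res h (toFun V hV f)

namespace VectorField
variable {M : SuperSpace.{u, v}} {U : Opens M}

/-- The action of a vector field on `U` on a superfunction on `U`. -/
def app (X : VectorField M U) (f : M.O U) : M.O U := X.toFun U le_rfl f

/-- Restriction of a vector field to a smaller open set. -/
def restrict (X : VectorField M U) {V : Opens M} (h : V ≤ U) : VectorField M V where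
  toFun W hW := X.toFun W (hW.trans h)
  derivation W hW := X.derivation W (hW.trans h)
  res_comm W W' hW hW' f := X.res_comm W W' (hW.trans h) hW' f

/-- `X` is homogeneous of parity `i`. -/
def IsHomogeneous (X : VectorField M U) (i : ZMod 2) : Prop :=
  ∀ (V : Opens M) (hV : V ≤ U) (k : ZMod 2), ∀ a ∈ M.parity V k, X.toFun V hV a ∈ M.parity V (i + k)

instance : Add (VectorField M U) where
  add X Y :=
    { toFun := fun V hV => X.toFun V hV + Y.toFun V hV
      derivation := fun V hV => isSuperDerivation_add (X.derivation V hV) (Y.derivation V hV)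
      res_comm := fun V W hV h f => by
        simp only [LinearMap.add_apply, map_add, X.res_comm V W hV h, Y.res_comm V W hV h] }

instance : SMul (M.O U) (VectorField M U) where
  smul f X :=
    { toFun := fun V hV => LinearMap.mulLeft ℝ (M.res hV f) ∘ₗ X.toFun V hV
      derivation := fun V hV => isSuperDerivation_mulLeft M.supercomm _ (X.derivation V hV)
      res_comm := fun V W hV h g => by
        simp only [LinearMap.comp_apply, LinearMap.mulLeft_apply, map_mul, X.res_comm V W hV h,
          M.res_res] }

end VectorField

/-- A one-form on `U`: a section over `U` of the dual of the tangent sheaf, that is, a (left)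
`O`-linear morphism of sheaves `X ↦ ⟨X, ω⟩`. -/
structure OneForm (M : SuperSpace.{u, v}) (U : Opens M) where
  toFun : ∀ V : Opens M, V ≤ U → VectorField M V → M.O V
  map_add : ∀ V hV X Y, toFun V hV (X + Y) = toFun V hV X + toFun V hV Y
  map_smul : ∀ V hV (f : M.O V) X, toFun V hV (f • X) = f * toFun V hV X
  res_comm : ∀ (V W : Opens M) (hV : V ≤ U) (h : W ≤ V) (X : VectorField M V),
    toFun W (h.trans hV) (X.restrict h) = M.res h (toFun V hV X)

/-- A graded Riemannian metric: a graded-symmetric, even, non-degenerate `O`-bilinear morphism of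
sheaves. Non-degeneracy: the map from vector fields to one-forms is bijective on every open set; as
one-forms are written here as left-linear forms, it is `X ↦ ⟨·, X⟩`, which agrees with `X ↦ ⟨X, ·⟩` up
to the sign `(-1)^{|X||·|}`. -/
structure GradedMetric (M : SuperSpace.{u, v}) where
  toFun : ∀ U : Opens M, VectorField M U → VectorField M U → M.O U
  res_comm : ∀ (U V : Opens M) (h : V ≤ U) (X Y : VectorField M U),
    toFun V (X.restrict h) (Y.restrict h) = M.res h (toFun U X Y)
  add_left : ∀ U X Y Z, toFun U (X + Y) Z = toFun U X Z + toFun U Y Z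
  add_right : ∀ U X Y Z, toFun U X (Y + Z) = toFun U X Y + toFun U X Z
  smul_left : ∀ U (f : M.O U) X Y, toFun U (f • X) Y = f * toFun U X Y
  even : ∀ U i j (X Y : VectorField M U), X.IsHomogeneous i → Y.IsHomogeneous j →
    toFun U X Y ∈ M.parity U (i + j)
  symm : ∀ U i j (X Y : VectorField M U), X.IsHomogeneous i → Y.IsHomogeneous j →
    toFun U X Y = superSign i j • toFun U Y X
  nondegenerate : ∀ (U : Opens M) (w : OneForm M U), ∃! X : VectorField M U,
    ∀ (V : Opens M) (hV : V ≤ U) (Y : VectorField M V),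
      w.toFun V hV Y = toFun V Y (X.restrict hV)

/-- A connection on `M`, written as `(X, Y) ↦ ∇_X Y`. -/
structure Connection (M : SuperSpace.{u, v}) where
  toFun : ∀ U : Opens M, VectorField M U → VectorField M U → VectorField M U
  res_comm : ∀ (U V : Opens M) (h : V ≤ U) (X Y : VectorField M U),
    toFun V (X.restrict h) (Y.restrict h) = (toFun U X Y).restrict h
  add_left : ∀ U X Y Z, toFun U (X + Y) Z = toFun U X Z + toFun U Y Z
  add_right : ∀ U X Y Z, toFun U X (Y + Z) = toFun U X Y + toFun U X Z
  smul_left : ∀ U (f : M.O U) X Y, toFun U (f • X) Y = f • toFun U X Y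
  leibniz : ∀ U i j (X Y : VectorField M U) (f : M.O U), X.IsHomogeneous i → f ∈ M.parity U j →
    toFun U X (f • Y) = X.app f • Y + (superSign i j • f) • toFun U X Y
  even : ∀ U i j (X Y : VectorField M U), X.IsHomogeneous i → Y.IsHomogeneous j →
    (toFun U X Y).IsHomogeneous (i + j)

/-- `∇_X Y - (-1)^{|X||Y|} ∇_Y X = [X, Y]`. -/
def Connection.Torsionless {M : SuperSpace.{u, v}} (nab : Connection M) : Prop :=
  ∀ U i j (X Y : VectorField M U), X.IsHomogeneous i → Y.IsHomogeneous j →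
    ∀ (V : Opens M) (hV : V ≤ U) (f : M.O V),
      (nab.toFun U X Y).toFun V hV f - superSign i j • (nab.toFun U Y X).toFun V hV f
        = X.toFun V hV (Y.toFun V hV f) - superSign i j • Y.toFun V hV (X.toFun V hV f)

/-- `X⟨Y, Z⟩ = ⟨∇_X Y, Z⟩ + (-1)^{|X||Y|} ⟨Y, ∇_X Z⟩`. -/
def Connection.Metric {M : SuperSpace.{u, v}} (nab : Connection M) (G : GradedMetric M) : Prop :=
  ∀ U i j (X Y Z : VectorField M U), X.IsHomogeneous i → Y.IsHomogeneous j →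
    X.app (G.toFun U Y Z)
      = G.toFun U (nab.toFun U X Y) Z + superSign i j • G.toFun U Y (nab.toFun U X Z)

/-- `∇` is the Levi-Civita connection of the metric: torsionless and metric. -/
def Connection.IsLeviCivita {M : SuperSpace.{u, v}} (nab : Connection M) (G : GradedMetric M) :
    Prop := nab.Torsionless ∧ nab.Metric G

namespace SuperChart
variable {M : SuperSpace.{u, v}} {n m : ℕ} (c : SuperChart M n m)

/-- The coordinate domain `U`. -/
def dom : Opens M := ⟨c.x.source, c.x.open_source⟩

/-- The coordinates `η = (x_i, ξ_α)`, as superfunctions on the coordinate domain. -/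
def coord : Fin n ⊕ Fin m → M.O c.dom
  | .inl i => (c.iso c.dom subset_rfl).symm
      ⟨fun p => algebraMap ℝ (Gr m) (c.x p i), by
        intro p hp hs
        have h : ContDiffAt ℝ ∞ (fun y : Fin n → ℝ => (Algebra.linearMap ℝ (Gr m)) (y i)) (c.x p) :=
          (LinearMap.toContinuousLinearMap (Algebra.linearMap ℝ (Gr m))).contDiff.contDiffAt.comp _
            (contDiff_apply ℝ ℝ i).contDiffAt
        refine h.congr_of_eventuallyEq ?_
        filter_upwards [coordRep_eventually c.x hp hs, c.x.open_target.mem_nhds (c.x.map_source hs)]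
          with y hy hy'
        simp [coordRep, hy, c.x.right_inv hy']⟩
  | .inr α => (c.iso c.dom subset_rfl).symm
      ⟨fun _ => ExteriorAlgebra.ι ℝ (Pi.single α 1), by
        intro p hp hs
        refine (contDiffAt_const (c := ExteriorAlgebra.ι ℝ (Pi.single α (1 : ℝ)))).congr_of_eventuallyEq ?_
        filter_upwards [coordRep_eventually c.x hp hs] with y hy
        simp [coordRep, hy]⟩

/-- `∂_{x_i}` and `∂_{ξ_α}` on `Λ`-valued functions; the latter is the odd derivation with
`∂_{ξ_α} ξ_β = δ_{αβ}`, which Mathlib calls contraction. -/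
def localPartial (V : Opens M) (hV : (V : Set M) ⊆ c.x.source) :
    Fin n ⊕ Fin m → grSections c.x m V →ₗ[ℝ] grSections c.x m V
  | .inl i => grSections.dir c.x m V hV (Pi.single i 1)
  | .inr α => grSections.mapLin c.x m V (CliffordAlgebra.contractLeft (LinearMap.proj α))

/-- The parity of a coordinate. -/
def coordParity : Fin n ⊕ Fin m → ZMod 2
  | .inl _ => 0
  | .inr _ => 1

theorem iso_symm_mem (V : Opens M) (hV : (V : Set M) ⊆ c.x.source) (i : ZMod 2)
    (g : grSections c.x m V) (hg : g ∈ grSections.parity c.x m V i) :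
    (c.iso V hV).symm g ∈ M.parity V i := by
  rw [← c.iso_mem V hV, AlgEquiv.apply_symm_apply]
  exact hg

theorem localPartial_mem (V : Opens M) (hV : (V : Set M) ⊆ c.x.source) (k : Fin n ⊕ Fin m)
    (i : ZMod 2) (f : grSections c.x m V) (hf : f ∈ grSections.parity c.x m V i) :
    c.localPartial V hV k f ∈ grSections.parity c.x m V (coordParity k + i) := by
  rcases k with k | α
  · rw [coordParity, zero_add]
    exact grSections.dir_mem _ _ _ hV _ _ _ hf
  · exact fun p => gr_contract_mem _ _ _ (hf p)

theorem localPartial_mul (V : Opens M) (hV : (V : Set M) ⊆ c.x.source) (k : Fin n ⊕ Fin m)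
    (j : ZMod 2) (f g : grSections c.x m V) (hf : f ∈ grSections.parity c.x m V j) :
    c.localPartial V hV k (f * g) = c.localPartial V hV k f * g
      + superSign (coordParity k) j • (f * c.localPartial V hV k g) := by
  rcases k with k | α
  · simp only [coordParity, localPartial, superSign, grSections.dir_mul]
    simp
  · ext p
    change CliffordAlgebra.contractLeft _ (f.1 p * g.1 p)
      = CliffordAlgebra.contractLeft _ (f.1 p) * g.1 p
        + superSign 1 j • (f.1 p * CliffordAlgebra.contractLeft _ (g.1 p))
    rw [gr_contract_mul, gr_involute (hf p), smul_mul_assoc]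

theorem localPartial_res (V W : Opens M) (hV : (V : Set M) ⊆ c.x.source) (h : W ≤ V)
    (k : Fin n ⊕ Fin m) (f : grSections c.x m V) :
    c.localPartial W (fun _ hp => hV (h hp)) k (grSections.res c.x m h f)
      = grSections.res c.x m h (c.localPartial V hV k f) := by
  rcases k with k | α
  · exact (grSections.dir_res c.x m hV h _ f).symm
  · rfl

/-- The coordinate vector fields `∂_{x_i}`, `∂_{ξ_α}` on the coordinate domain. -/
def partialField (k : Fin n ⊕ Fin m) : VectorField M c.dom where
  toFun V hV := (c.iso V hV).symm.toLinearMap ∘ₗ c.localPartial V hV k ∘ₗ (c.iso V hV).toLinearMap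
  derivation V hV := by
    refine isSuperDerivation_of_homogeneous (i := coordParity k) (fun j a ha => ?_)
      fun j a b ha => ?_
    · exact c.iso_symm_mem V hV _ _ (c.localPartial_mem V hV k j _ ((c.iso_mem V hV j a).2 ha))
    · apply (c.iso V hV).injective
      simp only [LinearMap.comp_apply, AlgEquiv.toLinearMap_apply, map_add, map_mul, map_smul,
        AlgEquiv.apply_symm_apply]
      exact c.localPartial_mul V hV k j _ _ ((c.iso_mem V hV j a).2 ha)
  res_comm V W hV h f := by
    apply (c.iso W (fun _ hp => hV (h hp))).injective
    simp only [LinearMap.comp_apply, AlgEquiv.toLinearMap_apply, AlgEquiv.apply_symm_apply,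
      c.iso_res V W hV h]
    exact c.localPartial_res V W hV h k _

/-- The Christoffel symbol `Γ_{ij}^k`: the coefficient of `∂_k` in `∇_{∂_i} ∂_j`, which is the value of
that vector field on the coordinate `η_k`. -/
def christoffel (nab : Connection M) (i j k : Fin n ⊕ Fin m) : M.O c.dom :=
  (nab.toFun c.dom (c.partialField i) (c.partialField j)).app (c.coord k)

end SuperChart
/-- The germ of `f - r` at `p` is not invertible. -/
def SuperSpace.HasValue (M : SuperSpace.{u, v}) {U : Opens M} (f : M.O U) (p : M) (r : ℝ) : Prop :=
  ∀ (V : Opens M) (hV : V ≤ U), p ∈ V → ¬ IsUnit (M.res hV f - algebraMap ℝ (M.O V) r)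

/-- The value of `f` at `p`: the unique real number `r` for which the germ of `f - r` at `p` is not
invertible. -/
def SuperSpace.value (M : SuperSpace.{u, v}) {U : Opens M} (f : M.O U) (p : M) : ℝ :=
  Classical.epsilon (M.HasValue f p)

/-- A tangent vector at `p`: a derivation `τ` of the stalk at `p` with values in `ℝ`, given by its
values on sections near `p`. The sign in `τ(fg) = τ(f) g(p) + (-1)^{|τ||f|} f(p) τ(g)` plays no role,
since `f(p) = 0` for odd `f`. -/
structure TangentVector (M : SuperSpace.{u, v}) (p : M) where
  toFun : ∀ V : Opens M, p ∈ V → M.O V →ₗ[ℝ] ℝ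
  res_comm : ∀ (V W : Opens M) (h : W ≤ V) (hp : p ∈ W) (f : M.O V),
    toFun W hp (M.res h f) = toFun V (h hp) f
  leibniz : ∀ (V : Opens M) (hp : p ∈ V) (f g : M.O V),
    toFun V hp (f * g) = toFun V hp f * M.value g p + M.value f p * toFun V hp g

/-- The open subset `f⁻¹(W)` of `X`, for a map `f` defined on an open subset `U` of `X`. -/
def preimageOpens {X : Type u} {Y : Type w} [TopologicalSpace X] [TopologicalSpace Y] {U : Opens X}
    (f : C(U, Y)) (W : Opens Y) : Opens X :=
  ⟨Subtype.val '' (f ⁻¹' W), U.isOpen.isOpenMap_subtype_val _ (W.isOpen.preimage f.continuous)⟩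

theorem preimageOpens_mono {X : Type u} {Y : Type w} [TopologicalSpace X] [TopologicalSpace Y]
    {U : Opens X} (f : C(U, Y)) {W W' : Opens Y} (h : W' ≤ W) :
    preimageOpens f W' ≤ preimageOpens f W :=
  Set.image_mono (Set.preimage_mono h)

theorem preimageOpens_restrict {X : Type u} {Y : Type w} [TopologicalSpace X] [TopologicalSpace Y]
    {U U' : Opens X} (f : C(U, Y)) (h : U' ≤ U) (W : Opens Y) :
    preimageOpens (f.comp (ContinuousMap.inclusion h)) W ≤ preimageOpens f W := by
  rintro _ ⟨p, hp, rfl⟩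
  exact ⟨⟨p.1, h p.2⟩, hp, rfl⟩

/-- A morphism from the open subspace `(U, O_M|_U)` of `M` to `N`: a continuous map and a morphism of
sheaves of super algebras. -/
structure SuperMap (M : SuperSpace.{u, v}) (U : Opens M) (N : SuperSpace.{w, z}) where
  base : C(U, N)
  pull : ∀ W : Opens N, N.O W →ₐ[ℝ] M.O (preimageOpens base W)
  pull_mem : ∀ (W : Opens N) (i : ZMod 2), ∀ f ∈ N.parity W i,
    pull W f ∈ M.parity (preimageOpens base W) i
  pull_res : ∀ (W W' : Opens N) (h : W' ≤ W) (f : N.O W),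
    pull W' (N.res h f) = M.res (preimageOpens_mono base h) (pull W f)

/-- Restriction of a morphism to a smaller open subspace. -/
def SuperMap.restrict {M : SuperSpace.{u, v}} {U : Opens M} {N : SuperSpace.{w, z}}
    (φ : SuperMap M U N) {U' : Opens M} (h : U' ≤ U) : SuperMap M U' N where
  base := φ.base.comp (ContinuousMap.inclusion h)
  pull W := (M.res (preimageOpens_restrict φ.base h W)).comp (φ.pull W)
  pull_mem W i f hf := M.res_mem _ (φ.pull_mem W i f hf)
  pull_res W W' hW f := by
    simp only [AlgHom.comp_apply, φ.pull_res W W' hW, M.res_res]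

/-- `ℝ^{1|1}`. -/
abbrev superLine : SuperSpace.{0, 0} := stdSuper ℝ 1

/-- Supercurves in `M` with domain `I^{1|1}`, the open subspace of `ℝ^{1|1}` over `I ⊆ ℝ`. -/
abbrev SuperCurve (I : Opens ℝ) (M : SuperSpace.{u, v}) := SuperMap superLine I M

namespace superLine

/-- The vector field `∂_t` on `ℝ^{1|1}`. -/
def dt (W : Opens ℝ) : superLine.O W →ₗ[ℝ] superLine.O W :=
  grSections.dir (OpenPartialHomeomorph.refl ℝ) 1 W (Set.subset_univ _) (1 : ℝ)

/-- The vector field `∂_ξ` on `ℝ^{1|1}`. -/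
def dxi (W : Opens ℝ) : superLine.O W →ₗ[ℝ] superLine.O W :=
  grSections.mapLin (OpenPartialHomeomorph.refl ℝ) 1 W
    (CliffordAlgebra.contractLeft (LinearMap.proj (0 : Fin 1)))

/-- The odd coordinate `ξ` of `ℝ^{1|1}`. -/
def xi : Gr 1 := ExteriorAlgebra.ι ℝ (Pi.single 0 1)

/-- The reduction `f̃` of a superfunction `f` on `W ⊆ ℝ^{1|1}` (extended by `0`). -/
def reduced {W : Opens ℝ} (f : superLine.O W) (t : ℝ) : ℝ :=
  ExteriorAlgebra.algebraMapInv (coordRep (OpenPartialHomeomorph.refl ℝ) f.1 t)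

end superLine

namespace SuperCurve
variable {I : Opens ℝ} {M : SuperSpace.{u, v}} {n m : ℕ}

/-- The vector field `dγ(∂_t) = ∂_t ∘ γ^*` along `γ`. -/
def velT (γ : SuperCurve I M) (U : Opens M) :
    M.O U →ₗ[ℝ] superLine.O (preimageOpens γ.base U) :=
  superLine.dt _ ∘ₗ (γ.pull U).toLinearMap

/-- The vector field `dγ(∂_ξ) = ∂_ξ ∘ γ^*` along `γ`. -/
def velXi (γ : SuperCurve I M) (U : Opens M) :
    M.O U →ₗ[ℝ] superLine.O (preimageOpens γ.base U) :=
  superLine.dxi _ ∘ₗ (γ.pull U).toLinearMap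

/-- The coefficient of `γ^* ∘ ∂_k` in `(∇/dt) X`, where `X = ∑ f_j (γ^* ∘ ∂_j)`, `f_j = X(η_j)`, namely
`∂_t f_k + ∑_{i,j} f_j ∂_t(γ^* η_i) γ^* Γ_{ij}^k`. -/
def covDtCoeff (nab : Connection M) (γ : SuperCurve I M) (c : SuperChart M n m)
    (X : M.O c.dom →ₗ[ℝ] superLine.O (preimageOpens γ.base c.dom)) (k : Fin n ⊕ Fin m) :
    superLine.O (preimageOpens γ.base c.dom) :=
  superLine.dt _ (X (c.coord k)) + ∑ i, ∑ j, X (c.coord j) *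
    superLine.dt _ (γ.pull c.dom (c.coord i)) * γ.pull c.dom (c.christoffel nab i j k)

/-- The covariant derivative `(∇/dt) X` of a vector field along `γ`, in the given coordinates. -/
def covDt (nab : Connection M) (γ : SuperCurve I M) (c : SuperChart M n m)
    (X : M.O c.dom →ₗ[ℝ] superLine.O (preimageOpens γ.base c.dom)) :
    M.O c.dom →ₗ[ℝ] superLine.O (preimageOpens γ.base c.dom) :=
  ∑ k, LinearMap.mulLeft ℝ (covDtCoeff nab γ c X k) ∘ₗ (γ.pull c.dom).toLinearMap ∘ₗ
    (c.partialField k).toFun c.dom le_rfl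

/-- `X̃ = 0`, for a vector field `X` along `γ`: at each `t` the induced tangent vector
`f ↦ (X f)(t)` at `γ(t)` is zero. -/
def ReducedVanishes {γ : SuperCurve I M} {U : Opens M}
    (X : M.O U →ₗ[ℝ] superLine.O (preimageOpens γ.base U)) : Prop :=
  ∀ f : M.O U, ∀ t ∈ preimageOpens γ.base U, superLine.reduced (X f) t = 0

/-- `γ` is a supergeodesic: the reductions of `(∇/dt) dγ(∂_t)` and `(∇/dt) dγ(∂_ξ)` vanish. -/
def IsSupergeodesic (n m : ℕ) (nab : Connection M) (γ : SuperCurve I M) : Prop :=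
  ∀ c : SuperChart M n m, ReducedVanishes (covDt nab γ c (γ.velT c.dom)) ∧
    ReducedVanishes (covDt nab γ c (γ.velXi c.dom))

/-- The reduction of `(∇/dt) dγ(∂_ξ)` vanishes. -/
def OddCondition (n m : ℕ) (nab : Connection M) (γ : SuperCurve I M) : Prop :=
  ∀ c : SuperChart M n m, ReducedVanishes (covDt nab γ c (γ.velXi c.dom))

/-- `γ(0) = p` and `d_0γ(∂_t + ∂_ξ) = τ`. -/
def HasInitial (γ : SuperCurve I M) (h0 : (0 : ℝ) ∈ I) {p : M} (τ : TangentVector M p) : Prop :=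
  γ.base ⟨0, h0⟩ = p ∧ ∀ (U : Opens M) (hp : p ∈ U) (f : M.O U),
    superLine.reduced ((γ.velT U + γ.velXi U) f) 0 = τ.toFun U hp f

/-- The function `g_i` in `γ^* x_i = g_i`. -/
def evenCoord (γ : SuperCurve I M) (c : SuperChart M n m) (i : Fin n) (t : ℝ) : ℝ :=
  superLine.reduced (γ.pull c.dom (c.coord (.inl i))) t

/-- The function `h_α` in `γ^* ξ_α = h_α ξ`. -/
def oddCoord (γ : SuperCurve I M) (c : SuperChart M n m) (α : Fin m) (t : ℝ) : ℝ :=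
  superLine.reduced (superLine.dxi _ (γ.pull c.dom (c.coord (.inr α)))) t

end SuperCurve

namespace GradedMetric
variable {M : SuperSpace.{u, v}} {n m : ℕ} (G : GradedMetric M) (c : SuperChart M n m)

/-- The matrix of the induced pseudo-Riemannian metric of `M_red` in the coordinates `x_i`. -/
def redMetric (y : Fin n → ℝ) : Matrix (Fin n) (Fin n) ℝ := Matrix.of fun i j =>
  ExteriorAlgebra.algebraMapInv (coordRep c.x
    (c.iso c.dom subset_rfl (G.toFun c.dom (c.partialField (.inl i)) (c.partialField (.inl j)))).1 y)

/-- `∂_l g_{ij}` for the metric of `M_red`. -/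
def redMetricDeriv (l i j : Fin n) (y : Fin n → ℝ) : ℝ :=
  fderiv ℝ (fun z => G.redMetric c z i j) y (Pi.single l 1)

/-- The Christoffel symbols `Γ_{ij}^k` of the Levi-Civita connection of `M_red`. -/
def redChristoffel (i j k : Fin n) (y : Fin n → ℝ) : ℝ :=
  (1 / 2) * ∑ l, (G.redMetric c y)⁻¹ k l *
    (G.redMetricDeriv c i j l y + G.redMetricDeriv c j i l y - G.redMetricDeriv c l i j y)

/-- The coordinates `x_i(σ(t))` of a curve. -/
def curveCoord {I : Opens ℝ} (σ : C(I, M)) (t : ℝ) : Fin n → ℝ :=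
  open Classical in if h : t ∈ I then c.x (σ ⟨t, h⟩) else 0

/-- `σ` is a smooth curve in `M_red` and a geodesic of its pseudo-Riemannian metric. -/
def IsRedGeodesic (n m : ℕ) {I : Opens ℝ} (σ : C(I, M)) : Prop :=
  ∀ c : SuperChart M n m, ContDiffOn ℝ ∞ (curveCoord c σ) (preimageOpens σ c.dom) ∧
    ∀ t ∈ preimageOpens σ c.dom, ∀ k, deriv (deriv fun s => curveCoord c σ s k) t
      + ∑ i, ∑ j, G.redChristoffel c i j k (curveCoord c σ t)
        * deriv (fun s => curveCoord c σ s i) t * deriv (fun s => curveCoord c σ s j) t = 0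

/-- `σ` is a geodesic of `M_red` with `σ(0) = p` whose velocity at `0` is the even part of `τ`. -/
def IsRedGeodesicFrom (n m : ℕ) {I : Opens ℝ} (h0 : (0 : ℝ) ∈ I) (σ : C(I, M)) {p : M}
    (τ : TangentVector M p) : Prop :=
  G.IsRedGeodesic n m σ ∧ σ ⟨0, h0⟩ = p ∧
    ∀ (c : SuperChart M n m) (hp : p ∈ c.dom) (i : Fin n),
      deriv (fun s => curveCoord c σ s i) 0 = τ.toFun c.dom hp (c.coord (.inl i))

end GradedMetric

end

end SuperGeometry

open SuperGeometry

/-!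
A supercurve `γ : I^{1|1} → M` is determined by its underlying curve `γ̃` and by the tangent vectors of
`M` along `γ̃` that are induced by `dγ(∂_ξ)`, because `γ^* f = f(γ̃) + (dγ(∂_ξ) f)~ ξ`
(`SuperCurve.ext_of_sameAt`). By parity, `dγ(∂_t)` induces even and `dγ(∂_ξ)` odd tangent vectors; their
components are the derivatives `g_i'` and the functions `h_α`. That a tangent vector is a combination of
the coordinate derivations (`TangentVector.eq_sum`) is Hadamard's lemma.

The reduced Christoffel symbols with an odd number of odd indices vanish, and those with even indices
are the Christoffel symbols of `M_red` (`SuperChart.value_christoffel`): the reductions of the torsion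
and metric conditions are those that determine the Levi-Civita connection of the reduced metric, which
is non-degenerate. Hence the reduction of `(∇/dt) dγ(∂_t)` is the geodesic equation of the underlying
curve (`SuperCurve.isRedGeodesic_iff`), and the reduction of `(∇/dt) dγ(∂_ξ)` is a linear system
`h' + A h = 0` along it (`SuperCurve.reducedVanishes_velXi_iff`). The vanishing of these reductions at a
parameter value does not depend on the chart (`SuperCurve.IsField.covDtCoeff_eq_zero`), because
`(∇/dt) X`, applied to a function `f`, is the derivative of `X f` minus the Hessian of `f` on
`dγ(∂_t)` and `X`, and the Hessian is a tensor.

Uniqueness is then the uniqueness theorem for ordinary differential equations, first for the underlying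
curve (`SuperCurve.forall_samePointAt`) and then for the odd velocity (`SuperCurve.forall_sameAt`). All
supergeodesics with given initial data glue to the maximal one (`SuperCurve.exists_maximal`). If the
underlying geodesic continued beyond an end point `b` of its domain, one could solve the odd equations
on a neighbourhood of `b`; because they are linear, this neighbourhood does not depend on the initial
value (`SuperCurve.exists_odd_solution`), which can therefore be prescribed at a parameter value that
has been reached already, so that the supergeodesic could be prolonged
(`SuperCurve.le_of_isRedGeodesicFrom`).
-/

namespace SuperGeometry

/-! ### Smooth functions and ordinary differential equations -/

section Analysis

open MeasureTheory Set
open scoped Convolution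

/-- The parametric integral over `[0, 1]` is, at `0`, the convolution of the indicator function of
`[0, 1]` with `s ↦ φ y (-s)`, cut off; this gives smoothness in the parameter. -/
theorem contDiff_integral_unitInterval {E F : Type*} [NormedAddCommGroup E] [NormedSpace ℝ E]
    [NormedAddCommGroup F] [NormedSpace ℝ F] [CompleteSpace F]
    {φ : E → ℝ → F} (hφ : ContDiff ℝ ∞ (Function.uncurry φ)) :
    ContDiff ℝ ∞ (fun y => ∫ s in (0 : ℝ)..1, φ y s) := by
  let χ : ContDiffBump (0 : ℝ) := ⟨1, 2, by norm_num, by norm_num⟩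
  have key : ContDiffOn ℝ ∞ (fun y : E => ((Icc (0 : ℝ) 1).indicator (fun _ => (1 : ℝ))
      ⋆[ContinuousLinearMap.lsmul ℝ ℝ, volume] (fun s => χ s • φ y (-s))) 0) univ := by
    refine contDiffOn_convolution_right_with_param_comp (n := ⊤) (k := tsupport χ) _
      contDiffOn_const isOpen_univ χ.hasCompactSupport ?_ ?_ ?_
    · intro p x _ hx
      simp [image_eq_zero_of_notMem_tsupport hx]
    · exact ((integrable_indicator_iff measurableSet_Icc).2 (by simp)).locallyIntegrable
    · have h1 : ContDiff ℝ ∞ (fun q : E × ℝ => χ q.2 • φ q.1 (-q.2)) :=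
        (χ.contDiff.comp contDiff_snd).smul
          (hφ.comp (contDiff_fst.prodMk contDiff_snd.neg))
      exact h1.contDiffOn
  rw [contDiffOn_univ] at key
  convert key using 2 with y
  rw [MeasureTheory.convolution, intervalIntegral.integral_of_le zero_le_one,
    ← integral_Icc_eq_integral_Ioc, ← integral_indicator measurableSet_Icc]
  refine integral_congr_ae (Filter.Eventually.of_forall fun s => ?_)
  by_cases hs : s ∈ Icc (0 : ℝ) 1
  · have : χ (-s) = 1 := χ.one_of_mem_closedBall (by
      rw [mem_closedBall_zero_iff, norm_neg, Real.norm_of_nonneg hs.1]; exact hs.2)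
    simp [hs, this]
  · simp [hs]

theorem map_eq_sum_single {n : ℕ} {F : Type*} [NormedAddCommGroup F] [NormedSpace ℝ F]
    (L : (Fin n → ℝ) →L[ℝ] F) (v : Fin n → ℝ) : L v = ∑ i, v i • L (Pi.single i 1) := by
  conv_lhs => rw [← Finset.univ_sum_single v, map_sum]
  refine Finset.sum_congr rfl fun i _ => ?_
  rw [← L.map_smul, ← Pi.single_smul]
  simp

/-- Hadamard's lemma: a function that is smooth near `a` is, near `a`, of the form
`f a + ∑ i, (y i - a i) • G i y` with smooth functions `G i`. -/
theorem exists_hadamard {n : ℕ} {F : Type*} [NormedAddCommGroup F] [NormedSpace ℝ F]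
    [CompleteSpace F] {f : (Fin n → ℝ) → F} {a : Fin n → ℝ}
    (hf : ∀ᶠ y in 𝓝 a, ContDiffAt ℝ ∞ f y) :
    ∃ G : Fin n → (Fin n → ℝ) → F, (∀ i, ContDiff ℝ ∞ (G i)) ∧
      ∀ᶠ y in 𝓝 a, f y = f a + ∑ i, (y i - a i) • G i y := by
  obtain ⟨r, hr, hball⟩ := Metric.eventually_nhds_iff_ball.1 hf
  let χ : ContDiffBump a := ⟨r / 3, r / 2, by positivity, by linarith⟩
  -- the cut-off `χ • f` is smooth everywhere and agrees with `f` near `a`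
  let g : (Fin n → ℝ) → F := fun y => χ y • f y
  have hg : ContDiff ℝ ∞ g := by
    rw [contDiff_iff_contDiffAt]
    intro y
    by_cases hy : y ∈ Metric.ball a r
    · exact χ.contDiff.contDiffAt.smul (hball y hy)
    · have : y ∉ tsupport χ := by
        rw [χ.tsupport_eq]
        intro h
        exact hy (Metric.closedBall_subset_ball (by change r / 2 < r; linarith) h)
      have h0 : χ =ᶠ[𝓝 y] 0 := notMem_tsupport_iff_eventuallyEq.1 this
      refine (contDiffAt_const (c := (0 : F))).congr_of_eventuallyEq ?_
      filter_upwards [h0] with z hz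
      simp [g, hz]
  have hgf : ∀ᶠ y in 𝓝 a, g y = f y := by
    filter_upwards [χ.eventuallyEq_one] with y hy
    simp [g, hy]
  let φ : Fin n → (Fin n → ℝ) → ℝ → F := fun i y s =>
    fderiv ℝ g (a + s • (y - a)) (Pi.single i 1)
  have hφ : ∀ i, ContDiff ℝ ∞ (Function.uncurry (φ i)) := by
    intro i
    have h1 : ContDiff ℝ ∞ (fderiv ℝ g) := hg.fderiv_right (by simp)
    have h2 : ContDiff ℝ ∞ (fun q : (Fin n → ℝ) × ℝ => a + q.2 • (q.1 - a)) := by fun_prop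
    exact (h1.comp h2).clm_apply contDiff_const
  refine ⟨fun i y => ∫ s in (0 : ℝ)..1, φ i y s,
    fun i => contDiff_integral_unitInterval (hφ i), ?_⟩
  have main : ∀ y, g y = g a + ∑ i, (y i - a i) • ∫ s in (0 : ℝ)..1, φ i y s := by
    intro y
    have hd : ∀ s : ℝ, HasDerivAt (fun s : ℝ => g (a + s • (y - a)))
        (∑ i, (y i - a i) • φ i y s) s := by
      intro s
      have h1 : HasDerivAt (fun s : ℝ => a + s • (y - a)) (y - a) s := by
        simpa using ((hasDerivAt_id s).smul_const (y - a)).const_add a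
      have h2 := ((hg.differentiable (by simp)) (a + s • (y - a))).hasFDerivAt.comp_hasDerivAt s h1
      rw [map_eq_sum_single] at h2
      exact h2
    have hc : ∀ i, Continuous (φ i y) := fun i =>
      (hφ i).continuous.comp (Continuous.prodMk_right y)
    have h3 := intervalIntegral.integral_eq_sub_of_hasDerivAt (a := (0 : ℝ)) (b := 1)
      (fun s _ => hd s)
      ((continuous_finsetSum _ fun i _ => (hc i).const_smul _).intervalIntegrable _ _)
    rw [intervalIntegral.integral_finsetSum
      (fun i _ => (show Continuous fun s => (y i - a i) • φ i y s from
        (hc i).const_smul _).intervalIntegrable _ _)] at h3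
    simp only [intervalIntegral.integral_smul] at h3
    rw [h3]
    simp
  filter_upwards [hgf] with y hy
  rw [← hy, ← hgf.self_of_nhds]
  exact main y

/-- Smooth local solutions of a smooth autonomous system. -/
theorem ode_exists {E : Type*} [NormedAddCommGroup E] [NormedSpace ℝ E] [CompleteSpace E]
    {F : E → E} {s : Set E} (hs : IsOpen s) (hF : ContDiffOn ℝ ∞ F s) {u₀ : E} (hu : u₀ ∈ s)
    (t₀ : ℝ) : ∃ ε > (0 : ℝ), ∃ α : ℝ → E, α t₀ = u₀ ∧ ContDiffOn ℝ ∞ α (Ioo (t₀ - ε) (t₀ + ε)) ∧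
      ∀ t ∈ Ioo (t₀ - ε) (t₀ + ε), α t ∈ s ∧ HasDerivAt α (F (α t)) t := by
  obtain ⟨α, h0, ε, hε, hα⟩ :=
    ((hF.contDiffAt (hs.mem_nhds hu)).of_le
      (by simp)).exists_forall_mem_closedBall_exists_eq_forall_mem_Ioo_hasDerivAt₀ t₀
  have hc : ContinuousAt α t₀ := (hα t₀ ⟨by linarith, by linarith⟩).continuousAt
  have hm : ∀ᶠ t in 𝓝 t₀, α t ∈ s := hc (by rw [h0]; exact hs.mem_nhds hu)
  obtain ⟨δ, hδ, hball⟩ := Metric.eventually_nhds_iff_ball.1 hm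
  rw [Real.ball_eq_Ioo] at hball
  let η := min ε δ / 2
  have hη : 0 < η := by positivity
  have hη1 : η < ε := by
    have := min_le_left ε δ
    simp only [η]; linarith
  have hη2 : η < δ := by
    have := min_le_right ε δ
    simp only [η]; linarith
  have hmem : ∀ t ∈ Icc (t₀ - η) (t₀ + η), α t ∈ s ∧ HasDerivAt α (F (α t)) t := fun t ht =>
    ⟨hball t ⟨by linarith [ht.1], by linarith [ht.2]⟩,
      hα t ⟨by linarith [ht.1], by linarith [ht.2]⟩⟩
  refine ⟨η, hη, α, h0, ?_, fun t ht => hmem t (Ioo_subset_Icc_self ht)⟩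
  refine (ODE.contDiffOn_enat_Icc_of_hasDerivWithinAt (n := ⊤) (f := fun _ => F) (u := s) ?_
    (fun t ht => (hmem t ht).2.hasDerivWithinAt) fun t ht => (hmem t ht).1).mono Ioo_subset_Icc_self
  exact hF.comp contDiffOn_snd fun q hq => hq.2

/-- Local uniqueness of solutions of an autonomous `C^1` system, in terms of germs. -/
theorem ode_unique {E : Type*} [NormedAddCommGroup E] [NormedSpace ℝ E]
    {F : E → E} {f g : ℝ → E} {t₀ : ℝ} (hF : ContDiffAt ℝ 1 F (f t₀))
    (hf : ∀ᶠ t in 𝓝 t₀, HasDerivAt f (F (f t)) t) (hg : ∀ᶠ t in 𝓝 t₀, HasDerivAt g (F (g t)) t)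
    (h0 : f t₀ = g t₀) : f =ᶠ[𝓝 t₀] g := by
  obtain ⟨K, s, hs, hL⟩ := hF.exists_lipschitzOnWith
  refine ODE_solution_unique_of_eventually (v := fun _ => F) (s := fun _ => s) (K := K)
    (Filter.Eventually.of_forall fun _ => hL) (hf.and ?_) (hg.and ?_) h0
  · exact hf.self_of_nhds.continuousAt hs
  · refine hg.self_of_nhds.continuousAt ?_
    rw [← h0]; exact hs

end Analysis

noncomputable section

/-! ### Grassmann algebras -/

/-- The body of an element of the Grassmann algebra: its component of degree `0`. -/
abbrev body (m : ℕ) : Gr m →ₐ[ℝ] ℝ := ExteriorAlgebra.algebraMapInv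

theorem body_algebraMap {m : ℕ} (r : ℝ) : body m (algebraMap ℝ (Gr m) r) = r :=
  ExteriorAlgebra.algebraMap_leftInverse _ r

theorem body_gen {m : ℕ} (v : Fin m → ℝ) : body m (ExteriorAlgebra.ι ℝ v) = 0 := by
  simp [ExteriorAlgebra.algebraMapInv]

theorem body_involute {m : ℕ} (a : Gr m) : body m (CliffordAlgebra.involute a) = body m a := by
  induction a using CliffordAlgebra.left_induction with
  | algebraMap r => simp
  | add x y hx hy => simp only [map_add, hx, hy]
  | ι_mul x v hx =>
    have h : body m (CliffordAlgebra.ι 0 v) = 0 := body_gen v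
    rw [map_mul, map_mul, map_mul, CliffordAlgebra.involute_ι, map_neg, h]
    simp

theorem body_odd {m : ℕ} {a : Gr m} (ha : a ∈ grParity m 1) : body m a = 0 := by
  have h := body_involute a
  rw [CliffordAlgebra.involute_eq_of_mem_odd ha, map_neg] at h
  linarith

/-- The even elements without body are nilpotent: they are sums of commuting elements of
square zero. -/
theorem isNilpotent_sub_body_of_even {m : ℕ} {a : Gr m} (ha : a ∈ grParity m 0) :
    IsNilpotent (a - algebraMap ℝ (Gr m) (body m a)) := by
  induction a, ha using CliffordAlgebra.even_induction with
  | algebraMap r => simp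
  | add x y hx hy ihx ihy =>
    have hc : Commute (x - algebraMap ℝ (Gr m) (body m x))
        (y - algebraMap ℝ (Gr m) (body m y)) :=
      gr_even_mul (Submodule.sub_mem _ hx (SetLike.algebraMap_mem_graded (grParity m) _)) _
    have := hc.isNilpotent_add ihx ihy
    rw [map_add, map_add]
    convert this using 1
    abel
  | ι_mul_ι_mul v w x hx ih =>
    have h0 : body m (CliffordAlgebra.ι 0 v * CliffordAlgebra.ι 0 w * x) = 0 := by
      have h : body m (CliffordAlgebra.ι 0 v) = 0 := body_gen v
      simp only [map_mul, h, zero_mul]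
    rw [h0, map_zero, sub_zero]
    have hvw := CliffordAlgebra.ι_mul_ι_mem_evenOdd_zero (0 : QuadraticForm ℝ (Fin m → ℝ)) v w
    refine ⟨2, ?_⟩
    have hc := gr_even_mul hvw
    have hsq : (CliffordAlgebra.ι (0 : QuadraticForm ℝ (Fin m → ℝ)) v * CliffordAlgebra.ι 0 w)
        * (CliffordAlgebra.ι 0 v * CliffordAlgebra.ι 0 w) = 0 := by
      rw [← mul_assoc, hc, ← mul_assoc, CliffordAlgebra.ι_sq_scalar]
      simp
    rw [sq, mul_assoc _ x, ← mul_assoc x, ← hc x, mul_assoc _ x x, ← mul_assoc, hsq, zero_mul]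

/-- An element with non-zero body is a unit: it is the sum of its body and commuting nilpotent
elements. -/
theorem isUnit_of_body_ne_zero {m : ℕ} {a : Gr m} (ha : body m a ≠ 0) : IsUnit a := by
  have hsum := sum_proj (grParity m) a
  have h2 : ∑ i : ZMod 2, GradedAlgebra.proj (grParity m) i a
      = GradedAlgebra.proj (grParity m) 0 a + GradedAlgebra.proj (grParity m) 1 a :=
    Fin.sum_univ_two _
  rw [h2] at hsum
  have h0 : GradedAlgebra.proj (grParity m) 0 a ∈ grParity m 0 := SetLike.coe_mem _
  have h1 : GradedAlgebra.proj (grParity m) 1 a ∈ grParity m 1 := SetLike.coe_mem _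
  set b := GradedAlgebra.proj (grParity m) 0 a
  set d := GradedAlgebra.proj (grParity m) 1 a
  have hb : body m b = body m a := by rw [← hsum, map_add, body_odd h1, add_zero]
  have hd : IsNilpotent d := by
    refine ⟨2, ?_⟩
    have h := gr_odd_mul h1 d
    rw [CliffordAlgebra.involute_eq_of_mem_odd h1, neg_mul] at h
    rw [sq]
    have h' : (2 : ℝ) • (d * d) = 0 := by rw [two_smul]; nth_rewrite 1 [h]; simp
    exact (smul_eq_zero.1 h').resolve_left two_ne_zero
  have hr : IsUnit (algebraMap ℝ (Gr m) (body m b)) := by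
    rw [hb]; exact (isUnit_iff_ne_zero.2 ha).map _
  have hcm : Commute (b - algebraMap ℝ (Gr m) (body m b)) d := gr_even_mul
    (Submodule.sub_mem _ h0 (SetLike.algebraMap_mem_graded (grParity m) (body m b))) d
  have hn := hcm.isNilpotent_add
    (isNilpotent_sub_body_of_even h0) hd
  have := (hn.isUnit_add_left_of_commute hr
    ((Algebra.commutes _ _ : Commute (algebraMap ℝ (Gr m) (body m b)) _)).symm)
  convert this using 1
  rw [← hsum]
  abel

/-- An element of `Λ[ξ]` is its body plus its `∂_ξ`-derivative times `ξ`. -/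
theorem gr_one_eq (a : Gr 1) : a = algebraMap ℝ (Gr 1) (body 1 a)
    + body 1 (CliffordAlgebra.contractLeft (LinearMap.proj (0 : Fin 1)) a) • superLine.xi := by
  induction a using CliffordAlgebra.left_induction with
  | algebraMap r => rw [CliffordAlgebra.contractLeft_algebraMap]; simp
  | add x y hx hy =>
    conv_lhs => rw [hx, hy]
    simp only [map_add, add_smul]
    abel
  | ι_mul x v hx =>
    have hv : CliffordAlgebra.ι (0 : QuadraticForm ℝ (Fin 1 → ℝ)) v = v 0 • superLine.xi := by
      change ExteriorAlgebra.ι ℝ v = _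
      rw [superLine.xi, ← map_smul]
      congr 1
      ext i
      rw [Subsingleton.elim i 0]
      simp
    have hxi : superLine.xi * superLine.xi = 0 := ExteriorAlgebra.ι_sq_zero _
    have hbx : body 1 (superLine.xi) = 0 := body_gen _
    rw [CliffordAlgebra.contractLeft_ι_mul, hv]
    simp only [map_mul, map_sub, map_smul, hbx]
    conv_lhs => rw [hx]
    simp only [smul_mul_assoc, mul_add, mul_smul_comm, hxi, LinearMap.proj_apply, smul_eq_mul,
      zero_mul, mul_zero, sub_zero, map_zero, zero_add, smul_zero, add_zero]
    rw [← Algebra.commutes, ← Algebra.smul_def, smul_smul]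

/-- Linear maps on the Grassmann algebra are continuous. -/
abbrev grCLM {m : ℕ} {F : Type*} [NormedAddCommGroup F] [NormedSpace ℝ F] (L : Gr m →ₗ[ℝ] F) :
    Gr m →L[ℝ] F := LinearMap.toContinuousLinearMap L

/-- The inclusion of the scalars into the Grassmann algebra, as a continuous linear map. -/
abbrev scalarCLM (m : ℕ) : ℝ →L[ℝ] Gr m :=
  LinearMap.toContinuousLinearMap (Algebra.linearMap ℝ (Gr m))

/-! ### Smooth superfunctions on a chart -/

theorem coordRep_apply {X : Type u} [TopologicalSpace X] {E : Type} [NormedAddCommGroup E]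
    {x : OpenPartialHomeomorph X E} {m : ℕ} {V : Opens X} (f : V → Gr m) {p : X} (hp : p ∈ V)
    (hs : p ∈ x.source) : coordRep x f (x p) = f ⟨p, hp⟩ := by
  have : x.symm (x p) = p := x.left_inv hs
  simp [coordRep, this, hp]

section sections
variable {X : Type u} [TopologicalSpace X] {E : Type} [NormedAddCommGroup E] [NormedSpace ℝ E]
  {x : OpenPartialHomeomorph X E} {m : ℕ} {V : Opens X}

/-- Smoothness of a superfunction can be checked locally. -/
theorem mem_grSections_of_eventuallyEq {f : V → Gr m}
    (h : ∀ p ∈ V, p ∈ x.source → ∃ φ : E → Gr m, ContDiffAt ℝ ∞ φ (x p) ∧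
      ∀ᶠ q in 𝓝 p, ∀ hq : q ∈ V, f ⟨q, hq⟩ = φ (x q)) : f ∈ grSections x m V := by
  intro p hp hs
  obtain ⟨φ, hφ, he⟩ := h p hp hs
  refine hφ.congr_of_eventuallyEq ?_
  have hc : ContinuousAt x.symm (x p) := x.continuousAt_symm (x.map_source hs)
  have he' : ∀ᶠ y in 𝓝 (x p), ∀ hq : x.symm y ∈ V, f ⟨x.symm y, hq⟩ = φ (x (x.symm y)) := by
    refine hc.eventually (p := fun q => ∀ hq : q ∈ V, f ⟨q, hq⟩ = φ (x q)) ?_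
    rw [x.left_inv hs]; exact he
  filter_upwards [he', coordRep_eventually x hp hs, x.open_target.mem_nhds (x.map_source hs)]
    with y h1 h2 h3
  simp only [coordRep, h2, dif_pos]
  rw [h1 h2, x.right_inv h3]

theorem grSections_comp_mem {φ : E → Gr m} (hφ : ∀ p ∈ V, p ∈ x.source → ContDiffAt ℝ ∞ φ (x p)) :
    (fun p : V => φ (x p)) ∈ grSections x m V :=
  mem_grSections_of_eventuallyEq fun p hp hs =>
    ⟨φ, hφ p hp hs, Filter.Eventually.of_forall fun _ _ => rfl⟩

/-- A superfunction whose body has no zeros is invertible. -/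
theorem grSections_isUnit {f : grSections x m V}
    (hf : ∀ p, body m (f.1 p) ≠ 0) : IsUnit f := by
  have hu : ∀ p, IsUnit (f.1 p) := fun p => isUnit_of_body_ne_zero (hf p)
  -- the inverse is smooth, as it is obtained by inverting the operator of left multiplication
  let Lm : Gr m →L[ℝ] (Gr m →L[ℝ] Gr m) := grCLM
    ((LinearMap.toContinuousLinearMap : (Gr m →ₗ[ℝ] Gr m) ≃ₗ[ℝ] _).toLinearMap ∘ₗ
      LinearMap.mul ℝ (Gr m))
  have hLm : ∀ a b, Lm a b = a * b := fun a b => rfl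
  let e : (Gr m)ˣ → (Gr m ≃L[ℝ] Gr m) := fun a =>
    { toFun := fun b => a * b
      invFun := fun b => (a⁻¹ : (Gr m)ˣ) * b
      left_inv := fun b => by simp
      right_inv := fun b => by simp
      map_add' := mul_add _
      map_smul' := fun r b => by simp
      continuous_toFun := (Lm a).continuous
      continuous_invFun := (Lm (a⁻¹ : (Gr m)ˣ)).continuous }
  have he : ∀ a : (Gr m)ˣ, Lm a = e a := fun a => by ext b; rfl
  have hinv : ∀ a : (Gr m)ˣ, (Lm a).inverse 1 = ((a⁻¹ : (Gr m)ˣ) : Gr m) := fun a => by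
    rw [he, ContinuousLinearMap.inverse_equiv]
    change ((a⁻¹ : (Gr m)ˣ) : Gr m) * 1 = _
    rw [mul_one]
  let g : V → Gr m := fun p => (Lm (f.1 p)).inverse 1
  have hg : g ∈ grSections x m V := by
    refine mem_grSections_of_eventuallyEq fun p hp hs =>
      ⟨fun y => (Lm (coordRep x f.1 y)).inverse 1, ?_, ?_⟩
    · have h1 : ContDiffAt ℝ ∞ (fun y => Lm (coordRep x f.1 y)) (x p) :=
        Lm.contDiff.contDiffAt.comp _ (f.2 p hp hs)
      refine ContDiffAt.clm_apply ?_ contDiffAt_const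
      have h2 : ContDiffAt ℝ ∞ ContinuousLinearMap.inverse (Lm (coordRep x f.1 (x p))) := by
        rw [coordRep_apply f.1 hp hs, ← (hu ⟨p, hp⟩).unit_spec, he]
        exact contDiffAt_map_inverse _
      exact h2.comp (x p) h1
    · filter_upwards [x.open_source.mem_nhds hs] with q hq hqV
      rw [coordRep_apply f.1 hqV hq]
  rw [isUnit_iff_exists]
  refine ⟨⟨g, hg⟩, ?_, ?_⟩ <;> ext p
  · change f.1 p * (Lm (f.1 p)).inverse 1 = 1
    rw [← (hu p).unit_spec, hinv]; simp
  · change (Lm (f.1 p)).inverse 1 * f.1 p = 1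
    rw [← (hu p).unit_spec, hinv]; simp

end sections

/-! ### Superfunctions in a chart -/

theorem mem_inf_of_mem {X : Type*} [TopologicalSpace X] {U V : Opens X} {p : X} (hU : p ∈ U)
    (hV : p ∈ V) : p ∈ U ⊓ V := ⟨hU, hV⟩

namespace SuperChart
variable {M : SuperSpace.{u, v}} {n m : ℕ} (c : SuperChart M n m)

theorem inf_dom_subset (U : Opens M) : ((U ⊓ c.dom : Opens M) : Set M) ⊆ c.x.source :=
  fun _ hp => hp.2

theorem subset_source {c : SuperChart M n m} {V : Opens M} (hV : V ≤ c.dom) :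
    (V : Set M) ⊆ c.x.source := hV

/-- The value in `Λ` of a superfunction at a point of the chart. -/
def ev {U : Opens M} {p : M} (hp : p ∈ U) (hc : p ∈ c.dom) : M.O U →ₐ[ℝ] Gr m :=
  ((Pi.evalAlgHom ℝ (fun _ : (U ⊓ c.dom : Opens M) => Gr m) ⟨p, hp, hc⟩).comp
    (grSections c.x m (U ⊓ c.dom)).val).comp
      ((c.iso (U ⊓ c.dom) (c.inf_dom_subset U)).toAlgHom.comp (M.res inf_le_left))

theorem ev_res {U V : Opens M} (h : V ≤ U) {p : M} (hp : p ∈ V) (hc : p ∈ c.dom) (f : M.O U) :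
    c.ev hp hc (M.res h f) = c.ev (h hp) hc f := by
  change (c.iso (V ⊓ c.dom) (c.inf_dom_subset V) (M.res _ (M.res h f))).1 ⟨p, hp, hc⟩
    = (c.iso (U ⊓ c.dom) (c.inf_dom_subset U) (M.res _ f)).1 ⟨p, h hp, hc⟩
  have := c.iso_res (U ⊓ c.dom) (V ⊓ c.dom) (c.inf_dom_subset U) (inf_le_inf_right _ h)
    (M.res inf_le_left f)
  rw [M.res_res] at this ⊢
  rw [this]
  rfl

theorem ev_eq {V : Opens M} (hV : V ≤ c.dom) {p : M} (hp : p ∈ V) (hc : p ∈ c.dom)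
    (f : M.O V) : c.ev hp hc f = (c.iso V (subset_source hV) f).1 ⟨p, hp⟩ := by
  change (c.iso (V ⊓ c.dom) (c.inf_dom_subset V) (M.res _ f)).1 ⟨p, hp, hc⟩ = _
  rw [c.iso_res V (V ⊓ c.dom) (subset_source hV) inf_le_left]
  rfl

theorem ext_ev {V : Opens M} (hV : V ≤ c.dom) {f g : M.O V}
    (h : ∀ p (hp : p ∈ V) (hc : p ∈ c.dom), c.ev hp hc f = c.ev hp hc g) : f = g := by
  apply (c.iso V (subset_source hV)).injective
  ext p
  have hc : p.1 ∈ c.dom := hV p.2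
  have := h p.1 p.2 hc
  rwa [c.ev_eq hV, c.ev_eq hV] at this

theorem ev_mem {U : Opens M} {p : M} (hp : p ∈ U) (hc : p ∈ c.dom) {i : ZMod 2} {f : M.O U}
    (hf : f ∈ M.parity U i) : c.ev hp hc f ∈ grParity m i :=
  (c.iso_mem _ (c.inf_dom_subset U) i _).2 (M.res_mem _ hf) _

/-- The coordinate expression `ℝ^n → Λ` of a superfunction, extended by `0` to all of `ℝ^n`. -/
def rep {U : Opens M} (f : M.O U) : (Fin n → ℝ) → Gr m :=
  coordRep c.x (c.iso (U ⊓ c.dom) (c.inf_dom_subset U) (M.res inf_le_left f)).1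

theorem rep_apply {U : Opens M} {p : M} (hp : p ∈ U) (hc : p ∈ c.dom) (f : M.O U) :
    c.rep f (c.x p) = c.ev hp hc f :=
  coordRep_apply _ (show p ∈ U ⊓ c.dom from ⟨hp, hc⟩) hc

theorem rep_contDiffAt {U : Opens M} {p : M} (hp : p ∈ U) (hc : p ∈ c.dom) (f : M.O U) :
    ContDiffAt ℝ ∞ (c.rep f) (c.x p) :=
  (c.iso (U ⊓ c.dom) (c.inf_dom_subset U) (M.res inf_le_left f)).2 p ⟨hp, hc⟩ hc

theorem eventually_nhds_of_eventually {p : M} (hc : p ∈ c.dom) {P : M → Prop} (h : ∀ᶠ q in 𝓝 p, P q) :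
    ∀ᶠ y in 𝓝 (c.x p), P (c.x.symm y) ∧ c.x.symm y ∈ c.dom ∧ c.x (c.x.symm y) = y := by
  have hcont : ContinuousAt c.x.symm (c.x p) := c.x.continuousAt_symm (c.x.map_source hc)
  have h' : ∀ᶠ q in 𝓝 (c.x.symm (c.x p)), P q := by rw [c.x.left_inv hc]; exact h
  filter_upwards [hcont.eventually h', c.x.open_target.mem_nhds (c.x.map_source hc)] with y h1 h2
  exact ⟨h1, c.x.map_target h2, c.x.right_inv h2⟩

theorem rep_congr {U : Opens M} {p : M} (hp : p ∈ U) (hc : p ∈ c.dom) {f : M.O U}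
    {φ : (Fin n → ℝ) → Gr m} (h : ∀ q (hq : q ∈ U) (hqc : q ∈ c.dom), c.ev hq hqc f = φ (c.x q)) :
    c.rep f =ᶠ[𝓝 (c.x p)] φ := by
  filter_upwards [c.eventually_nhds_of_eventually hc (U.isOpen.mem_nhds hp)] with y hy
  rw [← hy.2.2, c.rep_apply hy.1 hy.2.1, h _ hy.1 hy.2.1]

/-- The superfunction with coordinate expression `φ`. -/
def ofRep {V : Opens M} (hV : V ≤ c.dom) (φ : (Fin n → ℝ) → Gr m)
    (hφ : ∀ p ∈ V, ContDiffAt ℝ ∞ φ (c.x p)) : M.O V :=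
  (c.iso V (subset_source hV)).symm ⟨fun p => φ (c.x p), grSections_comp_mem fun p hp _ => hφ p hp⟩

theorem ev_ofRep {V : Opens M} (hV : V ≤ c.dom) {φ : (Fin n → ℝ) → Gr m}
    (hφ : ∀ p ∈ V, ContDiffAt ℝ ∞ φ (c.x p)) {p : M} (hp : p ∈ V) (hc : p ∈ c.dom) :
    c.ev hp hc (c.ofRep hV φ hφ) = φ (c.x p) := by
  rw [c.ev_eq hV hp, ofRep, AlgEquiv.apply_symm_apply]

theorem ev_coord_inl {p : M} (hc hc' : p ∈ c.dom) (i : Fin n) :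
    c.ev hc hc' (c.coord (.inl i)) = algebraMap ℝ (Gr m) (c.x p i) := by
  rw [c.ev_eq le_rfl hc, coord, AlgEquiv.apply_symm_apply]

theorem ev_coord_inr {p : M} (hc hc' : p ∈ c.dom) (α : Fin m) :
    c.ev hc hc' (c.coord (.inr α)) = ExteriorAlgebra.ι ℝ (Pi.single α 1) := by
  rw [c.ev_eq le_rfl hc, coord, AlgEquiv.apply_symm_apply]

theorem coord_mem (k : Fin n ⊕ Fin m) : c.coord k ∈ M.parity c.dom (coordParity k) := by
  rcases k with i | α
  · exact c.iso_symm_mem c.dom subset_rfl 0 _ fun _ => SetLike.algebraMap_mem_graded (grParity m) _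
  · exact c.iso_symm_mem c.dom subset_rfl 1 _ fun _ => CliffordAlgebra.ι_mem_evenOdd_one _ _

theorem ev_partialField_inl {V : Opens M} (hV : V ≤ c.dom) {p : M} (hp : p ∈ V) (hc : p ∈ c.dom)
    (i : Fin n) (f : M.O V) : c.ev hp hc ((c.partialField (.inl i)).toFun V hV f)
      = fderiv ℝ (c.rep f) (c.x p) (Pi.single i 1) := by
  rw [c.ev_eq hV hp]
  simp only [partialField, LinearMap.comp_apply, AlgEquiv.toLinearMap_apply,
    AlgEquiv.apply_symm_apply]
  change fderiv ℝ (coordRep c.x (c.iso V (subset_source hV) f).1) (c.x p) _ = _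
  rw [Filter.EventuallyEq.fderiv_eq]
  refine Filter.EventuallyEq.symm (c.rep_congr hp hc fun q hq hqc => ?_)
  rw [c.ev_eq hV hq, coordRep_apply _ hq hqc]

theorem ev_partialField_inr {V : Opens M} (hV : V ≤ c.dom) {p : M} (hp : p ∈ V) (hc : p ∈ c.dom)
    (α : Fin m) (f : M.O V) : c.ev hp hc ((c.partialField (.inr α)).toFun V hV f)
      = CliffordAlgebra.contractLeft (LinearMap.proj α) (c.ev hp hc f) := by
  rw [c.ev_eq hV hp, c.ev_eq hV hp]
  simp only [partialField, LinearMap.comp_apply, AlgEquiv.toLinearMap_apply,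
    AlgEquiv.apply_symm_apply]
  rfl

/-! ### Values of superfunctions -/

/-- The value of a superfunction at a point is the body of its value in `Λ`. -/
theorem hasValue_iff {U : Opens M} {p : M} (hp : p ∈ U) (hc : p ∈ c.dom) (f : M.O U) (r : ℝ) :
    M.HasValue f p r ↔ r = body m (c.ev hp hc f) := by
  constructor
  · intro h
    by_contra hne
    -- near `p`, the body of `f - r` does not vanish
    have hcont : ContinuousAt (fun q => body m (c.rep f (c.x q))) p :=
      ((grCLM (body m).toLinearMap).continuous.continuousAt.comp
        (c.rep_contDiffAt hp hc f).continuousAt).comp (c.x.continuousAt hc)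
    have h1 : ∀ᶠ q in 𝓝 p, body m (c.rep f (c.x q)) ≠ r :=
      hcont.eventually_ne (by rw [c.rep_apply hp hc]; exact Ne.symm hne)
    obtain ⟨W, hW, hWo, hpW⟩ := eventually_nhds_iff.1 h1
    let V : Opens M := ⟨W, hWo⟩ ⊓ (U ⊓ c.dom)
    refine h V (inf_le_right.trans inf_le_left) ⟨hpW, hp, hc⟩ ?_
    have hV : V ≤ c.dom := fun q hq => hq.2.2
    have hu : IsUnit (c.iso V (subset_source hV) (M.res (inf_le_right.trans inf_le_left) f
        - algebraMap ℝ (M.O V) r)) := by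
      refine grSections_isUnit fun q => ?_
      have hqc : q.1 ∈ c.dom := q.2.2.2
      rw [← c.ev_eq hV q.2 hqc, map_sub, map_sub, c.ev_res, AlgHom.commutes, AlgHom.commutes,
        ← c.rep_apply q.2.2.1 hqc]
      exact sub_ne_zero.2 (hW q.1 q.2.1)
    exact (MulEquiv.isUnit_map (c.iso V (subset_source hV))).1 hu
  · rintro rfl V hV hpV hu
    have := (hu.map (c.ev hpV hc)).map (body m)
    rw [map_sub, map_sub, c.ev_res, AlgHom.commutes, body_algebraMap, sub_self] at this
    exact not_isUnit_zero this

theorem value_eq {U : Opens M} {p : M} (hp : p ∈ U) (hc : p ∈ c.dom) (f : M.O U) :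
    M.value f p = body m (c.ev hp hc f) :=
  (c.hasValue_iff hp hc f _).1 (Classical.epsilon_spec
    (⟨_, (c.hasValue_iff hp hc f _).2 rfl⟩ : ∃ r, M.HasValue f p r))

theorem value_coord_inl {p : M} (hc : p ∈ c.dom) (i : Fin n) :
    M.value (c.coord (.inl i)) p = c.x p i := by
  rw [c.value_eq hc hc, ev_coord_inl, body_algebraMap]

end SuperChart

/-- The value at `p` as a homomorphism of algebras. -/
def SuperChart.valueHom {M : SuperSpace.{u, v}} {n m : ℕ} (c : SuperChart M n m) {U : Opens M} {p : M}
    (hp : p ∈ U) (hc : p ∈ c.dom) : M.O U →ₐ[ℝ] ℝ := (body m).comp (c.ev hp hc)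

theorem SuperChart.valueHom_apply {M : SuperSpace.{u, v}} {n m : ℕ} (c : SuperChart M n m)
    {U : Opens M} {p : M} (hp : p ∈ U) (hc : p ∈ c.dom) (f : M.O U) :
    c.valueHom hp hc f = M.value f p := (c.value_eq hp hc f).symm

theorem value_res {M : SuperSpace.{u, v}} {n m : ℕ} (c : SuperChart M n m) {U V : Opens M} (h : V ≤ U) {p : M}
    (hp : p ∈ V) (hc : p ∈ c.dom) (f : M.O U) : M.value (M.res h f) p = M.value f p := by
  rw [c.value_eq hp hc, c.ev_res, ← c.value_eq]

theorem value_odd {M : SuperSpace.{u, v}} {n m : ℕ} (c : SuperChart M n m) {U : Opens M} {p : M}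
    (hp : p ∈ U) (hc : p ∈ c.dom) {f : M.O U} (hf : f ∈ M.parity U 1) : M.value f p = 0 := by
  rw [c.value_eq hp hc, body_odd (c.ev_mem hp hc hf)]

/-! ### Derivations are determined by the coordinates -/

theorem isSuperDerivation_apply_mul {A : Type v} [Ring A] [Algebra ℝ A]
    {𝒜 : ZMod 2 → Submodule ℝ A} [GradedAlgebra 𝒜] {φ : A →ₗ[ℝ] A} (hφ : IsSuperDerivation 𝒜 φ)
    {i : ZMod 2} (hi : ∀ k, ∀ a ∈ 𝒜 k, φ a ∈ 𝒜 (i + k)) {j : ZMod 2} {a : A} (ha : a ∈ 𝒜 j) (b : A) :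
    φ (a * b) = φ a * b + superSign i j • (a * φ b) := by
  have := hφ i j a b ha
  rwa [endComponent_self hi] at this

theorem sum_endComponent {A : Type v} [Ring A] [Algebra ℝ A]
    (𝒜 : ZMod 2 → Submodule ℝ A) [GradedAlgebra 𝒜] (φ : A →ₗ[ℝ] A) (a : A) :
    ∑ i, endComponent 𝒜 i φ a = φ a := by
  simp only [endComponent, LinearMap.sum_apply, LinearMap.comp_apply]
  rw [Finset.sum_comm]
  conv_rhs => rw [← sum_proj 𝒜 a, map_sum]
  refine Finset.sum_congr rfl fun k _ => ?_
  conv_rhs => rw [← sum_proj 𝒜 (φ (GradedAlgebra.proj 𝒜 k a))]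
  exact Fintype.sum_equiv (Equiv.addRight k) _ _ fun i => rfl

theorem superSign_zero_left (j : ZMod 2) : superSign 0 j = 1 := by simp [superSign]

theorem superSign_zero_right (j : ZMod 2) : superSign j 0 = 1 := by simp [superSign]

theorem add_self_zmod_two (i : ZMod 2) : i + i = 0 := by revert i; decide

namespace SuperChart
variable {M : SuperSpace.{u, v}} {n m : ℕ} (c : SuperChart M n m)

/-- Superfunctions with constant coefficients. -/
def cst {V : Opens M} (hV : V ≤ c.dom) : Gr m →ₐ[ℝ] M.O V :=
  (c.iso V (subset_source hV)).symm.toAlgHom.comp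
    { toFun := fun l => ⟨fun _ => l, grSections_comp_mem (φ := fun _ => l) fun _ _ _ =>
        contDiffAt_const⟩
      map_one' := rfl
      map_mul' := fun _ _ => rfl
      map_zero' := rfl
      map_add' := fun _ _ => rfl
      commutes' := fun _ => rfl }

theorem ev_cst {V : Opens M} (hV : V ≤ c.dom) {p : M} (hp : p ∈ V) (hc : p ∈ c.dom)
    (l : Gr m) : c.ev hp hc (c.cst hV l) = l := by
  rw [c.ev_eq hV hp]
  change (c.iso V (subset_source hV) ((c.iso V (subset_source hV)).symm _)).1 ⟨p, hp⟩ = l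
  rw [AlgEquiv.apply_symm_apply]
  rfl

theorem cst_gen {V : Opens M} (hV : V ≤ c.dom) (w : Fin m → ℝ) :
    c.cst hV (ExteriorAlgebra.ι ℝ w) = ∑ α, w α • M.res hV (c.coord (.inr α)) := by
  refine c.ext_ev hV fun p hp hc => ?_
  rw [ev_cst, map_sum]
  simp only [map_smul]
  conv_lhs => rw [← Finset.univ_sum_single w, map_sum]
  refine Finset.sum_congr rfl fun α _ => ?_
  rw [c.ev_res hV hp hc, c.ev_coord_inr, ← map_smul, ← Pi.single_smul]
  simp

theorem cst_gen_mem {V : Opens M} (hV : V ≤ c.dom) (w : Fin m → ℝ) :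
    c.cst hV (ExteriorAlgebra.ι ℝ w) ∈ M.parity V 1 := by
  rw [cst_gen]
  exact Submodule.sum_mem _ fun α _ => Submodule.smul_mem _ _ (M.res_mem _ (c.coord_mem (.inr α)))

/-- Near `p`, a superfunction differs from one with constant coefficients by an element of the ideal
generated by the functions `x_i - x_i(p)`. -/
theorem exists_eq_cst_add {V : Opens M} {p : M} (hp : p ∈ V) (hc : p ∈ c.dom) (f : M.O V) :
    ∃ (W : Opens M) (hW : W ≤ V) (hWc : W ≤ c.dom) (_ : p ∈ W) (l : Gr m) (G : Fin n → M.O W),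
      M.res hW f = c.cst hWc l
        + ∑ i, (M.res hWc (c.coord (.inl i)) - algebraMap ℝ (M.O W) (c.x p i)) * G i := by
  have hsm : ∀ᶠ y in 𝓝 (c.x p), ContDiffAt ℝ ∞ (c.rep f) y := by
    filter_upwards [c.eventually_nhds_of_eventually hc (V.isOpen.mem_nhds hp)] with y hy
    rw [← hy.2.2]
    exact c.rep_contDiffAt hy.1 hy.2.1 f
  obtain ⟨G, hG, he⟩ := exists_hadamard hsm
  have he' := (c.x.continuousAt hc).eventually he
  obtain ⟨S, hS, hSo, hpS⟩ := eventually_nhds_iff.1 he'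
  let W : Opens M := ⟨S, hSo⟩ ⊓ (V ⊓ c.dom)
  have hWV : W ≤ V := inf_le_right.trans inf_le_left
  have hWc : W ≤ c.dom := inf_le_right.trans inf_le_right
  refine ⟨W, hWV, hWc, ⟨hpS, hp, hc⟩, c.rep f (c.x p),
    fun i => c.ofRep hWc (G i) fun q _ => (hG i).contDiffAt, c.ext_ev hWc fun q hq hqc => ?_⟩
  rw [c.ev_res hWV hq hqc, map_add, c.ev_cst, map_sum, ← c.rep_apply (hWV hq) hqc, hS q hq.1]
  congr 1
  refine Finset.sum_congr rfl fun i _ => ?_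
  rw [map_mul, c.ev_ofRep, map_sub, AlgHom.commutes, c.ev_res hWc hq hqc, c.ev_coord_inl, ← map_sub,
    ← Algebra.smul_def]

end SuperChart

/-! ### Tangent vectors -/

namespace TangentVector
variable {M : SuperSpace.{u, v}} {n m : ℕ} {p : M}

theorem map_one (τ : TangentVector M p) (c : SuperChart M n m) (hc : p ∈ c.dom) {V : Opens M}
    (hp : p ∈ V) : τ.toFun V hp 1 = 0 := by
  have h := τ.leibniz V hp 1 1
  have h1 : c.valueHom hp hc 1 = 1 := _root_.map_one _
  rw [mul_one, ← c.valueHom_apply hp hc, h1] at h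
  linarith

/-- A tangent vector that vanishes on the coordinates is zero: this follows from Hadamard's lemma, as
the products of functions `x_i - x_i(p)` with other functions only contribute `τ(x_i)`. -/
theorem eq_zero_of_coord (τ : TangentVector M p) (c : SuperChart M n m) (hc : p ∈ c.dom)
    (h : ∀ k, τ.toFun c.dom hc (c.coord k) = 0) {V : Opens M} (hp : p ∈ V) (f : M.O V) :
    τ.toFun V hp f = 0 := by
  obtain ⟨W, hW, hWc, hpW, l, G, he⟩ := c.exists_eq_cst_add hp hc f
  have hcst : ∀ l, τ.toFun W hpW (c.cst hWc l) = 0 := by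
    intro l
    induction l using CliffordAlgebra.left_induction with
    | algebraMap r =>
      rw [AlgHom.commutes, Algebra.algebraMap_eq_smul_one, map_smul, τ.map_one c hc hpW, smul_zero]
    | add a b ha hb => rw [_root_.map_add, _root_.map_add, ha, hb, add_zero]
    | ι_mul a w ha =>
      have h1 : τ.toFun W hpW (c.cst hWc (CliffordAlgebra.ι 0 w)) = 0 := by
        have := c.cst_gen hWc w
        rw [show c.cst hWc (CliffordAlgebra.ι 0 w) = _ from this, map_sum]
        refine Finset.sum_eq_zero fun α _ => ?_
        rw [map_smul, τ.res_comm, h, smul_zero]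
      rw [map_mul, τ.leibniz, ha, h1]
      ring
  rw [← τ.res_comm V W hW hpW, he, _root_.map_add, hcst, zero_add, map_sum]
  refine Finset.sum_eq_zero fun i _ => ?_
  rw [τ.leibniz, map_sub, τ.res_comm, h, Algebra.algebraMap_eq_smul_one, map_smul,
    τ.map_one c hc hpW, ← Algebra.algebraMap_eq_smul_one, ← c.valueHom_apply hpW hc (_ - _), map_sub,
    AlgHom.commutes, c.valueHom_apply, value_res c _ hpW hc, c.value_coord_inl hc]
  simp

end TangentVector

/-- On values the sign in the rule for derivations disappears, since odd functions have value `0`. -/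
theorem value_superDerivation_mul {M : SuperSpace.{u, v}} {n m : ℕ} (c : SuperChart M n m)
    {V : Opens M} {p : M} (hp : p ∈ V) (hc : p ∈ c.dom) {φ : M.O V →ₗ[ℝ] M.O V}
    (hφ : IsSuperDerivation (M.parity V) φ) (f g : M.O V) :
    M.value (φ (f * g)) p = M.value (φ f) p * M.value g p + M.value f p * M.value (φ g) p := by
  simp only [← c.valueHom_apply hp hc]
  have key : ∀ i j, ∀ a ∈ M.parity V j, c.valueHom hp hc (endComponent (M.parity V) i φ (a * g))
      = c.valueHom hp hc (endComponent (M.parity V) i φ a) * c.valueHom hp hc g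
        + c.valueHom hp hc a * c.valueHom hp hc (endComponent (M.parity V) i φ g) := by
    intro i j a ha
    rw [hφ i j a g ha, _root_.map_add, map_smul, map_mul, map_mul]
    rcases gr_parity_cases j with rfl | rfl
    · rw [superSign_zero_right, one_smul]
    · rw [c.valueHom_apply hp hc a, value_odd c hp hc ha]
      simp
  rw [← sum_endComponent (M.parity V) φ (f * g), ← sum_endComponent (M.parity V) φ f,
    ← sum_endComponent (M.parity V) φ g]
  simp only [map_sum]
  rw [Finset.sum_mul, Finset.mul_sum, ← Finset.sum_add_distrib]
  refine Finset.sum_congr rfl fun i _ => ?_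
  have hf := sum_proj (M.parity V) f
  conv_lhs => rw [← hf, Finset.sum_mul]
  conv_rhs => rw [← hf]
  simp only [map_sum, Finset.sum_mul]
  rw [← Finset.sum_add_distrib]
  exact Finset.sum_congr rfl fun j _ => key i j _ (SetLike.coe_mem _)

/-- The tangent vector at `p` given by a vector field. The chart only serves to know that `p` has a
coordinate neighbourhood. -/
def VectorField.at {M : SuperSpace.{u, v}} {n m : ℕ} {U : Opens M} (Y : VectorField M U)
    (c : SuperChart M n m) {p : M} (hU : p ∈ U) (hc : p ∈ c.dom) : TangentVector M p where
  toFun V hp := (c.valueHom (mem_inf_of_mem hp hU) hc).toLinearMap ∘ₗ Y.toFun (V ⊓ U) inf_le_right ∘ₗ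
    (M.res inf_le_left).toLinearMap
  res_comm V W h hp f := by
    simp only [LinearMap.comp_apply, AlgHom.toLinearMap_apply, M.res_res]
    rw [← M.res_res (U := V) (V := V ⊓ U) (W := W ⊓ U) inf_le_left (inf_le_inf_right U h),
      Y.res_comm (V ⊓ U) (W ⊓ U) inf_le_right, c.valueHom_apply, c.valueHom_apply,
      value_res c (inf_le_inf_right U h) (mem_inf_of_mem hp hU) hc]
  leibniz V hp f g := by
    simp only [LinearMap.comp_apply, AlgHom.toLinearMap_apply, map_mul]
    rw [c.valueHom_apply, c.valueHom_apply, c.valueHom_apply,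
      value_superDerivation_mul c (mem_inf_of_mem hp hU) hc (Y.derivation _ _),
      value_res c _ (mem_inf_of_mem hp hU) hc, value_res c _ (mem_inf_of_mem hp hU) hc]

theorem VectorField.at_apply {M : SuperSpace.{u, v}} {n m : ℕ} {U V : Opens M} (Y : VectorField M U)
    (c : SuperChart M n m) {p : M} (hU : p ∈ U) (hc : p ∈ c.dom) (hV : V ≤ U) (hp : p ∈ V)
    (f : M.O V) : (Y.at c hU hc).toFun V hp f = M.value (Y.toFun V hV f) p := by
  change c.valueHom _ hc (Y.toFun (V ⊓ U) inf_le_right (M.res inf_le_left f)) = _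
  rw [Y.res_comm V (V ⊓ U) hV, c.valueHom_apply, value_res c _ (mem_inf_of_mem hp hU) hc]

theorem SuperChart.partialField_coord {M : SuperSpace.{u, v}} {n m : ℕ} (c : SuperChart M n m)
    {V : Opens M} (hV : V ≤ c.dom) (k l : Fin n ⊕ Fin m) :
    (c.partialField k).toFun V hV (M.res hV (c.coord l)) = if k = l then 1 else 0 := by
  refine c.ext_ev hV fun p hp hc => ?_
  rcases k with i | α
  · rw [c.ev_partialField_inl hV hp hc]
    rcases l with j | β
    · have h : c.rep (M.res hV (c.coord (.inl j))) =ᶠ[𝓝 (c.x p)]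
          fun y => algebraMap ℝ (Gr m) (y j) := by
        refine c.rep_congr hp hc fun q hq hqc => ?_
        rw [c.ev_res hV hq hqc, c.ev_coord_inl]
      have hd : HasFDerivAt (fun y : Fin n → ℝ => algebraMap ℝ (Gr m) (y j))
          ((scalarCLM m).comp (ContinuousLinearMap.proj (R := ℝ) (φ := fun _ : Fin n => ℝ) j))
          (c.x p) :=
        ((scalarCLM m).comp (ContinuousLinearMap.proj (R := ℝ) (φ := fun _ : Fin n => ℝ)
          j)).hasFDerivAt
      rw [h.fderiv_eq, hd.fderiv]
      by_cases hij : i = j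
      · subst hij; simp [scalarCLM]
      · simp [scalarCLM, hij, Ne.symm hij]
    · have h : c.rep (M.res hV (c.coord (.inr β))) =ᶠ[𝓝 (c.x p)]
          fun y => ExteriorAlgebra.ι ℝ (Pi.single β 1) := by
        refine c.rep_congr hp hc fun q hq hqc => ?_
        rw [c.ev_res hV hq hqc, c.ev_coord_inr]
      rw [h.fderiv_eq]
      simp
  · rw [c.ev_partialField_inr hV hp hc, c.ev_res hV hp hc]
    rcases l with j | β
    · rw [c.ev_coord_inl, CliffordAlgebra.contractLeft_algebraMap]
      simp
    · rw [c.ev_coord_inr]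
      erw [CliffordAlgebra.contractLeft_ι]
      by_cases hij : α = β
      · subst hij; simp
      · simp [hij]

/-- A tangent vector is the combination of the coordinate derivations with its values on the
coordinates as coefficients. -/
theorem TangentVector.eq_sum {M : SuperSpace.{u, v}} {n m : ℕ} {p : M} (τ : TangentVector M p)
    (c : SuperChart M n m) (hc : p ∈ c.dom) {V : Opens M} (hp : p ∈ V) (f : M.O V) :
    τ.toFun V hp f = ∑ k, τ.toFun c.dom hc (c.coord k) *
      ((c.partialField k).at c hc hc).toFun V hp f := by
  let D : TangentVector M p :=
    { toFun := fun V hp => τ.toFun V hp - ∑ k, τ.toFun c.dom hc (c.coord k) •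
        ((c.partialField k).at c hc hc).toFun V hp
      res_comm := fun V W h hp f => by
        simp [LinearMap.sub_apply, LinearMap.sum_apply, TangentVector.res_comm]
      leibniz := fun V hp f g => by
        simp only [LinearMap.sub_apply, LinearMap.sum_apply, TangentVector.leibniz,
          LinearMap.smul_apply, smul_eq_mul, mul_add, Finset.sum_add_distrib, sub_mul, mul_sub,
          Finset.sum_mul, Finset.mul_sum]
        have h1 : ∀ a b d : ℝ, a * (b * d) = b * (a * d) := fun a b d => by ring
        simp only [mul_assoc, h1 (M.value f p)]
        ring }
  have h := D.eq_zero_of_coord c hc (fun l => ?_) hp f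
  · simpa [D, LinearMap.sub_apply, LinearMap.sum_apply, sub_eq_zero] using h
  · have h1 : ∀ k, ((c.partialField k).at c hc hc).toFun c.dom hc (c.coord l)
        = if k = l then 1 else 0 := by
      intro k
      have h2 := c.partialField_coord le_rfl k l
      rw [M.res_self] at h2
      rw [VectorField.at_apply _ c hc hc le_rfl hc, h2, ← c.valueHom_apply hc hc]
      split_ifs <;> simp
    simp only [D, LinearMap.sub_apply, LinearMap.sum_apply, LinearMap.smul_apply, h1, smul_eq_mul,
      mul_ite, mul_one, mul_zero, Finset.sum_ite_eq', Finset.mem_univ, if_true, sub_self]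

/-! ### Vector fields as a module over the superfunctions -/

namespace VectorField
variable {M : SuperSpace.{u, v}} {U : Opens M}

@[ext]
theorem ext {X Y : VectorField M U} (h : ∀ V hV f, X.toFun V hV f = Y.toFun V hV f) : X = Y := by
  cases X; cases Y
  congr
  funext V hV
  exact LinearMap.ext (h V hV)

theorem add_toFun (X Y : VectorField M U) (V : Opens M) (hV : V ≤ U) (f : M.O V) :
    (X + Y).toFun V hV f = X.toFun V hV f + Y.toFun V hV f := rfl

theorem smul_toFun (a : M.O U) (X : VectorField M U) (V : Opens M) (hV : V ≤ U) (f : M.O V) :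
    (a • X).toFun V hV f = M.res hV a * X.toFun V hV f := rfl

instance : Zero (VectorField M U) where
  zero :=
    { toFun := fun _ _ => 0
      derivation := fun V _ => by intro i j a b _; simp [endComponent]
      res_comm := fun _ _ _ _ _ => by simp }

theorem zero_toFun (V : Opens M) (hV : V ≤ U) (f : M.O V) :
    (0 : VectorField M U).toFun V hV f = 0 := rfl

instance : AddCommMonoid (VectorField M U) where
  add_assoc X Y Z := by ext V hV f; simp only [add_toFun, add_assoc]
  zero_add X := by ext V hV f; simp only [add_toFun, zero_toFun, zero_add]
  add_zero X := by ext V hV f; simp only [add_toFun, zero_toFun, add_zero]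
  add_comm X Y := by ext V hV f; simp only [add_toFun, add_comm]
  nsmul := nsmulRec

theorem zero_eq_smul : (0 : VectorField M U) = (0 : M.O U) • (0 : VectorField M U) := by
  ext V hV f
  rw [smul_toFun, map_zero, zero_mul, zero_toFun]

theorem sum_toFun {ι : Type*} (s : Finset ι) (X : ι → VectorField M U) (V : Opens M) (hV : V ≤ U)
    (f : M.O V) : (∑ k ∈ s, X k).toFun V hV f = ∑ k ∈ s, (X k).toFun V hV f := by
  classical
  induction s using Finset.induction_on with
  | empty => simp [zero_toFun]
  | insert a s ha ih => rw [Finset.sum_insert ha, Finset.sum_insert ha, add_toFun, ih]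

theorem IsHomogeneous.smul {X : VectorField M U} {i j : ZMod 2} (hX : X.IsHomogeneous i) {a : M.O U}
    (ha : a ∈ M.parity U j) : (a • X).IsHomogeneous (j + i) := by
  intro V hV k f hf
  rw [smul_toFun, add_assoc]
  exact SetLike.mul_mem_graded (M.res_mem hV ha) (hX V hV k f hf)

theorem IsHomogeneous.sum {ι : Type*} {s : Finset ι} {X : ι → VectorField M U} {i : ZMod 2}
    (hX : ∀ k ∈ s, (X k).IsHomogeneous i) : (∑ k ∈ s, X k).IsHomogeneous i := by
  intro V hV k f hf
  rw [sum_toFun]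
  exact Submodule.sum_mem _ fun l hl => hX l hl V hV k f hf

theorem IsHomogeneous.restrict {X : VectorField M U} {i : ZMod 2} (hX : X.IsHomogeneous i)
    {V : Opens M} (h : V ≤ U) : (X.restrict h).IsHomogeneous i :=
  fun W hW k f hf => hX W (hW.trans h) k f hf

theorem IsHomogeneous.apply_mul {X : VectorField M U} {i j : ZMod 2} (hX : X.IsHomogeneous i)
    {V : Opens M} (hV : V ≤ U) {a : M.O V} (ha : a ∈ M.parity V j) (b : M.O V) :
    X.toFun V hV (a * b) = X.toFun V hV a * b + superSign i j • (a * X.toFun V hV b) :=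
  isSuperDerivation_apply_mul (X.derivation V hV) (hX V hV) ha b

theorem IsHomogeneous.apply_one {X : VectorField M U} {i : ZMod 2} (hX : X.IsHomogeneous i)
    {V : Opens M} (hV : V ≤ U) : X.toFun V hV 1 = 0 := by
  have h := hX.apply_mul hV (SetLike.GradedOne.one_mem (A := M.parity V)) 1
  rw [superSign_zero_right, one_smul, mul_one, one_mul, mul_one] at h
  simpa using h

/-- The component of parity `i` of a vector field. -/
def component (i : ZMod 2) (X : VectorField M U) : VectorField M U where
  toFun V hV := endComponent (M.parity V) i (X.toFun V hV)
  derivation V hV := by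
    refine isSuperDerivation_of_homogeneous (i := i) (fun k a ha => ?_)
      fun j a b ha => X.derivation V hV i j a b ha
    rw [endComponent, LinearMap.sum_apply]
    refine Submodule.sum_mem _ fun l _ => ?_
    by_cases hl : l = k
    · subst hl
      exact SetLike.coe_mem _
    · have : GradedAlgebra.proj (M.parity V) l a = 0 :=
        DirectSum.decompose_of_mem_ne _ ha (Ne.symm hl)
      rw [LinearMap.comp_apply, LinearMap.comp_apply, this, map_zero, map_zero]
      exact Submodule.zero_mem _
  res_comm V W hV h f := by
    have hproj : ∀ k (g : M.O V), GradedAlgebra.proj (M.parity W) k (M.res h g)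
        = M.res h (GradedAlgebra.proj (M.parity V) k g) := by
      intro k g
      conv_lhs => rw [← sum_proj (M.parity V) g, map_sum, map_sum]
      rw [Finset.sum_eq_single k]
      · exact DirectSum.decompose_of_mem_same _ (M.res_mem h (SetLike.coe_mem _))
      · intro l _ hl
        exact DirectSum.decompose_of_mem_ne _ (M.res_mem h (SetLike.coe_mem _)) hl
      · simp
    simp only [endComponent, LinearMap.sum_apply, LinearMap.comp_apply, map_sum, hproj,
      X.res_comm V W hV h]

theorem component_isHomogeneous (i : ZMod 2) (X : VectorField M U) :
    (X.component i).IsHomogeneous i := by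
  intro V hV k a ha
  change endComponent (M.parity V) i (X.toFun V hV) a ∈ _
  rw [endComponent, LinearMap.sum_apply]
  refine Submodule.sum_mem _ fun l _ => ?_
  by_cases hl : l = k
  · subst hl
    exact SetLike.coe_mem _
  · have : GradedAlgebra.proj (M.parity V) l a = 0 :=
      DirectSum.decompose_of_mem_ne _ ha (Ne.symm hl)
    rw [LinearMap.comp_apply, LinearMap.comp_apply, this, map_zero, map_zero]
    exact Submodule.zero_mem _

theorem component_add_component (X : VectorField M U) : X.component 0 + X.component 1 = X := by
  ext V hV f
  have h : ∑ i : ZMod 2, endComponent (M.parity V) i (X.toFun V hV) f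
      = endComponent (M.parity V) 0 (X.toFun V hV) f
        + endComponent (M.parity V) 1 (X.toFun V hV) f := Fin.sum_univ_two _
  rw [sum_endComponent] at h
  exact h.symm

end VectorField

/-! ### Coordinate expressions of vector fields -/

namespace SuperChart
variable {M : SuperSpace.{u, v}} {n m : ℕ} (c : SuperChart M n m)

theorem partialField_isHomogeneous (k : Fin n ⊕ Fin m) :
    (c.partialField k).IsHomogeneous (coordParity k) := by
  intro V hV i f hf
  exact c.iso_symm_mem V hV _ _ (c.localPartial_mem V hV k i _ ((c.iso_mem V hV i f).2 hf))

/-- Homogeneous vector fields are determined by their values on the coordinates. -/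
theorem vectorField_ext {U : Opens M} (hU : U ≤ c.dom) {i : ZMod 2} {Y Z : VectorField M U}
    (hY : Y.IsHomogeneous i) (hZ : Z.IsHomogeneous i)
    (h : ∀ k, Y.app (M.res hU (c.coord k)) = Z.app (M.res hU (c.coord k))) : Y = Z := by
  have hcoord : ∀ (W : Opens M) (hW : W ≤ U) k, Y.toFun W hW (M.res (hW.trans hU) (c.coord k))
      = Z.toFun W hW (M.res (hW.trans hU) (c.coord k)) := by
    intro W hW k
    have h1 := Y.res_comm U W le_rfl hW (M.res hU (c.coord k))
    have h2 := Z.res_comm U W le_rfl hW (M.res hU (c.coord k))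
    rw [M.res_res] at h1 h2
    rw [h1, h2]
    exact congrArg _ (h k)
  have hcst : ∀ (W : Opens M) (hW : W ≤ U) (l : Gr m),
      Y.toFun W hW (c.cst (hW.trans hU) l) = Z.toFun W hW (c.cst (hW.trans hU) l) := by
    intro W hW l
    induction l using CliffordAlgebra.left_induction with
    | algebraMap r =>
      rw [AlgHom.commutes, Algebra.algebraMap_eq_smul_one, map_smul, map_smul, hY.apply_one,
        hZ.apply_one]
    | add a b ha hb => rw [map_add, map_add, map_add, ha, hb]
    | ι_mul a w ha =>
      have hm := c.cst_gen_mem (hW.trans hU) w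
      have h1 : Y.toFun W hW (c.cst (hW.trans hU) (ExteriorAlgebra.ι ℝ w))
          = Z.toFun W hW (c.cst (hW.trans hU) (ExteriorAlgebra.ι ℝ w)) := by
        rw [cst_gen, map_sum, map_sum]
        simp only [map_smul, hcoord]
      change Y.toFun W hW (c.cst (hW.trans hU) (ExteriorAlgebra.ι ℝ w * a))
        = Z.toFun W hW (c.cst (hW.trans hU) (ExteriorAlgebra.ι ℝ w * a))
      rw [map_mul, hY.apply_mul hW hm, hZ.apply_mul hW hm, h1, ha]
  ext V hV f
  refine c.ext_ev (hV.trans hU) fun p hp hc => ?_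
  obtain ⟨W, hW, hWc, hpW, l, G, he⟩ := c.exists_eq_cst_add hp hc f
  have hpt : ∀ X : VectorField M U, c.ev hp hc (X.toFun V hV f)
      = c.ev hpW hc (X.toFun W (hW.trans hV) (M.res hW f)) := by
    intro X
    rw [X.res_comm V W hV hW, c.ev_res hW hpW hc]
  have hterm : ∀ (X : VectorField M U), X.IsHomogeneous i → ∀ k,
      c.ev hpW hc (X.toFun W (hW.trans hV)
        ((M.res hWc (c.coord (.inl k)) - algebraMap ℝ (M.O W) (c.x p k)) * G k))
      = c.ev hpW hc (X.toFun W (hW.trans hV) (M.res hWc (c.coord (.inl k)))) * c.ev hpW hc (G k) := by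
    intro X hX k
    have hm : M.res hWc (c.coord (.inl k)) - algebraMap ℝ (M.O W) (c.x p k) ∈ M.parity W 0 :=
      Submodule.sub_mem _ (M.res_mem _ (c.coord_mem (.inl k)))
        (SetLike.algebraMap_mem_graded (M.parity W) _)
    have h0 : c.ev hpW hc (M.res hWc (c.coord (.inl k)) - algebraMap ℝ (M.O W) (c.x p k)) = 0 := by
      rw [map_sub, AlgHom.commutes, c.ev_res hWc hpW hc, c.ev_coord_inl, sub_self]
    rw [hX.apply_mul _ hm, map_add, map_mul, map_smul, map_mul, h0, zero_mul, smul_zero, add_zero,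
      map_sub, Algebra.algebraMap_eq_smul_one, map_smul, hX.apply_one, smul_zero, sub_zero]
  rw [hpt, hpt, he, map_add, map_add, hcst W (hW.trans hV), map_sum, map_sum, map_add, map_add,
    map_sum, map_sum]
  congr 1
  refine Finset.sum_congr rfl fun k _ => ?_
  rw [hterm Y hY, hterm Z hZ, hcoord W (hW.trans hV)]

/-- The coordinate expression `Y = ∑ k, Y(η_k) ∂_k` of a homogeneous vector field. -/
theorem vectorField_eq_sum {U : Opens M} (hU : U ≤ c.dom) {i : ZMod 2} {Y : VectorField M U}
    (hY : Y.IsHomogeneous i) :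
    Y = ∑ k, Y.app (M.res hU (c.coord k)) • (c.partialField k).restrict hU := by
  refine c.vectorField_ext hU hY (VectorField.IsHomogeneous.sum fun k _ => ?_) fun l => ?_
  · have h1 := hY U le_rfl _ _ (M.res_mem hU (c.coord_mem k))
    have h2 := ((c.partialField_isHomogeneous k).restrict hU).smul h1
    rwa [add_assoc, add_self_zmod_two, add_zero] at h2
  · change _ = VectorField.toFun _ U le_rfl _
    rw [VectorField.sum_toFun]
    simp only [VectorField.smul_toFun, M.res_self]
    have h : ∀ k, ((c.partialField k).restrict hU).toFun U le_rfl (M.res hU (c.coord l))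
        = if k = l then 1 else 0 := fun k => c.partialField_coord hU k l
    simp only [h, mul_ite, mul_one, mul_zero, Finset.sum_ite_eq', Finset.mem_univ, if_true]

end SuperChart

/-! ### The reduced Levi-Civita connection -/

theorem GradedMetric.sum_left {M : SuperSpace.{u, v}} (G : GradedMetric M) {U : Opens M} {ι : Type*}
    (s : Finset ι) (X : ι → VectorField M U) (Z : VectorField M U) :
    G.toFun U (∑ k ∈ s, X k) Z = ∑ k ∈ s, G.toFun U (X k) Z := by
  classical
  induction s using Finset.induction_on with
  | empty => rw [Finset.sum_empty, Finset.sum_empty, VectorField.zero_eq_smul, G.smul_left, zero_mul]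
  | insert a s ha ih => rw [Finset.sum_insert ha, Finset.sum_insert ha, G.add_left, ih]

namespace SuperChart
variable {M : SuperSpace.{u, v}} {n m : ℕ} (c : SuperChart M n m)

/-- The coordinate one-form `dη_k`. -/
def coordForm (k : Fin n ⊕ Fin m) : OneForm M c.dom where
  toFun V hV Y := Y.app (M.res hV (c.coord k))
  map_add _ _ _ _ := rfl
  map_smul V hV f X := by
    change (f • X).toFun V le_rfl _ = _
    rw [VectorField.smul_toFun, M.res_self]
    rfl
  res_comm V W hV h X := by
    change X.toFun W _ _ = M.res h (X.toFun V le_rfl _)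
    rw [← X.res_comm V W le_rfl h, M.res_res]

theorem nabla_eq_sum (nab : Connection M) (i j : Fin n ⊕ Fin m) :
    nab.toFun c.dom (c.partialField i) (c.partialField j)
      = ∑ k, c.christoffel nab i j k • c.partialField k := by
  have h := c.vectorField_eq_sum le_rfl (nab.even c.dom _ _ _ _ (c.partialField_isHomogeneous i)
    (c.partialField_isHomogeneous j))
  simp only [M.res_self] at h
  exact h

theorem partialField_partialField_coord (i j k : Fin n ⊕ Fin m) :
    (c.partialField i).app ((c.partialField j).app (c.coord k)) = 0 := by
  have h := c.partialField_coord le_rfl j k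
  rw [M.res_self] at h
  change (c.partialField i).toFun c.dom le_rfl ((c.partialField j).toFun c.dom le_rfl (c.coord k)) = 0
  rw [h]
  split_ifs
  · exact (c.partialField_isHomogeneous i).apply_one le_rfl
  · rw [map_zero]

theorem christoffel_symm {nab : Connection M} (h : nab.Torsionless) (i j : Fin n)
    (k : Fin n ⊕ Fin m) : c.christoffel nab (.inl i) (.inl j) k
      = c.christoffel nab (.inl j) (.inl i) k := by
  have := h c.dom 0 0 _ _ (c.partialField_isHomogeneous (.inl i))
    (c.partialField_isHomogeneous (.inl j)) c.dom le_rfl (c.coord k)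
  rw [superSign_zero_left, one_smul, one_smul] at this
  have h1 := c.partialField_partialField_coord (.inl i) (.inl j) k
  have h2 := c.partialField_partialField_coord (.inl j) (.inl i) k
  unfold VectorField.app at h1 h2
  rw [h1, h2, sub_zero] at this
  exact sub_eq_zero.1 this

variable (G : GradedMetric M)

/-- The components of the metric. -/
def metricCoeff (i j : Fin n ⊕ Fin m) : M.O c.dom :=
  G.toFun c.dom (c.partialField i) (c.partialField j)

theorem redMetric_apply {p : M} (hc : p ∈ c.dom) (i j : Fin n) :
    G.redMetric c (c.x p) i j = M.value (c.metricCoeff G (.inl i) (.inl j)) p := by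
  change body m (coordRep c.x _ (c.x p)) = _
  rw [c.value_eq hc hc, coordRep_apply _ hc hc, c.ev_eq le_rfl hc]
  rfl

theorem redMetricDeriv_apply {p : M} (hc : p ∈ c.dom) (l i j : Fin n) :
    G.redMetricDeriv c l i j (c.x p)
      = M.value ((c.partialField (.inl l)).app (c.metricCoeff G (.inl i) (.inl j))) p := by
  have he : (fun z => G.redMetric c z i j) =ᶠ[𝓝 (c.x p)]
      fun z => grCLM (body m).toLinearMap (c.rep (c.metricCoeff G (.inl i) (.inl j)) z) := by
    filter_upwards [c.eventually_nhds_of_eventually hc (c.dom.isOpen.mem_nhds hc)] with y hy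
    rw [← hy.2.2, c.redMetric_apply G hy.2.1, c.value_eq hy.1 hy.2.1, c.rep_apply hy.1 hy.2.1]
    rfl
  have hd := ((c.rep_contDiffAt hc hc (c.metricCoeff G (.inl i) (.inl j))).differentiableAt
    (by simp)).hasFDerivAt
  have hd' := ((grCLM (body m).toLinearMap).hasFDerivAt.comp (c.x p) hd).fderiv
  rw [Function.comp_def] at hd'
  rw [GradedMetric.redMetricDeriv, he.fderiv_eq, hd', c.value_eq hc hc,
    VectorField.app, c.ev_partialField_inl le_rfl hc hc]
  rfl

theorem value_metricCoeff_inr {p : M} (hc : p ∈ c.dom) (α : Fin m) (j : Fin n) :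
    M.value (c.metricCoeff G (.inr α) (.inl j)) p = 0 :=
  value_odd c hc hc (G.even c.dom 1 0 _ _ (c.partialField_isHomogeneous (.inr α))
    (c.partialField_isHomogeneous (.inl j)))

theorem metricCoeff_symm (i j : Fin n) :
    c.metricCoeff G (.inl i) (.inl j) = c.metricCoeff G (.inl j) (.inl i) := by
  have := G.symm c.dom 0 0 _ _ (c.partialField_isHomogeneous (.inl i))
    (c.partialField_isHomogeneous (.inl j))
  rwa [superSign_zero_left, one_smul] at this

/-- On bodies, contracting the metric with `∑ k, a_k ∂_k` only involves the even directions. -/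
theorem value_metric_sum {p : M} (hc : p ∈ c.dom) (a : Fin n ⊕ Fin m → M.O c.dom) (j : Fin n) :
    M.value (G.toFun c.dom (∑ k, a k • c.partialField k) (c.partialField (.inl j))) p
      = ∑ r, M.value (a (.inl r)) p * M.value (c.metricCoeff G (.inl r) (.inl j)) p := by
  rw [G.sum_left, Fintype.sum_sum_type]
  simp only [G.smul_left]
  simp only [← c.valueHom_apply hc hc, map_add, map_sum, map_mul]
  rw [Finset.sum_eq_zero (s := (Finset.univ : Finset (Fin m))), add_zero]
  · rfl
  · intro α _
    have := c.value_metricCoeff_inr G hc α j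
    rw [← c.valueHom_apply hc hc] at this
    exact mul_eq_zero_of_right _ this

/-- Non-degeneracy of the graded metric makes the reduced metric invertible: the dual vector fields
of the coordinate forms provide the inverse matrix. -/
theorem exists_mul_redMetric {p : M} (hc : p ∈ c.dom) :
    ∃ A : Matrix (Fin n) (Fin n) ℝ, A * G.redMetric c (c.x p) = 1 := by
  have hX : ∀ k : Fin n, ∃ X : VectorField M c.dom, ∀ j : Fin n,
      (c.partialField (.inl j)).app (c.coord (.inl k))
        = G.toFun c.dom (c.partialField (.inl j)) X := by
    intro k
    obtain ⟨X, hX, -⟩ := G.nondegenerate c.dom (c.coordForm (.inl k))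
    refine ⟨X, fun j => ?_⟩
    have := hX c.dom le_rfl (c.partialField (.inl j))
    change (c.partialField (.inl j)).app (M.res le_rfl (c.coord (.inl k))) = _ at this
    rw [M.res_self] at this
    exact this
  choose X hX using hX
  refine ⟨Matrix.of fun k l => M.value (((X k).component 0).app (c.coord (.inl l))) p, ?_⟩
  ext k j
  have h0 := (X k).component_isHomogeneous 0
  have h1 := (X k).component_isHomogeneous 1
  have hsum := c.vectorField_eq_sum le_rfl h0
  simp only [M.res_self] at hsum
  have hsum' : (X k).component 0
      = ∑ l, ((X k).component 0).app (c.coord l) • c.partialField l := hsum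
  have hodd : M.value (G.toFun c.dom (c.partialField (.inl j)) ((X k).component 1)) p = 0 :=
    value_odd c hc hc (G.even c.dom 0 1 _ _ (c.partialField_isHomogeneous (.inl j)) h1)
  have hev : G.toFun c.dom (c.partialField (.inl j)) ((X k).component 0)
      = G.toFun c.dom ((X k).component 0) (c.partialField (.inl j)) := by
    have := G.symm c.dom 0 0 _ _ (c.partialField_isHomogeneous (.inl j)) h0
    rwa [superSign_zero_left, one_smul] at this
  have h := hX k j
  rw [← (X k).component_add_component, G.add_right, hev] at h
  have hv := congrArg (c.valueHom hc hc) h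
  rw [map_add, c.valueHom_apply, c.valueHom_apply, c.valueHom_apply, hodd, add_zero, hsum',
    c.value_metric_sum G hc] at hv
  have hd := c.partialField_coord le_rfl (.inl j) (.inl k)
  rw [M.res_self] at hd
  have hd' : (c.partialField (.inl j)).app (c.coord (.inl k))
      = if (Sum.inl j : Fin n ⊕ Fin m) = .inl k then 1 else 0 := hd
  rw [hd', ← c.valueHom_apply hc hc] at hv
  rw [Matrix.mul_apply, Matrix.one_apply]
  simp only [Matrix.of_apply, c.redMetric_apply G hc]
  rw [← hv]
  by_cases hjk : j = k
  · subst hjk; simp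
  · simp [hjk, Ne.symm hjk]

/-- The reductions of the even Christoffel symbols of the Levi-Civita connection are the Christoffel
symbols of the reduced metric. -/
theorem value_christoffel {nab : Connection M} (hnab : nab.IsLeviCivita G) {p : M} (hc : p ∈ c.dom)
    (i j k : Fin n) : M.value (c.christoffel nab (.inl i) (.inl j) (.inl k)) p
      = G.redChristoffel c i j k (c.x p) := by
  let Γ : Fin n → Fin n → Fin n → ℝ := fun i j k =>
    M.value (c.christoffel nab (.inl i) (.inl j) (.inl k)) p
  let g : Matrix (Fin n) (Fin n) ℝ := G.redMetric c (c.x p)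
  have hg : ∀ i j, M.value (c.metricCoeff G (.inl i) (.inl j)) p = g i j := fun i j =>
    (c.redMetric_apply G hc i j).symm
  have hgs : ∀ i j, g i j = g j i := fun i j => by
    rw [← hg, ← hg, c.metricCoeff_symm]
  have hΓs : ∀ i j k, Γ i j k = Γ j i k := fun i j k => by
    simp only [Γ, c.christoffel_symm hnab.1 i j]
  -- the metric property, in Christoffel symbols of the first kind
  have hcomp : ∀ l i j, G.redMetricDeriv c l i j (c.x p)
      = ∑ r, Γ l i r * g r j + ∑ r, Γ l j r * g r i := by
    intro l i j
    have hm := hnab.2 c.dom 0 0 (c.partialField (.inl l)) (c.partialField (.inl i))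
      (c.partialField (.inl j)) (c.partialField_isHomogeneous (.inl l))
      (c.partialField_isHomogeneous (.inl i))
    have hs := G.symm c.dom 0 0 _ _ (c.partialField_isHomogeneous (.inl i))
      (nab.even c.dom 0 0 _ _ (c.partialField_isHomogeneous (.inl l))
        (c.partialField_isHomogeneous (.inl j)))
    rw [superSign_zero_left, one_smul] at hm hs
    rw [hs] at hm
    rw [c.redMetricDeriv_apply G hc, metricCoeff, hm, ← c.valueHom_apply hc hc, map_add,
      c.valueHom_apply, c.valueHom_apply, c.nabla_eq_sum, c.nabla_eq_sum, c.value_metric_sum G hc,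
      c.value_metric_sum G hc]
    simp only [hg, Γ]
  obtain ⟨A, hA⟩ := c.exists_mul_redMetric G hc
  have hinv : (G.redMetric c (c.x p))⁻¹ = A := Matrix.inv_eq_left_inv hA
  have hAg : ∀ r, ∑ l, A k l * g r l = if k = r then 1 else 0 := by
    intro r
    have := congrFun (congrFun hA k) r
    rw [Matrix.mul_apply, Matrix.one_apply] at this
    rw [← this]
    exact Finset.sum_congr rfl fun l _ => by rw [hgs r l]
  have hterm : ∀ l, G.redMetricDeriv c i j l (c.x p) + G.redMetricDeriv c j i l (c.x p)
      - G.redMetricDeriv c l i j (c.x p) = 2 * ∑ r, Γ i j r * g r l := by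
    intro l
    rw [hcomp, hcomp, hcomp]
    simp only [hΓs j i, hΓs l i, hΓs l j]
    ring
  rw [GradedMetric.redChristoffel, hinv]
  simp only [hterm]
  have h2 : ∑ l, A k l * (2 * ∑ r, Γ i j r * g r l) = 2 * ∑ r, Γ i j r * ∑ l, A k l * g r l := by
    simp only [Finset.mul_sum]
    rw [Finset.sum_comm]
    exact Finset.sum_congr rfl fun r _ => Finset.sum_congr rfl fun l _ => by ring
  rw [h2]
  simp only [hAg, mul_ite, mul_one, mul_zero, Finset.sum_ite_eq, Finset.mem_univ, if_true]
  change Γ i j k = _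
  ring

/-- The body of `Γ_{ij}^k` vanishes unless the sum of the parities is even. -/
theorem value_christoffel_eq_zero (nab : Connection M) {p : M} (hc : p ∈ c.dom)
    {i j k : Fin n ⊕ Fin m} (h : coordParity i + coordParity j + coordParity k = 1) :
    M.value (c.christoffel nab i j k) p = 0 := by
  have h1 := nab.even c.dom _ _ _ _ (c.partialField_isHomogeneous i) (c.partialField_isHomogeneous j)
    c.dom le_rfl _ _ (c.coord_mem k)
  rw [h] at h1
  exact value_odd c hc hc h1

end SuperChart

/-! ### Superfunctions on `ℝ^{1|1}` -/

namespace superLine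

variable {W : Opens ℝ}

theorem reduced_apply (f : superLine.O W) {t : ℝ} (ht : t ∈ W) : reduced f t = body 1 (f.1 ⟨t, ht⟩) :=
  congrArg (body 1) (coordRep_apply (x := OpenPartialHomeomorph.refl ℝ) f.1 ht trivial)

/-- The reduction at `t` as a homomorphism of algebras. -/
def redHom {t : ℝ} (ht : t ∈ W) : superLine.O W →ₐ[ℝ] ℝ :=
  (body 1).comp ((Pi.evalAlgHom ℝ (fun _ : W => Gr 1) ⟨t, ht⟩).comp
    (grSections (OpenPartialHomeomorph.refl ℝ) 1 W).val)

theorem redHom_apply {t : ℝ} (ht : t ∈ W) (f : superLine.O W) : redHom ht f = reduced f t :=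
  (reduced_apply f ht).symm

theorem reduced_contDiffAt (f : superLine.O W) {t : ℝ} (ht : t ∈ W) :
    ContDiffAt ℝ ∞ (reduced f) t :=
  (grCLM (body 1).toLinearMap).contDiff.contDiffAt.comp t (f.2 t ht trivial)

theorem reduced_differentiableAt (f : superLine.O W) {t : ℝ} (ht : t ∈ W) :
    DifferentiableAt ℝ (reduced f) t :=
  (reduced_contDiffAt f ht).differentiableAt (by simp)

theorem reduced_res {W' : Opens ℝ} (h : W' ≤ W) (f : superLine.O W) {t : ℝ} (ht : t ∈ W') :
    reduced (superLine.res h f) t = reduced f t := by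
  rw [reduced_apply _ ht, reduced_apply _ (h ht)]
  rfl

theorem reduced_dt (f : superLine.O W) {t : ℝ} (ht : t ∈ W) :
    reduced (dt W f) t = deriv (reduced f) t := by
  have hd : HasFDerivAt (coordRep (OpenPartialHomeomorph.refl ℝ) f.1)
      (fderiv ℝ (coordRep (OpenPartialHomeomorph.refl ℝ) f.1) t) t :=
    (ContDiffAt.differentiableAt (f.2 t ht trivial) (by simp)).hasFDerivAt
  have h := ((grCLM (body 1).toLinearMap).hasFDerivAt.comp t hd).hasDerivAt.deriv
  rw [reduced_apply _ ht]
  exact h.symm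

theorem reduced_odd {f : superLine.O W} (hf : f ∈ superLine.parity W 1) {t : ℝ} (ht : t ∈ W) :
    reduced f t = 0 := by
  rw [reduced_apply _ ht]
  exact body_odd (hf ⟨t, ht⟩)

theorem reduced_dxi (f : superLine.O W) {t : ℝ} (ht : t ∈ W) : reduced (dxi W f) t
    = body 1 (CliffordAlgebra.contractLeft (LinearMap.proj (0 : Fin 1)) (f.1 ⟨t, ht⟩)) :=
  reduced_apply _ ht

theorem reduced_dxi_even {f : superLine.O W} (hf : f ∈ superLine.parity W 0) {t : ℝ} (ht : t ∈ W) :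
    reduced (dxi W f) t = 0 := by
  have h := gr_contract_mem (LinearMap.proj (0 : Fin 1)) 0 _ (hf ⟨t, ht⟩)
  rw [add_zero] at h
  rw [reduced_dxi _ ht]
  exact body_odd h

theorem eq_reduced_add (f : superLine.O W) {t : ℝ} (ht : t ∈ W) :
    f.1 ⟨t, ht⟩ = algebraMap ℝ (Gr 1) (reduced f t) + reduced (dxi W f) t • xi := by
  rw [reduced_apply _ ht, reduced_dxi _ ht]
  exact gr_one_eq _

theorem reduced_dt_mul (f g : superLine.O W) {t : ℝ} (ht : t ∈ W) :
    reduced (dt W (f * g)) t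
      = reduced (dt W f) t * reduced g t + reduced f t * reduced (dt W g) t := by
  have : dt W (f * g) = dt W f * g + f * dt W g := grSections.dir_mul _ _ _ _ _ _ _
  rw [this]
  simp only [← redHom_apply ht, map_add, map_mul]

theorem reduced_dxi_mul (f g : superLine.O W) {t : ℝ} (ht : t ∈ W) :
    reduced (dxi W (f * g)) t
      = reduced (dxi W f) t * reduced g t + reduced f t * reduced (dxi W g) t := by
  rw [reduced_dxi _ ht, reduced_dxi _ ht, reduced_dxi _ ht, reduced_apply _ ht, reduced_apply _ ht]
  change body 1 (CliffordAlgebra.contractLeft _ (f.1 ⟨t, ht⟩ * g.1 ⟨t, ht⟩)) = _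
  rw [gr_contract_mul, map_add, map_mul, map_mul, body_involute]

theorem dt_res {W' : Opens ℝ} (h : W' ≤ W) (f : superLine.O W) {t : ℝ} (ht : t ∈ W') :
    reduced (dt W' (superLine.res h f)) t = reduced (dt W f) t := by
  have : superLine.res h (dt W f) = dt W' (superLine.res h f) :=
    grSections.dir_res _ _ (Set.subset_univ _) h _ _
  rw [← this, reduced_res h _ ht]

theorem dxi_res {W' : Opens ℝ} (h : W' ≤ W) (f : superLine.O W) {t : ℝ} (ht : t ∈ W') :
    reduced (dxi W' (superLine.res h f)) t = reduced (dxi W f) t := by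
  rw [reduced_dxi _ ht, reduced_dxi _ (h ht)]
  rfl

end superLine

theorem mem_preimageOpens {X : Type u} {Y : Type w} [TopologicalSpace X] [TopologicalSpace Y]
    {U : Opens X} {f : C(U, Y)} {W : Opens Y} {t : X} (ht : t ∈ U) (h : f ⟨t, ht⟩ ∈ W) :
    t ∈ preimageOpens f W := ⟨⟨t, ht⟩, h, rfl⟩

theorem preimageOpens_le {X : Type u} {Y : Type w} [TopologicalSpace X] [TopologicalSpace Y]
    {U : Opens X} {f : C(U, Y)} {W : Opens Y} : preimageOpens f W ≤ U := by
  rintro _ ⟨t, -, rfl⟩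
  exact t.2

theorem apply_mem_of_mem_preimageOpens {X : Type u} {Y : Type w} [TopologicalSpace X]
    [TopologicalSpace Y] {U : Opens X} {f : C(U, Y)} {W : Opens Y} {t : X}
    (h : t ∈ preimageOpens f W) : f ⟨t, preimageOpens_le h⟩ ∈ W := by
  obtain ⟨s, hs, rfl⟩ := h
  exact hs

/-! ### Supercurves at a point -/

namespace SuperCurve
variable {I : Opens ℝ} {M : SuperSpace.{u, v}} {n m : ℕ} (γ : SuperCurve I M)

/-- The reduction of `γ^* f` is the value of `f` along the underlying curve. -/
theorem reduced_pull (c : SuperChart M n m) {U : Opens M} (f : M.O U) {t : ℝ} (ht : t ∈ I)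
    (hU : γ.base ⟨t, ht⟩ ∈ U) (hc : γ.base ⟨t, ht⟩ ∈ c.dom) :
    superLine.reduced (γ.pull U f) t = M.value f (γ.base ⟨t, ht⟩) := by
  rw [c.value_eq hU hc]
  refine (c.hasValue_iff hU hc f _).1 fun V hV hpV hu => ?_
  have htV := mem_preimageOpens ht hpV
  have h := (hu.map (γ.pull V)).map (superLine.redHom htV)
  rw [map_sub, map_sub, γ.pull_res, AlgHom.commutes, AlgHom.commutes, superLine.redHom_apply] at h
  have h1 := superLine.reduced_res (preimageOpens_mono γ.base hV) (γ.pull U f) htV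
  rw [h1] at h
  simp at h

/-- The tangent vector of `M` at `γ(t)` induced by `dγ(∂_t)`. -/
def tangentT (c : SuperChart M n m) {t : ℝ} (ht : t ∈ I) (hc : γ.base ⟨t, ht⟩ ∈ c.dom) :
    TangentVector M (γ.base ⟨t, ht⟩) where
  toFun V hp := (superLine.redHom (mem_preimageOpens ht hp)).toLinearMap ∘ₗ γ.velT V
  res_comm V W h hp f := by
    refine (superLine.redHom_apply _ _).trans (Eq.trans ?_ (superLine.redHom_apply _ _).symm)
    change superLine.reduced (superLine.dt _ (γ.pull W (M.res h f))) t = _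
    rw [γ.pull_res]
    exact superLine.dt_res _ _ (mem_preimageOpens ht hp)
  leibniz V hp f g := by
    have e : ∀ f, ((superLine.redHom (mem_preimageOpens ht hp)).toLinearMap ∘ₗ γ.velT V) f
        = superLine.reduced (superLine.dt _ (γ.pull V f)) t := fun f => superLine.redHom_apply _ _
    rw [e, e, e, map_mul, superLine.reduced_dt_mul _ _ (mem_preimageOpens ht hp),
      γ.reduced_pull c f ht hp hc, γ.reduced_pull c g ht hp hc]

theorem tangentT_apply (c : SuperChart M n m) {t : ℝ} (ht : t ∈ I) (hc : γ.base ⟨t, ht⟩ ∈ c.dom)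
    {V : Opens M} (hp : γ.base ⟨t, ht⟩ ∈ V) (f : M.O V) :
    (γ.tangentT c ht hc).toFun V hp f = superLine.reduced (γ.velT V f) t :=
  superLine.redHom_apply (mem_preimageOpens ht hp) _

/-- The tangent vector of `M` at `γ(t)` induced by `dγ(∂_ξ)`. -/
def tangentXi (c : SuperChart M n m) {t : ℝ} (ht : t ∈ I) (hc : γ.base ⟨t, ht⟩ ∈ c.dom) :
    TangentVector M (γ.base ⟨t, ht⟩) where
  toFun V hp := (superLine.redHom (mem_preimageOpens ht hp)).toLinearMap ∘ₗ γ.velXi V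
  res_comm V W h hp f := by
    refine (superLine.redHom_apply _ _).trans (Eq.trans ?_ (superLine.redHom_apply _ _).symm)
    change superLine.reduced (superLine.dxi _ (γ.pull W (M.res h f))) t = _
    rw [γ.pull_res]
    exact superLine.dxi_res _ _ (mem_preimageOpens ht hp)
  leibniz V hp f g := by
    have e : ∀ f, ((superLine.redHom (mem_preimageOpens ht hp)).toLinearMap ∘ₗ γ.velXi V) f
        = superLine.reduced (superLine.dxi _ (γ.pull V f)) t := fun f => superLine.redHom_apply _ _
    rw [e, e, e, map_mul, superLine.reduced_dxi_mul _ _ (mem_preimageOpens ht hp),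
      γ.reduced_pull c f ht hp hc, γ.reduced_pull c g ht hp hc]

theorem tangentXi_apply (c : SuperChart M n m) {t : ℝ} (ht : t ∈ I) (hc : γ.base ⟨t, ht⟩ ∈ c.dom)
    {V : Opens M} (hp : γ.base ⟨t, ht⟩ ∈ V) (f : M.O V) :
    (γ.tangentXi c ht hc).toFun V hp f = superLine.reduced (γ.velXi V f) t :=
  superLine.redHom_apply (mem_preimageOpens ht hp) _

theorem velT_eq_deriv {U : Opens M} (f : M.O U) {t : ℝ} (ht : t ∈ preimageOpens γ.base U) :
    superLine.reduced (γ.velT U f) t = deriv (superLine.reduced (γ.pull U f)) t :=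
  superLine.reduced_dt _ ht

theorem velT_odd {U : Opens M} {f : M.O U} (hf : f ∈ M.parity U 1) {t : ℝ}
    (ht : t ∈ preimageOpens γ.base U) : superLine.reduced (γ.velT U f) t = 0 :=
  superLine.reduced_odd (grSections.dir_mem _ _ _ (Set.subset_univ _) _ 1 _ (γ.pull_mem U 1 f hf)) ht

theorem velXi_even {U : Opens M} {f : M.O U} (hf : f ∈ M.parity U 0) {t : ℝ}
    (ht : t ∈ preimageOpens γ.base U) : superLine.reduced (γ.velXi U f) t = 0 :=
  superLine.reduced_dxi_even (γ.pull_mem U 0 f hf) ht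

theorem deriv_eq_zero_of_forall_mem {f : ℝ → ℝ} {W : Opens ℝ} (h : ∀ t ∈ W, f t = 0) {t : ℝ}
    (ht : t ∈ W) : deriv f t = 0 := by
  have : f =ᶠ[𝓝 t] fun _ => 0 := Filter.eventually_of_mem (W.isOpen.mem_nhds ht) h
  rw [this.deriv_eq, deriv_const]

variable (c : SuperChart M n m) (nab : Connection M)

theorem reduced_covDtCoeff
    (X : M.O c.dom →ₗ[ℝ] superLine.O (preimageOpens γ.base c.dom)) (k : Fin n ⊕ Fin m) {t : ℝ}
    (ht : t ∈ preimageOpens γ.base c.dom) :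
    superLine.reduced (covDtCoeff nab γ c X k) t = deriv (superLine.reduced (X (c.coord k))) t
      + ∑ i, ∑ j, superLine.reduced (X (c.coord j)) t
        * superLine.reduced (γ.velT c.dom (c.coord i)) t
        * M.value (c.christoffel nab i j k) (γ.base ⟨t, preimageOpens_le ht⟩) := by
  have hc := apply_mem_of_mem_preimageOpens ht
  rw [covDtCoeff, ← superLine.redHom_apply ht, map_add, map_sum, superLine.redHom_apply,
    superLine.reduced_dt _ ht]
  congr 1
  refine Finset.sum_congr rfl fun i _ => ?_
  rw [map_sum]
  refine Finset.sum_congr rfl fun j _ => ?_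
  rw [map_mul, map_mul, superLine.redHom_apply, superLine.redHom_apply, superLine.redHom_apply,
    γ.reduced_pull c _ _ hc hc]
  rfl

theorem reducedVanishes_covDt_iff
    (X : M.O c.dom →ₗ[ℝ] superLine.O (preimageOpens γ.base c.dom)) :
    ReducedVanishes (covDt nab γ c X) ↔ ∀ t ∈ preimageOpens γ.base c.dom, ∀ k,
      superLine.reduced (covDtCoeff nab γ c X k) t = 0 := by
  have hsum : ∀ f, covDt nab γ c X f = ∑ k, covDtCoeff nab γ c X k *
      γ.pull c.dom ((c.partialField k).toFun c.dom le_rfl f) := by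
    intro f
    simp [covDt, LinearMap.sum_apply]
  constructor
  · intro h t ht l
    have h1 := h (c.coord l) t ht
    rw [hsum] at h1
    have h2 : ∀ k, (c.partialField k).toFun c.dom le_rfl (c.coord l) = if k = l then 1 else 0 := by
      intro k
      have := c.partialField_coord le_rfl k l
      rwa [M.res_self] at this
    have h3 : ∀ k, covDtCoeff nab γ c X k * γ.pull c.dom (if k = l then 1 else 0)
        = if k = l then covDtCoeff nab γ c X k else 0 := by
      intro k
      split_ifs
      · rw [map_one, mul_one]
      · rw [map_zero, mul_zero]
    simp only [h2, h3, Finset.sum_ite_eq', Finset.mem_univ, if_true] at h1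
    exact h1
  · intro h f t ht
    rw [hsum, ← superLine.redHom_apply ht, map_sum]
    refine Finset.sum_eq_zero fun k _ => ?_
    rw [map_mul, superLine.redHom_apply, h t ht k, zero_mul]

theorem velT_coord_inl {t : ℝ} (ht : t ∈ preimageOpens γ.base c.dom) (i : Fin n) :
    superLine.reduced (γ.velT c.dom (c.coord (.inl i))) t = deriv (γ.evenCoord c i) t :=
  γ.velT_eq_deriv _ ht

theorem velT_coord_inr {t : ℝ} (ht : t ∈ preimageOpens γ.base c.dom) (α : Fin m) :
    superLine.reduced (γ.velT c.dom (c.coord (.inr α))) t = 0 :=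
  γ.velT_odd (c.coord_mem (.inr α)) ht

theorem velXi_coord_inl {t : ℝ} (ht : t ∈ preimageOpens γ.base c.dom) (i : Fin n) :
    superLine.reduced (γ.velXi c.dom (c.coord (.inl i))) t = 0 :=
  γ.velXi_even (c.coord_mem (.inl i)) ht

theorem reduced_covDtCoeff_velT_inl (k : Fin n) {t : ℝ} (ht : t ∈ preimageOpens γ.base c.dom) :
    superLine.reduced (covDtCoeff nab γ c (γ.velT c.dom) (.inl k)) t
      = deriv (deriv (γ.evenCoord c k)) t
        + ∑ i, ∑ j, deriv (γ.evenCoord c j) t * deriv (γ.evenCoord c i) t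
          * M.value (c.christoffel nab (.inl i) (.inl j) (.inl k))
            (γ.base ⟨t, preimageOpens_le ht⟩) := by
  have h : superLine.reduced (γ.velT c.dom (c.coord (.inl k))) =ᶠ[𝓝 t] deriv (γ.evenCoord c k) :=
    Filter.eventually_of_mem ((preimageOpens γ.base c.dom).isOpen.mem_nhds ht)
      fun s hs => γ.velT_coord_inl c hs k
  rw [γ.reduced_covDtCoeff c nab _ _ ht, h.deriv_eq]
  simp [Fintype.sum_sum_type, γ.velT_coord_inl c ht, γ.velT_coord_inr c ht]

theorem reduced_covDtCoeff_velT_inr (δ : Fin m) {t : ℝ} (ht : t ∈ preimageOpens γ.base c.dom) :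
    superLine.reduced (covDtCoeff nab γ c (γ.velT c.dom) (.inr δ)) t = 0 := by
  have h0 : ∀ i j : Fin n, M.value (c.christoffel nab (.inl i) (.inl j) (.inr δ))
      (γ.base ⟨t, preimageOpens_le ht⟩) = 0 := fun i j =>
    c.value_christoffel_eq_zero nab (apply_mem_of_mem_preimageOpens ht) rfl
  rw [γ.reduced_covDtCoeff c nab _ _ ht,
    deriv_eq_zero_of_forall_mem (fun s hs => γ.velT_coord_inr c hs δ) ht]
  simp [Fintype.sum_sum_type, γ.velT_coord_inr c ht, h0]

theorem reduced_covDtCoeff_velXi_inl (k : Fin n) {t : ℝ} (ht : t ∈ preimageOpens γ.base c.dom) :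
    superLine.reduced (covDtCoeff nab γ c (γ.velXi c.dom) (.inl k)) t = 0 := by
  have h0 : ∀ (i : Fin n) (β : Fin m), M.value (c.christoffel nab (.inl i) (.inr β) (.inl k))
      (γ.base ⟨t, preimageOpens_le ht⟩) = 0 := fun i β =>
    c.value_christoffel_eq_zero nab (apply_mem_of_mem_preimageOpens ht) rfl
  rw [γ.reduced_covDtCoeff c nab _ _ ht,
    deriv_eq_zero_of_forall_mem (fun s hs => γ.velXi_coord_inl c hs k) ht]
  simp [Fintype.sum_sum_type, γ.velT_coord_inr c ht, γ.velXi_coord_inl c ht, h0]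

theorem reduced_covDtCoeff_velXi_inr (δ : Fin m) {t : ℝ} (ht : t ∈ preimageOpens γ.base c.dom) :
    superLine.reduced (covDtCoeff nab γ c (γ.velXi c.dom) (.inr δ)) t
      = deriv (γ.oddCoord c δ) t
        + ∑ i, ∑ β, deriv (γ.evenCoord c i) t * γ.oddCoord c β t
          * M.value (c.christoffel nab (.inl i) (.inr β) (.inr δ))
            (γ.base ⟨t, preimageOpens_le ht⟩) := by
  have h : ∀ β, superLine.reduced (γ.velXi c.dom (c.coord (.inr β))) = γ.oddCoord c β :=
    fun β => rfl
  rw [γ.reduced_covDtCoeff c nab _ _ ht, h]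
  simp [Fintype.sum_sum_type, γ.velT_coord_inl c ht, γ.velT_coord_inr c ht,
    γ.velXi_coord_inl c ht, h, mul_comm (γ.oddCoord c _ t)]

/-! ### The coordinate form of the geodesic conditions -/

theorem evenCoord_eq {t : ℝ} (ht : t ∈ preimageOpens γ.base c.dom) (i : Fin n) :
    γ.evenCoord c i t = c.x (γ.base ⟨t, preimageOpens_le ht⟩) i := by
  have hc := apply_mem_of_mem_preimageOpens ht
  rw [evenCoord, γ.reduced_pull c _ _ hc hc, c.value_coord_inl hc]

theorem curveCoord_eq {t : ℝ} (ht : t ∈ preimageOpens γ.base c.dom) (i : Fin n) :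
    GradedMetric.curveCoord c γ.base t i = γ.evenCoord c i t := by
  rw [γ.evenCoord_eq c ht, GradedMetric.curveCoord, dif_pos (preimageOpens_le ht)]

theorem evenCoord_contDiffAt {t : ℝ} (ht : t ∈ preimageOpens γ.base c.dom) (i : Fin n) :
    ContDiffAt ℝ ∞ (γ.evenCoord c i) t := superLine.reduced_contDiffAt _ ht

theorem oddCoord_contDiffAt {t : ℝ} (ht : t ∈ preimageOpens γ.base c.dom) (α : Fin m) :
    ContDiffAt ℝ ∞ (γ.oddCoord c α) t := superLine.reduced_contDiffAt _ ht

theorem pull_coord_inl {t : ℝ} (ht : t ∈ preimageOpens γ.base c.dom) (i : Fin n) :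
    (γ.pull c.dom (c.coord (.inl i))).1 ⟨t, ht⟩ = algebraMap ℝ (Gr 1) (γ.evenCoord c i t) := by
  have h := superLine.eq_reduced_add (γ.pull c.dom (c.coord (.inl i))) ht
  have h0 := γ.velXi_coord_inl c ht i
  change superLine.reduced (superLine.dxi _ (γ.pull c.dom (c.coord (.inl i)))) t = 0 at h0
  rwa [h0, zero_smul, add_zero] at h

theorem pull_coord_inr {t : ℝ} (ht : t ∈ preimageOpens γ.base c.dom) (α : Fin m) :
    (γ.pull c.dom (c.coord (.inr α))).1 ⟨t, ht⟩ = γ.oddCoord c α t • superLine.xi := by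
  have h := superLine.eq_reduced_add (γ.pull c.dom (c.coord (.inr α))) ht
  rwa [superLine.reduced_odd (γ.pull_mem _ 1 _ (c.coord_mem (.inr α))) ht, map_zero, zero_add] at h

theorem curveCoord_eventuallyEq {t : ℝ} (ht : t ∈ preimageOpens γ.base c.dom) (i : Fin n) :
    (fun s => GradedMetric.curveCoord c γ.base s i) =ᶠ[𝓝 t] γ.evenCoord c i :=
  Filter.eventually_of_mem ((preimageOpens γ.base c.dom).isOpen.mem_nhds ht)
    fun _ hs => γ.curveCoord_eq c hs i

/-- The reduced geodesic equation in a chart, at one parameter value. -/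
theorem redGeodesic_eq_iff {G : GradedMetric M} (hnab : nab.IsLeviCivita G) {t : ℝ}
    (ht : t ∈ preimageOpens γ.base c.dom) (k : Fin n) :
    superLine.reduced (covDtCoeff nab γ c (γ.velT c.dom) (.inl k)) t
      = deriv (deriv fun s => GradedMetric.curveCoord c γ.base s k) t
      + ∑ i, ∑ j, G.redChristoffel c i j k (GradedMetric.curveCoord c γ.base t)
        * deriv (fun s => GradedMetric.curveCoord c γ.base s i) t
        * deriv (fun s => GradedMetric.curveCoord c γ.base s j) t := by
  have hc := apply_mem_of_mem_preimageOpens ht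
  have hx : GradedMetric.curveCoord c γ.base t = c.x (γ.base ⟨t, preimageOpens_le ht⟩) := by
    rw [GradedMetric.curveCoord, dif_pos (preimageOpens_le ht)]
  rw [γ.reduced_covDtCoeff_velT_inl c nab k ht, hx,
    (γ.curveCoord_eventuallyEq c ht k).deriv.deriv_eq]
  congr 1
  refine Finset.sum_congr rfl fun i _ => Finset.sum_congr rfl fun j _ => ?_
  rw [(γ.curveCoord_eventuallyEq c ht i).deriv_eq, (γ.curveCoord_eventuallyEq c ht j).deriv_eq,
    c.value_christoffel G hnab hc]
  ring

/-- The even half of the supergeodesic condition is the geodesic equation of the underlying curve. -/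
theorem isRedGeodesic_iff {G : GradedMetric M} (hnab : nab.IsLeviCivita G) :
    G.IsRedGeodesic n m γ.base ↔
      ∀ c : SuperChart M n m, ReducedVanishes (covDt nab γ c (γ.velT c.dom)) := by
  constructor
  · intro h c
    rw [γ.reducedVanishes_covDt_iff]
    rintro t ht (k | δ)
    · rw [γ.redGeodesic_eq_iff c nab hnab ht]
      exact (h c).2 t ht k
    · exact γ.reduced_covDtCoeff_velT_inr c nab δ ht
  · intro h c
    have h' := (γ.reducedVanishes_covDt_iff c nab _).1 (h c)
    refine ⟨?_, fun t ht k => ?_⟩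
    · intro t ht
      rw [contDiffWithinAt_pi]
      intro i
      exact ((γ.evenCoord_contDiffAt c ht i).congr_of_eventuallyEq
        (γ.curveCoord_eventuallyEq c ht i)).contDiffWithinAt
    · rw [← γ.redGeodesic_eq_iff c nab hnab ht]
      exact h' t ht (.inl k)

theorem isSupergeodesic_iff {G : GradedMetric M} (hnab : nab.IsLeviCivita G) :
    γ.IsSupergeodesic n m nab ↔ G.IsRedGeodesic n m γ.base ∧ γ.OddCondition n m nab := by
  rw [γ.isRedGeodesic_iff nab hnab]
  exact forall_and

theorem reducedVanishes_velXi_iff :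
    ReducedVanishes (γ.covDt nab c (γ.velXi c.dom)) ↔
      ∀ (δ : Fin m), ∀ t ∈ preimageOpens γ.base c.dom,
        deriv (γ.oddCoord c δ) t + ∑ i : Fin n, ∑ β : Fin m,
          deriv (γ.evenCoord c i) t * γ.oddCoord c β t *
            superLine.reduced (γ.pull c.dom (c.christoffel nab (.inl i) (.inr β) (.inr δ))) t
          = 0 := by
  have key : ∀ t (ht : t ∈ preimageOpens γ.base c.dom) δ,
      superLine.reduced (covDtCoeff nab γ c (γ.velXi c.dom) (.inr δ)) t
        = deriv (γ.oddCoord c δ) t + ∑ i : Fin n, ∑ β : Fin m,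
          deriv (γ.evenCoord c i) t * γ.oddCoord c β t *
            superLine.reduced (γ.pull c.dom (c.christoffel nab (.inl i) (.inr β) (.inr δ))) t := by
    intro t ht δ
    have hc := apply_mem_of_mem_preimageOpens ht
    rw [γ.reduced_covDtCoeff_velXi_inr c nab δ ht]
    simp only [γ.reduced_pull c _ _ hc hc]
  rw [γ.reducedVanishes_covDt_iff]
  constructor
  · intro h δ t ht
    rw [← key t ht]
    exact h t ht (.inr δ)
  · rintro h t ht (k | δ)
    · exact γ.reduced_covDtCoeff_velXi_inl c nab k ht
    · rw [key t ht]
      exact h δ t ht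

end SuperCurve

/-! ### The Hessian and independence of the chart -/

namespace Connection
variable {M : SuperSpace.{u, v}} (nab : Connection M) {U : Opens M}

theorem sum_left {ι : Type*} (s : Finset ι) (a : ι → M.O U) (X : ι → VectorField M U)
    (Y : VectorField M U) :
    nab.toFun U (∑ k ∈ s, a k • X k) Y = ∑ k ∈ s, a k • nab.toFun U (X k) Y := by
  classical
  induction s using Finset.induction_on with
  | empty =>
    rw [Finset.sum_empty, Finset.sum_empty, VectorField.zero_eq_smul, nab.smul_left]
    ext V hV f
    rw [VectorField.smul_toFun, map_zero, zero_mul, VectorField.smul_toFun, map_zero, zero_mul]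
  | insert k s hk ih =>
    rw [Finset.sum_insert hk, Finset.sum_insert hk, nab.add_left, nab.smul_left, ih]

theorem sum_right {ι : Type*} (s : Finset ι) (a : ι → M.O U) (j : ι → ZMod 2)
    (ha : ∀ k, a k ∈ M.parity U (j k)) {X : VectorField M U} (hX : X.IsHomogeneous 0)
    (Y : ι → VectorField M U) :
    nab.toFun U X (∑ k ∈ s, a k • Y k)
      = ∑ k ∈ s, (X.app (a k) • Y k + a k • nab.toFun U X (Y k)) := by
  classical
  induction s using Finset.induction_on with
  | empty =>
    rw [Finset.sum_empty, Finset.sum_empty, VectorField.zero_eq_smul,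
      nab.leibniz U 0 0 X 0 0 hX (Submodule.zero_mem _)]
    ext V hV f
    rw [VectorField.add_toFun, VectorField.smul_toFun, VectorField.smul_toFun,
      VectorField.smul_toFun, VectorField.app]
    simp
  | insert k s hk ih =>
    rw [Finset.sum_insert hk, Finset.sum_insert hk, nab.add_right,
      nab.leibniz U 0 (j k) X _ _ hX (ha k), superSign_zero_left, one_smul, ih]

/-- The Hessian `X (Y f) - (∇_X Y) f` of a superfunction. -/
def hessian (X Y : VectorField M U) (f : M.O U) : M.O U :=
  X.app (Y.app f) - (nab.toFun U X Y).app f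

theorem hessian_sum_left {ι : Type*} (s : Finset ι) (a : ι → M.O U) (X : ι → VectorField M U)
    (Y : VectorField M U) (f : M.O U) :
    nab.hessian (∑ k ∈ s, a k • X k) Y f = ∑ k ∈ s, a k * nab.hessian (X k) Y f := by
  simp only [hessian, VectorField.app, nab.sum_left, VectorField.sum_toFun, VectorField.smul_toFun,
    M.res_self, mul_sub, Finset.sum_sub_distrib]

theorem hessian_sum_right {ι : Type*} (s : Finset ι) (a : ι → M.O U) (j : ι → ZMod 2)
    (ha : ∀ k, a k ∈ M.parity U (j k)) {X : VectorField M U} (hX : X.IsHomogeneous 0)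
    (Y : ι → VectorField M U) (f : M.O U) :
    nab.hessian X (∑ k ∈ s, a k • Y k) f = ∑ k ∈ s, a k * nab.hessian X (Y k) f := by
  simp only [hessian, VectorField.app, nab.sum_right s a j ha hX, VectorField.sum_toFun,
    VectorField.add_toFun, VectorField.smul_toFun, M.res_self, map_sum, ← Finset.sum_sub_distrib]
  refine Finset.sum_congr rfl fun k _ => ?_
  rw [hX.apply_mul le_rfl (ha k), superSign_zero_left, one_smul, mul_sub]
  abel

end Connection

theorem sum_mul_sum_mul {ι κ : Type*} [Fintype ι] [Fintype κ] (A B : ι → κ → ℝ) (H : κ → κ → ℝ) :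
    ∑ i, ∑ j, ∑ a, ∑ b, A i a * B j b * H a b
      = ∑ a, ∑ b, (∑ i, A i a) * (∑ j, B j b) * H a b := by
  simp only [Finset.sum_mul, Finset.mul_sum]
  rw [Finset.sum_congr rfl fun i _ => Finset.sum_comm, Finset.sum_comm]
  refine Finset.sum_congr rfl fun a _ => ?_
  rw [Finset.sum_congr rfl fun i _ => Finset.sum_comm, Finset.sum_comm]
  exact Finset.sum_congr rfl fun b _ => Finset.sum_comm

namespace SuperChart
variable {M : SuperSpace.{u, v}} {n m : ℕ} (c : SuperChart M n m)

theorem value_nabla (nab : Connection M) {U : Opens M} (hU : U ≤ c.dom) {p : M} (hp : p ∈ U)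
    (i j : Fin n ⊕ Fin m) (f : M.O U) :
    M.value ((nab.toFun U ((c.partialField i).restrict hU) ((c.partialField j).restrict hU)).app f) p
      = ∑ k, M.value (c.christoffel nab i j k) p
        * M.value ((c.partialField k).toFun U hU f) p := by
  rw [nab.res_comm c.dom U hU, c.nabla_eq_sum]
  change M.value ((∑ k, c.christoffel nab i j k • c.partialField k).toFun U hU f) p = _
  rw [VectorField.sum_toFun, ← c.valueHom_apply hp (hU hp), map_sum]
  refine Finset.sum_congr rfl fun k _ => ?_
  rw [VectorField.smul_toFun, map_mul, c.valueHom_apply, c.valueHom_apply, value_res c hU hp (hU hp)]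

/-- The Jacobian matrix `∂_i η'_a` of a change of coordinates from `η` to `η'`. -/
def jacobian (c' : SuperChart M n m) (i a : Fin n ⊕ Fin m) : M.O (c.dom ⊓ c'.dom) :=
  ((c.partialField i).restrict inf_le_left).app (M.res inf_le_right (c'.coord a))

theorem jacobian_mem (c' : SuperChart M n m) (i a : Fin n ⊕ Fin m) :
    c.jacobian c' i a ∈ M.parity _ (coordParity i + coordParity a) :=
  ((c.partialField_isHomogeneous i).restrict inf_le_left) _ le_rfl _ _
    (M.res_mem _ (c'.coord_mem a))

theorem partialField_eq_sum (c' : SuperChart M n m) (i : Fin n ⊕ Fin m) :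
    (c.partialField i).restrict (inf_le_left : c.dom ⊓ c'.dom ≤ c.dom)
      = ∑ a, c.jacobian c' i a • (c'.partialField a).restrict inf_le_right :=
  c'.vectorField_eq_sum inf_le_right ((c.partialField_isHomogeneous i).restrict inf_le_left)

/-- The transformation of the components of a tangent vector under a change of coordinates. -/
theorem tangentVector_change (c' : SuperChart M n m) {p : M} (hc : p ∈ c.dom) (hc' : p ∈ c'.dom)
    (τ : TangentVector M p) (a : Fin n ⊕ Fin m) : τ.toFun c'.dom hc' (c'.coord a)
      = ∑ i, τ.toFun c.dom hc (c.coord i) * M.value (c.jacobian c' i a) p := by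
  rw [τ.eq_sum c hc]
  refine Finset.sum_congr rfl fun i _ => ?_
  rw [← ((c.partialField i).at c hc hc).res_comm c'.dom (c.dom ⊓ c'.dom) inf_le_right ⟨hc, hc'⟩,
    VectorField.at_apply _ c hc hc inf_le_left ⟨hc, hc'⟩]
  rfl

/-- The Hessian of a function is a tensor: evaluated on two tangent vectors, of which the first one
is even, it does not depend on the chart. -/
theorem sum_hessian_change (nab : Connection M) (c' : SuperChart M n m) {p : M} (hc : p ∈ c.dom)
    (hc' : p ∈ c'.dom) (τ σ : TangentVector M p)
    (hτ : ∀ α, τ.toFun c.dom hc (c.coord (.inr α)) = 0) (f : M.O (c.dom ⊓ c'.dom)) :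
    ∑ i, ∑ j, τ.toFun c.dom hc (c.coord i) * σ.toFun c.dom hc (c.coord j)
        * M.value (nab.hessian ((c.partialField i).restrict inf_le_left)
          ((c.partialField j).restrict inf_le_left) f) p
      = ∑ a, ∑ b, τ.toFun c'.dom hc' (c'.coord a) * σ.toFun c'.dom hc' (c'.coord b)
        * M.value (nab.hessian ((c'.partialField a).restrict inf_le_right)
          ((c'.partialField b).restrict inf_le_right) f) p := by
  have hp : p ∈ c.dom ⊓ c'.dom := ⟨hc, hc'⟩
  set H' : Fin n ⊕ Fin m → Fin n ⊕ Fin m → ℝ := fun a b =>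
    M.value (nab.hessian ((c'.partialField a).restrict inf_le_right)
          ((c'.partialField b).restrict inf_le_right) f) p with hH'
  have key : ∀ (i : Fin n) j, M.value (nab.hessian ((c.partialField (.inl i)).restrict
      (inf_le_left : c.dom ⊓ c'.dom ≤ c.dom)) ((c.partialField j).restrict inf_le_left) f) p
      = ∑ b, ∑ a, M.value (c.jacobian c' j b) p * (M.value (c.jacobian c' (.inl i) a) p * H' a b) := by
    intro i j
    rw [c.partialField_eq_sum c' j, nab.hessian_sum_right _ _ _ (c.jacobian_mem c' j)
      ((c.partialField_isHomogeneous (.inl i)).restrict inf_le_left), ← c.valueHom_apply hp hc,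
      map_sum]
    refine Finset.sum_congr rfl fun b _ => ?_
    rw [map_mul, c.partialField_eq_sum c' (.inl i), nab.hessian_sum_left, map_sum, Finset.mul_sum]
    refine Finset.sum_congr rfl fun a _ => ?_
    rw [map_mul, c.valueHom_apply, c.valueHom_apply, c.valueHom_apply]
  have hterm : ∀ i j, τ.toFun c.dom hc (c.coord i) * σ.toFun c.dom hc (c.coord j)
        * M.value (nab.hessian ((c.partialField i).restrict
          (inf_le_left : c.dom ⊓ c'.dom ≤ c.dom)) ((c.partialField j).restrict inf_le_left) f) p
      = ∑ a, ∑ b, (τ.toFun c.dom hc (c.coord i) * M.value (c.jacobian c' i a) p)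
        * (σ.toFun c.dom hc (c.coord j) * M.value (c.jacobian c' j b) p) * H' a b := by
    rintro (i | α) j
    · rw [key, Finset.mul_sum, Finset.sum_comm]
      refine Finset.sum_congr rfl fun b _ => ?_
      rw [Finset.mul_sum]
      exact Finset.sum_congr rfl fun a _ => by ring
    · simp [hτ]
  simp only [hterm, c.tangentVector_change c' hc hc']
  exact sum_mul_sum_mul _ _ _

end SuperChart

/-- The computation behind the formula for `∇/dt` in terms of the Hessian: `w`, `u` are the components
of a field along the curve and of the velocity, `w'` those of the derivative of the field, `pd` and
`pd2` the first and second derivatives of a function. -/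
theorem covDt_sum_identity {ι : Type*} [Fintype ι] (w' w u pd : ι → ℝ) (Γ : ι → ι → ι → ℝ)
    (pd2 : ι → ι → ℝ) :
    ∑ k, (w' k + ∑ i, ∑ j, w j * u i * Γ i j k) * pd k
      = ∑ k, (w' k * pd k + w k * ∑ i, u i * pd2 i k)
        - ∑ i, ∑ j, u i * w j * (pd2 i j - ∑ k, Γ i j k * pd k) := by
  have h1 : ∑ k, w k * ∑ i, u i * pd2 i k = ∑ i, ∑ j, u i * w j * pd2 i j := by
    simp only [Finset.mul_sum]
    rw [Finset.sum_comm]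
    exact Finset.sum_congr rfl fun i _ => Finset.sum_congr rfl fun j _ => by ring
  have h2 : ∑ k, (∑ i, ∑ j, w j * u i * Γ i j k) * pd k
      = ∑ i, ∑ j, u i * w j * ∑ k, Γ i j k * pd k := by
    simp only [Finset.mul_sum, Finset.sum_mul]
    rw [Finset.sum_comm]
    refine Finset.sum_congr rfl fun i _ => ?_
    rw [Finset.sum_comm]
    exact Finset.sum_congr rfl fun j _ => Finset.sum_congr rfl fun k _ => by ring
  simp only [add_mul, mul_sub, Finset.sum_add_distrib, Finset.sum_sub_distrib, h1, h2]
  ring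

namespace SuperCurve
variable {I : Opens ℝ} {M : SuperSpace.{u, v}} {n m : ℕ} (γ : SuperCurve I M)

/-- `X` induces at every parameter value a tangent vector of `M`. -/
def IsField (n m : ℕ) (γ : SuperCurve I M)
    (X : ∀ U : Opens M, M.O U →ₗ[ℝ] superLine.O (preimageOpens γ.base U)) : Prop :=
  ∀ (c : SuperChart M n m) (t : ℝ) (ht : t ∈ I), γ.base ⟨t, ht⟩ ∈ c.dom →
    ∃ w : TangentVector M (γ.base ⟨t, ht⟩), ∀ V (hp : γ.base ⟨t, ht⟩ ∈ V) (f : M.O V),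
      w.toFun V hp f = superLine.reduced (X V f) t

theorem isField_velT : IsField n m γ γ.velT := fun c _ ht hc =>
  ⟨γ.tangentT c ht hc, fun _ hp f => γ.tangentT_apply c ht hc hp f⟩

theorem isField_velXi : IsField n m γ γ.velXi := fun c _ ht hc =>
  ⟨γ.tangentXi c ht hc, fun _ hp f => γ.tangentXi_apply c ht hc hp f⟩

variable {γ} {X : ∀ U : Opens M, M.O U →ₗ[ℝ] superLine.O (preimageOpens γ.base U)}

theorem IsField.eq_sum (hX : IsField n m γ X) (c : SuperChart M n m) {U : Opens M} (hU : U ≤ c.dom)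
    {t : ℝ} (ht : t ∈ preimageOpens γ.base U) (f : M.O U) :
    superLine.reduced (X U f) t = ∑ k, superLine.reduced (X c.dom (c.coord k)) t
      * M.value ((c.partialField k).toFun U hU f) (γ.base ⟨t, preimageOpens_le ht⟩) := by
  have hp := apply_mem_of_mem_preimageOpens ht
  obtain ⟨w, hw⟩ := hX c t (preimageOpens_le ht) (hU hp)
  rw [← hw U hp, w.eq_sum c (hU hp)]
  refine Finset.sum_congr rfl fun k _ => ?_
  rw [hw, VectorField.at_apply _ c (hU hp) (hU hp) hU hp]

/-- The reduced covariant derivative `(∇/dt) X`, applied to `f`, is the derivative of `X f` minus the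
Hessian of `f` on `dγ(∂_t)` and `X`. -/
theorem IsField.sum_covDtCoeff (hX : IsField n m γ X) (c : SuperChart M n m) (nab : Connection M)
    {U : Opens M} (hU : U ≤ c.dom) {t : ℝ} (ht : t ∈ preimageOpens γ.base U) (f : M.O U) :
    ∑ k, superLine.reduced (covDtCoeff nab γ c (X c.dom) k) t
        * M.value ((c.partialField k).toFun U hU f) (γ.base ⟨t, preimageOpens_le ht⟩)
      = deriv (superLine.reduced (X U f)) t
        - ∑ i, ∑ j, superLine.reduced (γ.velT c.dom (c.coord i)) t
          * superLine.reduced (X c.dom (c.coord j)) t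
          * M.value (nab.hessian ((c.partialField i).restrict hU) ((c.partialField j).restrict hU) f)
            (γ.base ⟨t, preimageOpens_le ht⟩) := by
  have hp := apply_mem_of_mem_preimageOpens ht
  have htc : t ∈ preimageOpens γ.base c.dom := preimageOpens_mono γ.base hU ht
  have he : superLine.reduced (X U f) =ᶠ[𝓝 t] fun s => ∑ k,
      superLine.reduced (X c.dom (c.coord k)) s
        * superLine.reduced (γ.pull U ((c.partialField k).toFun U hU f)) s := by
    refine Filter.eventually_of_mem ((preimageOpens γ.base U).isOpen.mem_nhds ht) fun s hs => ?_
    have hps := apply_mem_of_mem_preimageOpens hs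
    rw [hX.eq_sum c hU hs]
    exact Finset.sum_congr rfl fun k _ => by rw [γ.reduced_pull c _ _ hps (hU hps)]
  have hd : deriv (superLine.reduced (X U f)) t = ∑ k,
      (deriv (superLine.reduced (X c.dom (c.coord k))) t
        * M.value ((c.partialField k).toFun U hU f) (γ.base ⟨t, preimageOpens_le ht⟩)
      + superLine.reduced (X c.dom (c.coord k)) t
        * ∑ i, superLine.reduced (γ.velT c.dom (c.coord i)) t
          * M.value ((c.partialField i).toFun U hU ((c.partialField k).toFun U hU f))
            (γ.base ⟨t, preimageOpens_le ht⟩)) := by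
    rw [he.deriv_eq, deriv_fun_sum fun k _ => DifferentiableAt.fun_mul
      (superLine.reduced_differentiableAt _ htc) (superLine.reduced_differentiableAt _ ht)]
    refine Finset.sum_congr rfl fun k _ => ?_
    rw [deriv_fun_mul (superLine.reduced_differentiableAt _ htc)
      (superLine.reduced_differentiableAt _ ht), γ.reduced_pull c _ _ hp (hU hp),
      ← γ.velT_eq_deriv _ ht, (γ.isField_velT (n := n) (m := m)).eq_sum c hU ht]
  rw [hd]
  simp only [γ.reduced_covDtCoeff c nab _ _ htc, Connection.hessian]
  have hv : ∀ a b : M.O U, M.value (a - b) (γ.base ⟨t, preimageOpens_le ht⟩)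
      = M.value a (γ.base ⟨t, preimageOpens_le ht⟩) - M.value b (γ.base ⟨t, preimageOpens_le ht⟩) := by
    intro a b
    simp only [← c.valueHom_apply hp (hU hp), map_sub]
  simp only [hv, c.value_nabla nab hU hp]
  change _ = _ - ∑ i, ∑ j, superLine.reduced (γ.velT c.dom (c.coord i)) t
          * superLine.reduced (X c.dom (c.coord j)) t
          * (M.value ((c.partialField i).toFun U hU ((c.partialField j).toFun U hU f))
            (γ.base ⟨t, preimageOpens_le ht⟩) - _)
  exact covDt_sum_identity _ _ _ _ _ _

/-- Vanishing of the reduced covariant derivative at a parameter value does not depend on the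
chart. -/
theorem IsField.covDtCoeff_eq_zero (hX : IsField n m γ X) (nab : Connection M)
    (c c' : SuperChart M n m) {t : ℝ} (ht : t ∈ preimageOpens γ.base c.dom)
    (ht' : t ∈ preimageOpens γ.base c'.dom)
    (h : ∀ k, superLine.reduced (covDtCoeff nab γ c (X c.dom) k) t = 0) (l : Fin n ⊕ Fin m) :
    superLine.reduced (covDtCoeff nab γ c' (X c'.dom) l) t = 0 := by
  have hc := apply_mem_of_mem_preimageOpens ht
  have hc' := apply_mem_of_mem_preimageOpens ht'
  have hU : t ∈ preimageOpens γ.base (c.dom ⊓ c'.dom) :=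
    mem_preimageOpens (preimageOpens_le ht) ⟨hc, hc'⟩
  let f : M.O (c.dom ⊓ c'.dom) := M.res inf_le_right (c'.coord l)
  have h1 := hX.sum_covDtCoeff c nab inf_le_left hU f
  have h2 := hX.sum_covDtCoeff c' nab inf_le_right hU f
  obtain ⟨w, hw⟩ := hX c t (preimageOpens_le ht) hc
  have h3 := c.sum_hessian_change nab c' hc hc' (γ.tangentT c (preimageOpens_le ht) hc) w
    (fun α => by rw [tangentT_apply]; exact γ.velT_coord_inr c ht α) f
  simp only [tangentT_apply, hw] at h3
  rw [h3, ← h2] at h1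
  simp only [h, zero_mul, Finset.sum_const_zero] at h1
  have h4 : ∀ k, (c'.partialField k).toFun (c.dom ⊓ c'.dom) inf_le_right f
      = if k = l then 1 else 0 := fun k => c'.partialField_coord inf_le_right k l
  have h5 : ∀ k, M.value ((c'.partialField k).toFun (c.dom ⊓ c'.dom) inf_le_right f)
      (γ.base ⟨t, preimageOpens_le hU⟩) = if k = l then 1 else 0 := by
    intro k
    rw [h4, ← c.valueHom_apply (show _ ∈ c.dom ⊓ c'.dom from ⟨hc, hc'⟩) hc]
    split_ifs <;> simp
  simp only [h5, mul_ite, mul_one, mul_zero, Finset.sum_ite_eq', Finset.mem_univ, if_true] at h1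
  exact h1.symm

end SuperCurve

namespace SuperCurve
variable {I I' I'' : Opens ℝ} {M : SuperSpace.{u, v}} {n m : ℕ}

/-! ### Agreement of supercurves at a parameter value -/

/-- By independence of the chart, the vanishing of a reduced covariant derivative can be verified in
one chart for each parameter value. -/
theorem covDt_of_forall_exists {γ : SuperCurve I M}
    {X : ∀ U : Opens M, M.O U →ₗ[ℝ] superLine.O (preimageOpens γ.base U)}
    (hX : IsField n m γ X) (nab : Connection M)
    (h : ∀ t ∈ I, ∃ c : SuperChart M n m, t ∈ preimageOpens γ.base c.dom ∧
      ∀ k, superLine.reduced (covDtCoeff nab γ c (X c.dom) k) t = 0) (c : SuperChart M n m) :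
    ReducedVanishes (covDt nab γ c (X c.dom)) := by
  rw [γ.reducedVanishes_covDt_iff]
  intro t ht k
  obtain ⟨c', ht', h'⟩ := h t (preimageOpens_le ht)
  exact hX.covDtCoeff_eq_zero nab c' c ht' ht h' k

/-- The underlying curves of two supercurves have the same point at `t`. -/
def SamePointAt (γ : SuperCurve I M) (γ' : SuperCurve I' M) (t : ℝ) : Prop :=
  ∃ (h : t ∈ I) (h' : t ∈ I'), γ.base ⟨t, h⟩ = γ'.base ⟨t, h'⟩

theorem SamePointAt.symm {γ : SuperCurve I M} {γ' : SuperCurve I' M} {t : ℝ}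
    (h : SamePointAt γ γ' t) : SamePointAt γ' γ t := by
  obtain ⟨h1, h2, h3⟩ := h
  exact ⟨h2, h1, h3.symm⟩

theorem SamePointAt.trans {γ : SuperCurve I M} {γ' : SuperCurve I' M} {γ'' : SuperCurve I'' M}
    {t : ℝ} (h : SamePointAt γ γ' t) (h' : SamePointAt γ' γ'' t) : SamePointAt γ γ'' t := by
  obtain ⟨h1, h2, h3⟩ := h
  obtain ⟨k1, k2, k3⟩ := h'
  exact ⟨h1, k2, h3.trans k3⟩

/-- Two supercurves agree at `t`: they have the same point and the same odd velocity there. -/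
def SameAt (γ : SuperCurve I M) (γ' : SuperCurve I' M) (t : ℝ) : Prop :=
  ∃ (h : t ∈ I) (h' : t ∈ I'), γ.base ⟨t, h⟩ = γ'.base ⟨t, h'⟩ ∧
    ∀ (W : Opens M) (f : M.O W), γ.base ⟨t, h⟩ ∈ W →
      superLine.reduced (γ.velXi W f) t = superLine.reduced (γ'.velXi W f) t

theorem SameAt.symm {γ : SuperCurve I M} {γ' : SuperCurve I' M} {t : ℝ} (h : SameAt γ γ' t) :
    SameAt γ' γ t := by
  obtain ⟨h1, h2, h3, h4⟩ := h
  exact ⟨h2, h1, h3.symm, fun W f hW => (h4 W f (h3 ▸ hW)).symm⟩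

theorem SameAt.trans {γ : SuperCurve I M} {γ' : SuperCurve I' M} {γ'' : SuperCurve I'' M} {t : ℝ}
    (h : SameAt γ γ' t) (h' : SameAt γ' γ'' t) : SameAt γ γ'' t := by
  obtain ⟨h1, h2, h3, h4⟩ := h
  obtain ⟨k1, k2, k3, k4⟩ := h'
  exact ⟨h1, k2, h3.trans k3, fun W f hW => (h4 W f hW).trans (k4 W f (h3 ▸ hW))⟩

theorem restrict_sameAt (γ : SuperCurve I M) (h : I' ≤ I) {t : ℝ} (ht : t ∈ I') :
    SameAt (SuperMap.restrict γ h) γ t := by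
  refine ⟨ht, h ht, rfl, fun W f hW => ?_⟩
  exact superLine.dxi_res (preimageOpens_restrict γ.base h W) (γ.pull W f)
    (mem_preimageOpens (f := (SuperMap.restrict γ h).base) ht hW)

theorem SameAt.samePointAt {γ : SuperCurve I M} {γ' : SuperCurve I' M} {t : ℝ}
    (h : SameAt γ γ' t) : SamePointAt γ γ' t := by
  obtain ⟨h1, h2, h3, -⟩ := h
  exact ⟨h1, h2, h3⟩

theorem SamePointAt.mem_iff {γ : SuperCurve I M} {γ' : SuperCurve I' M} {t : ℝ}
    (h : SamePointAt γ γ' t) (W : Opens M) :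
    t ∈ preimageOpens γ.base W ↔ t ∈ preimageOpens γ'.base W := by
  obtain ⟨h1, h2, h3⟩ := h
  constructor
  · intro h
    exact mem_preimageOpens h2 (h3 ▸ apply_mem_of_mem_preimageOpens h)
  · intro h
    exact mem_preimageOpens h1 (h3.symm ▸ apply_mem_of_mem_preimageOpens h)

theorem SamePointAt.evenCoord_eq {γ : SuperCurve I M} {γ' : SuperCurve I' M} {t : ℝ}
    (h : SamePointAt γ γ' t) (c : SuperChart M n m) (ht : t ∈ preimageOpens γ.base c.dom)
    (i : Fin n) : γ.evenCoord c i t = γ'.evenCoord c i t := by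
  have ht' := (h.mem_iff _).1 ht
  obtain ⟨_, _, h3⟩ := h
  rw [γ.evenCoord_eq c ht, γ'.evenCoord_eq c ht']
  exact congrArg (fun q => c.x q i) h3

theorem evenCoord_eventuallyEq {γ : SuperCurve I M} {γ' : SuperCurve I' M} {t : ℝ}
    (h : ∀ᶠ s in 𝓝 t, SamePointAt γ γ' s) (c : SuperChart M n m)
    (ht : t ∈ preimageOpens γ.base c.dom) (i : Fin n) :
    γ.evenCoord c i =ᶠ[𝓝 t] γ'.evenCoord c i := by
  filter_upwards [h, (preimageOpens γ.base c.dom).isOpen.mem_nhds ht] with s hs hs'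
  exact hs.evenCoord_eq c hs' i

theorem SameAt.oddCoord_eq {γ : SuperCurve I M} {γ' : SuperCurve I' M} {t : ℝ}
    (h : SameAt γ γ' t) (c : SuperChart M n m) (ht : t ∈ preimageOpens γ.base c.dom) (α : Fin m) :
    γ.oddCoord c α t = γ'.oddCoord c α t := by
  obtain ⟨h1, h2, h3, h4⟩ := h
  exact h4 _ _ (apply_mem_of_mem_preimageOpens ht)

/-- The odd velocity is determined by the functions `h_α`. -/
theorem velXi_eq_sum (γ : SuperCurve I M) (c : SuperChart M n m) {W : Opens M} (f : M.O W) {t : ℝ}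
    (ht : t ∈ I) (hW : γ.base ⟨t, ht⟩ ∈ W) (hc : γ.base ⟨t, ht⟩ ∈ c.dom) :
    superLine.reduced (γ.velXi W f) t = ∑ α, γ.oddCoord c α t
      * M.value ((c.partialField (.inr α)).toFun (W ⊓ c.dom) inf_le_right (M.res inf_le_left f))
        (γ.base ⟨t, ht⟩) := by
  have hU : t ∈ preimageOpens γ.base (W ⊓ c.dom) := mem_preimageOpens ht (mem_inf_of_mem hW hc)
  have h1 : superLine.reduced (γ.velXi (W ⊓ c.dom) (M.res inf_le_left f)) t
      = superLine.reduced (γ.velXi W f) t := by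
    rw [← γ.tangentXi_apply c ht hc (mem_inf_of_mem hW hc), ← γ.tangentXi_apply c ht hc hW,
      TangentVector.res_comm]
  rw [← h1, (γ.isField_velXi (n := n) (m := m)).eq_sum c inf_le_right hU, Fintype.sum_sum_type]
  simp only [γ.velXi_coord_inl c (mem_preimageOpens ht hc), zero_mul, Finset.sum_const_zero,
    zero_add]
  rfl

/-- Agreement at `t` can be checked in one chart. -/
theorem sameAt_of_coord {γ : SuperCurve I M} {γ' : SuperCurve I' M} (c : SuperChart M n m) {t : ℝ}
    (ht : t ∈ I) (ht' : t ∈ I') (hb : γ.base ⟨t, ht⟩ = γ'.base ⟨t, ht'⟩)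
    (hc : γ.base ⟨t, ht⟩ ∈ c.dom) (h : ∀ α, γ.oddCoord c α t = γ'.oddCoord c α t) :
    SameAt γ γ' t := by
  refine ⟨ht, ht', hb, fun W f hW => ?_⟩
  rw [γ.velXi_eq_sum c f ht hW hc, γ'.velXi_eq_sum c f ht' (hb ▸ hW) (hb ▸ hc)]
  simp only [h, hb]

/-- If two supercurves agree at `t`, then all pull-backs of superfunctions agree at `t`. -/
theorem SameAt.pull_eq (hM : IsSupermanifold M n m) {γ : SuperCurve I M} {γ' : SuperCurve I' M}
    {t : ℝ} (h : SameAt γ γ' t) {W : Opens M} (f : M.O W) (ht : t ∈ preimageOpens γ.base W)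
    (ht' : t ∈ preimageOpens γ'.base W) :
    (γ.pull W f).1 ⟨t, ht⟩ = (γ'.pull W f).1 ⟨t, ht'⟩ := by
  obtain ⟨h1, h2, h3, h4⟩ := h
  have hW := apply_mem_of_mem_preimageOpens ht
  have hW' := apply_mem_of_mem_preimageOpens ht'
  obtain ⟨c, hc⟩ := hM.chart_at (γ.base ⟨t, h1⟩)
  have e1 := superLine.eq_reduced_add (γ.pull W f) ht
  have e2 := superLine.eq_reduced_add (γ'.pull W f) ht'
  have e3 := h4 W f hW
  change superLine.reduced (superLine.dxi _ (γ.pull W f)) t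
    = superLine.reduced (superLine.dxi _ (γ'.pull W f)) t at e3
  rw [e1, e2, e3, γ.reduced_pull c f h1 hW hc, γ'.reduced_pull c f h2 hW' (h3 ▸ hc), h3]

theorem ext_of_sameAt (hM : IsSupermanifold M n m) {γ γ' : SuperCurve I M}
    (h : ∀ t ∈ I, SameAt γ γ' t) : γ = γ' := by
  have hb : γ.base = γ'.base := by
    ext ⟨t, ht⟩
    obtain ⟨_, _, h3, -⟩ := h t ht
    exact h3
  have hp : ∀ (W : Opens M) (f : M.O W) t (ht : t ∈ preimageOpens γ.base W)
      (ht' : t ∈ preimageOpens γ'.base W), (γ.pull W f).1 ⟨t, ht⟩ = (γ'.pull W f).1 ⟨t, ht'⟩ :=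
    fun W f t ht ht' => (h t (preimageOpens_le ht)).pull_eq hM f ht ht'
  clear h
  obtain ⟨b, P, _, _⟩ := γ
  obtain ⟨b', P', _, _⟩ := γ'
  obtain rfl : b = b' := hb
  congr
  funext W
  ext f ⟨t, ht⟩
  exact hp W f t ht ht

theorem covDtCoeff_velT_congr {γ : SuperCurve I M} {γ' : SuperCurve I' M} {t : ℝ}
    (h : ∀ᶠ s in 𝓝 t, SamePointAt γ γ' s) (nab : Connection M) (c : SuperChart M n m)
    (ht : t ∈ preimageOpens γ.base c.dom) (ht' : t ∈ preimageOpens γ'.base c.dom)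
    (k : Fin n ⊕ Fin m) : superLine.reduced (covDtCoeff nab γ c (γ.velT c.dom) k) t
      = superLine.reduced (covDtCoeff nab γ' c (γ'.velT c.dom) k) t := by
  have he := evenCoord_eventuallyEq h c ht
  obtain ⟨_, _, hb⟩ := h.self_of_nhds
  rcases k with k | δ
  · rw [γ.reduced_covDtCoeff_velT_inl c nab k ht, γ'.reduced_covDtCoeff_velT_inl c nab k ht',
      (he k).deriv.deriv_eq, hb]
    simp only [fun i => (he i).deriv_eq]
  · rw [γ.reduced_covDtCoeff_velT_inr c nab δ ht, γ'.reduced_covDtCoeff_velT_inr c nab δ ht']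

theorem covDtCoeff_velXi_congr {γ : SuperCurve I M} {γ' : SuperCurve I' M} {t : ℝ}
    (h : ∀ᶠ s in 𝓝 t, SameAt γ γ' s) (nab : Connection M) (c : SuperChart M n m)
    (ht : t ∈ preimageOpens γ.base c.dom) (ht' : t ∈ preimageOpens γ'.base c.dom)
    (k : Fin n ⊕ Fin m) : superLine.reduced (covDtCoeff nab γ c (γ.velXi c.dom) k) t
      = superLine.reduced (covDtCoeff nab γ' c (γ'.velXi c.dom) k) t := by
  have he := evenCoord_eventuallyEq (h.mono fun _ hs => hs.samePointAt) c ht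
  have ho : ∀ i, γ.oddCoord c i =ᶠ[𝓝 t] γ'.oddCoord c i := fun i => by
    filter_upwards [h, (preimageOpens γ.base c.dom).isOpen.mem_nhds ht] with s hs hs'
    exact hs.oddCoord_eq c hs' i
  obtain ⟨_, _, hb, -⟩ := h.self_of_nhds
  rcases k with k | δ
  · rw [γ.reduced_covDtCoeff_velXi_inl c nab k ht, γ'.reduced_covDtCoeff_velXi_inl c nab k ht']
  · rw [γ.reduced_covDtCoeff_velXi_inr c nab δ ht, γ'.reduced_covDtCoeff_velXi_inr c nab δ ht',
      (ho δ).deriv_eq, hb]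
    simp only [fun i => (he i).deriv_eq, fun i => (ho i).eq_of_nhds]

/-- Being a supergeodesic is a local condition. -/
theorem isSupergeodesic_of_locally (hM : IsSupermanifold M n m) {nab : Connection M}
    {γ : SuperCurve I M} (h : ∀ t ∈ I, ∃ (J : Opens ℝ) (γ' : SuperCurve J M),
      γ'.IsSupergeodesic n m nab ∧ ∀ᶠ s in 𝓝 t, SameAt γ γ' s) : γ.IsSupergeodesic n m nab := by
  intro c
  refine ⟨covDt_of_forall_exists γ.isField_velT nab (fun t ht => ?_) c,
    covDt_of_forall_exists γ.isField_velXi nab (fun t ht => ?_) c⟩ <;>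
  · obtain ⟨J, γ', hγ', hs⟩ := h t ht
    obtain ⟨c, hc⟩ := hM.chart_at (γ.base ⟨t, ht⟩)
    have htc : t ∈ preimageOpens γ.base c.dom := mem_preimageOpens ht hc
    have htc' := (hs.self_of_nhds.samePointAt.mem_iff _).1 htc
    refine ⟨c, htc, fun k => ?_⟩
    first
    | rw [covDtCoeff_velT_congr (hs.mono fun _ h => h.samePointAt) nab c htc htc']
      exact (γ'.reducedVanishes_covDt_iff c nab _).1 (hγ' c).1 t htc' k
    | rw [covDtCoeff_velXi_congr hs nab c htc htc']
      exact (γ'.reducedVanishes_covDt_iff c nab _).1 (hγ' c).2 t htc' k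

/-- The initial conditions in a chart. -/
theorem hasInitial_iff (γ : SuperCurve I M) (h0 : (0 : ℝ) ∈ I) {p : M} (τ : TangentVector M p)
    (c : SuperChart M n m) (hc : p ∈ c.dom) : γ.HasInitial h0 τ ↔ γ.base ⟨0, h0⟩ = p ∧
      (∀ i, deriv (γ.evenCoord c i) 0 = τ.toFun c.dom hc (c.coord (.inl i))) ∧
      ∀ α, γ.oddCoord c α 0 = τ.toFun c.dom hc (c.coord (.inr α)) := by
  have hsplit : ∀ (U : Opens M), γ.base ⟨0, h0⟩ ∈ U → ∀ f : M.O U,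
      superLine.reduced ((γ.velT U + γ.velXi U) f) 0
        = superLine.reduced (γ.velT U f) 0 + superLine.reduced (γ.velXi U f) 0 := by
    intro U hU f
    have h0U := mem_preimageOpens h0 hU
    rw [← superLine.redHom_apply h0U, LinearMap.add_apply, map_add, superLine.redHom_apply,
      superLine.redHom_apply]
  rw [HasInitial]
  refine and_congr_right fun hb => ?_
  subst hb
  have h0c : (0 : ℝ) ∈ preimageOpens γ.base c.dom := mem_preimageOpens h0 hc
  have hodd : ∀ α, superLine.reduced (γ.velXi c.dom (c.coord (.inr α))) 0 = γ.oddCoord c α 0 :=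
    fun α => rfl
  constructor
  · intro h
    refine ⟨fun i => ?_, fun α => ?_⟩
    · rw [← h c.dom hc, hsplit c.dom hc, γ.velXi_coord_inl c h0c, γ.velT_coord_inl c h0c, add_zero]
    · rw [← h c.dom hc, hsplit c.dom hc, γ.velT_coord_inr c h0c, hodd, zero_add]
  · rintro ⟨h1, h2⟩ U hU f
    rw [hsplit U hU, τ.eq_sum c hc hU, ← γ.tangentT_apply c h0 hc hU, ← γ.tangentXi_apply c h0 hc hU,
      (γ.tangentT c h0 hc).eq_sum c hc hU, (γ.tangentXi c h0 hc).eq_sum c hc hU,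
      ← Finset.sum_add_distrib]
    refine Finset.sum_congr rfl fun k _ => ?_
    rw [← add_mul, tangentT_apply, tangentXi_apply]
    congr 1
    rcases k with i | α
    · rw [γ.velXi_coord_inl c h0c, γ.velT_coord_inl c h0c, add_zero, h1]
    · rw [γ.velT_coord_inr c h0c, hodd, zero_add, h2]

theorem HasInitial.congr (hM : IsSupermanifold M n m) {γ : SuperCurve I M} {γ' : SuperCurve I' M}
    {h0 : (0 : ℝ) ∈ I} (h0' : (0 : ℝ) ∈ I') {p : M} {τ : TangentVector M p}
    (h : γ.HasInitial h0 τ) (hs : ∀ᶠ s in 𝓝 0, SameAt γ γ' s) : γ'.HasInitial h0' τ := by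
  obtain ⟨c, hc⟩ := hM.chart_at p
  rw [γ.hasInitial_iff h0 τ c hc] at h
  rw [γ'.hasInitial_iff h0' τ c hc]
  obtain ⟨hb, h1, h2⟩ := h
  have h0c : (0 : ℝ) ∈ preimageOpens γ.base c.dom := mem_preimageOpens h0 (by rw [hb]; exact hc)
  obtain ⟨_, _, hb', -⟩ := hs.self_of_nhds
  refine ⟨hb' ▸ hb, fun i => ?_, fun α => ?_⟩
  · rw [← h1]
    exact (evenCoord_eventuallyEq (hs.mono fun _ h => h.samePointAt) c h0c i).deriv_eq.symm
  · rw [← h2]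
    exact (hs.self_of_nhds.oddCoord_eq c h0c α).symm

end SuperCurve

/-! ### Construction of supercurves -/

/-- The homomorphism `Λ[ξ_1, …, ξ_m] → Λ[ξ]` with `ξ_α ↦ v_α ξ`. -/
def grLine {m : ℕ} (v : Fin m → ℝ) : Gr m →ₐ[ℝ] Gr 1 :=
  ExteriorAlgebra.map (LinearMap.pi fun _ => ∑ α, v α • LinearMap.proj α)

theorem grLine_gen {m : ℕ} (v w : Fin m → ℝ) :
    grLine v (ExteriorAlgebra.ι ℝ w) = (∑ α, v α * w α) • superLine.xi := by
  rw [grLine, ExteriorAlgebra.map_apply_ι, superLine.xi, ← map_smul]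
  congr 1
  funext i
  simp [Subsingleton.elim i 0]

theorem superLine.xi_mul (a : Gr 1) : superLine.xi * a = body 1 a • superLine.xi := by
  conv_lhs => rw [gr_one_eq a]
  have : superLine.xi * superLine.xi = 0 := ExteriorAlgebra.ι_sq_zero _
  rw [mul_add, mul_smul_comm, this, smul_zero, add_zero, ← Algebra.commutes, Algebra.smul_def]

/-- The homomorphism `ξ_α ↦ v_α ξ` is affine in `v`, with the derivation `∑ v_α ∂_{ξ_α}` at the body as
its linear part. -/
theorem grLine_eq {m : ℕ} (v : Fin m → ℝ) (a : Gr m) : grLine v a = algebraMap ℝ (Gr 1) (body m a)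
    + (∑ α, v α * body m (CliffordAlgebra.contractLeft (LinearMap.proj α) a)) • superLine.xi := by
  induction a using CliffordAlgebra.left_induction with
  | algebraMap r => simp [CliffordAlgebra.contractLeft_algebraMap]
  | add x y hx hy =>
    rw [map_add, hx, hy]
    simp only [map_add, mul_add, Finset.sum_add_distrib, add_smul]
    abel
  | ι_mul x w hx =>
    have hb : body m (CliffordAlgebra.ι 0 w) = 0 := body_gen w
    have hw : grLine v (CliffordAlgebra.ι 0 w) = (∑ α, v α * w α) • superLine.xi := grLine_gen v w
    have hx' : body 1 (grLine v x) = body m x := by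
      have : body 1 superLine.xi = 0 := body_gen _
      rw [hx]
      simp [this]
    simp only [map_mul, hw, hb, CliffordAlgebra.contractLeft_ι_mul, map_sub, map_smul, zero_mul,
      map_zero, sub_zero, zero_add, smul_mul_assoc, superLine.xi_mul, hx', smul_smul,
      LinearMap.proj_apply, smul_eq_mul, Finset.sum_mul, mul_assoc]

theorem contract_grLine {m : ℕ} (v : Fin m → ℝ) (a : Gr m) :
    body 1 (CliffordAlgebra.contractLeft (LinearMap.proj (0 : Fin 1)) (grLine v a))
      = ∑ α, v α * body m (CliffordAlgebra.contractLeft (LinearMap.proj α) a) := by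
  have h : CliffordAlgebra.contractLeft (LinearMap.proj (0 : Fin 1)) superLine.xi = 1 := by
    rw [superLine.xi]
    erw [CliffordAlgebra.contractLeft_ι]
    simp
  rw [grLine_eq, map_add, map_smul, h]
  erw [CliffordAlgebra.contractLeft_algebraMap]
  simp

theorem grLine_mem {m : ℕ} (v : Fin m → ℝ) {i : ZMod 2} {a : Gr m} (ha : a ∈ grParity m i) :
    grLine v a ∈ grParity 1 i := by
  rw [grLine_eq]
  rcases gr_parity_cases i with rfl | rfl
  · have h : ∀ α : Fin m, body m (CliffordAlgebra.contractLeft (LinearMap.proj α) a) = 0 :=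
      fun α => body_odd (by have := gr_contract_mem (LinearMap.proj α) 0 a ha; rwa [add_zero] at this)
    simp only [h, mul_zero, Finset.sum_const_zero, zero_smul, add_zero]
    exact SetLike.algebraMap_mem_graded (grParity 1) _
  · rw [body_odd ha, map_zero, zero_add]
    exact Submodule.smul_mem _ _ (CliffordAlgebra.ι_mem_evenOdd_one _ _)

namespace SuperCurve
variable {I : Opens ℝ} {M : SuperSpace.{u, v}} {n m : ℕ}

/-- The supercurve with underlying curve `σ` given by homomorphisms `P` from functions near `σ(t)` to
`Λ[ξ]`, depending smoothly on `t`. -/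
def ofFamily (σ : C(I, M))
    (P : ∀ (W : Opens M) (t : ℝ), t ∈ preimageOpens σ W → M.O W →ₐ[ℝ] Gr 1)
    (hmem : ∀ W t ht i, ∀ f ∈ M.parity W i, P W t ht f ∈ grParity 1 i)
    (hres : ∀ (W W' : Opens M) (h : W' ≤ W) t ht ht' (f : M.O W),
      P W' t ht' (M.res h f) = P W t ht f)
    (hsm : ∀ W t, t ∈ preimageOpens σ W → ∀ f : M.O W, ∃ φ : ℝ → Gr 1, ContDiffAt ℝ ∞ φ t ∧
      ∀ᶠ s in 𝓝 t, ∀ hs, P W s hs f = φ s) : SuperCurve I M where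
  base := σ
  pull W := (AlgHom.pi (A := fun _ : preimageOpens σ W => Gr 1) fun t => P W t.1 t.2).codRestrict
    (grSections (OpenPartialHomeomorph.refl ℝ) 1 (preimageOpens σ W)) fun f =>
      mem_grSections_of_eventuallyEq fun t ht _ => hsm W t ht f
  pull_mem W i f hf t := hmem W t.1 t.2 i f hf
  pull_res W W' h f := by
    ext t
    exact hres W W' h t.1 _ t.2 f

theorem velXi_ofFamily (σ : C(I, M))
    (P : ∀ (W : Opens M) (t : ℝ), t ∈ preimageOpens σ W → M.O W →ₐ[ℝ] Gr 1)
    (hmem : ∀ W t ht i, ∀ f ∈ M.parity W i, P W t ht f ∈ grParity 1 i)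
    (hres : ∀ (W W' : Opens M) (h : W' ≤ W) t ht ht' (f : M.O W),
      P W' t ht' (M.res h f) = P W t ht f)
    (hsm : ∀ W t, t ∈ preimageOpens σ W → ∀ f : M.O W, ∃ φ : ℝ → Gr 1, ContDiffAt ℝ ∞ φ t ∧
      ∀ᶠ s in 𝓝 t, ∀ hs, P W s hs f = φ s) {W : Opens M} (f : M.O W) {t : ℝ}
    (ht : t ∈ preimageOpens σ W) :
    superLine.reduced ((ofFamily σ P hmem hres hsm).velXi W f) t
      = body 1 (CliffordAlgebra.contractLeft (LinearMap.proj (0 : Fin 1)) (P W t ht f)) :=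
  superLine.reduced_dxi _ ht

theorem curveCoord_apply (c : SuperChart M n m) (σ : C(I, M)) {t : ℝ} (ht : t ∈ I) :
    GradedMetric.curveCoord c σ t = c.x (σ ⟨t, ht⟩) := by
  rw [GradedMetric.curveCoord, dif_pos ht]

/-- A superfunction is smooth along a smooth curve. -/
theorem contDiffAt_rep_curveCoord (c : SuperChart M n m) (σ : C(I, M)) {W : Opens M} (f : M.O W)
    {t : ℝ} (ht : t ∈ I) (hW : σ ⟨t, ht⟩ ∈ W) (hc : σ ⟨t, ht⟩ ∈ c.dom)
    (hσ : ContDiffAt ℝ ∞ (GradedMetric.curveCoord c σ) t) :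
    ContDiffAt ℝ ∞ (fun s => c.rep f (GradedMetric.curveCoord c σ s)) t := by
  have h := c.rep_contDiffAt hW hc f
  rw [← curveCoord_apply c σ ht] at h
  exact h.comp t hσ

/-- A smooth curve in the domain of a chart and functions `h_α` define a supercurve with
`γ^* ξ_α = h_α ξ`. -/
theorem exists_oddCoord_eq (c : SuperChart M n m) (σ : C(I, M)) (hc : ∀ t, σ t ∈ c.dom)
    (hσ : ∀ t ∈ I, ContDiffAt ℝ ∞ (GradedMetric.curveCoord c σ) t) (h : Fin m → ℝ → ℝ)
    (hh : ∀ α, ∀ t ∈ I, ContDiffAt ℝ ∞ (h α) t) :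
    ∃ γ : SuperCurve I M, γ.base = σ ∧ ∀ t ∈ I, ∀ α, γ.oddCoord c α t = h α t := by
  obtain ⟨P, hP⟩ : ∃ P : ∀ (W : Opens M) (t : ℝ), t ∈ preimageOpens σ W → M.O W →ₐ[ℝ] Gr 1,
      ∀ W t ht f, P W t ht f = grLine (fun α => h α t)
        (c.ev (apply_mem_of_mem_preimageOpens ht) (hc ⟨t, preimageOpens_le ht⟩) f) :=
    ⟨fun W t ht => (grLine fun α => h α t).comp
      (c.ev (apply_mem_of_mem_preimageOpens ht) (hc _)), fun _ _ _ _ => rfl⟩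
  refine ⟨ofFamily σ P ?_ ?_ ?_, rfl, ?_⟩
  · intro W t ht i f hf
    rw [hP W t ht]
    exact grLine_mem _ (c.ev_mem (apply_mem_of_mem_preimageOpens ht) (hc _) hf)
  · intro W W' hW t ht ht' f
    rw [hP W t ht, hP W' t ht', c.ev_res hW (apply_mem_of_mem_preimageOpens ht') (hc _)]
  · intro W t ht f
    have htI := preimageOpens_le ht
    have hr := contDiffAt_rep_curveCoord c σ f htI (apply_mem_of_mem_preimageOpens ht) (hc _)
      (hσ t htI)
    refine ⟨fun s => algebraMap ℝ (Gr 1) (body m (c.rep f (GradedMetric.curveCoord c σ s)))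
      + (∑ α, h α s * body m (CliffordAlgebra.contractLeft (LinearMap.proj α)
        (c.rep f (GradedMetric.curveCoord c σ s)))) • superLine.xi, ?_, ?_⟩
    · refine ContDiffAt.add ?_ (ContDiffAt.fun_smul (ContDiffAt.sum fun α _ =>
        (hh α t htI).mul ?_) contDiffAt_const)
      · exact (scalarCLM 1).contDiff.contDiffAt.comp t
          ((grCLM (body m).toLinearMap).contDiff.contDiffAt.comp t hr)
      · exact (grCLM ((body m).toLinearMap ∘ₗ
          CliffordAlgebra.contractLeft (LinearMap.proj α))).contDiff.contDiffAt.comp t hr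
    · refine Filter.Eventually.of_forall fun s hs => ?_
      rw [hP W s hs, grLine_eq]
      beta_reduce
      rw [curveCoord_apply c σ (preimageOpens_le hs),
        c.rep_apply (apply_mem_of_mem_preimageOpens hs) (hc _)]
  · intro t ht α
    have htc : t ∈ preimageOpens σ c.dom := mem_preimageOpens ht (hc _)
    refine (velXi_ofFamily σ P _ _ _ (c.coord (.inr α)) htc).trans ?_
    rw [hP c.dom t htc, contract_grLine, c.ev_coord_inr]
    have h1 : ∀ β, body m (CliffordAlgebra.contractLeft (LinearMap.proj β)
        (ExteriorAlgebra.ι ℝ (Pi.single α (1 : ℝ)))) = if β = α then 1 else 0 := by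
      intro β
      erw [CliffordAlgebra.contractLeft_ι]
      rw [body_algebraMap, LinearMap.proj_apply, Pi.single_apply]
    simp only [h1, mul_ite, mul_one, mul_zero, Finset.sum_ite_eq', Finset.mem_univ, if_true]

/-- A smooth curve in `M_red`, regarded as a supercurve with vanishing odd velocity. -/
theorem exists_lift (hM : IsSupermanifold M n m) (σ : C(I, M))
    (hσ : ∀ t (ht : t ∈ I), ∃ c : SuperChart M n m, σ ⟨t, ht⟩ ∈ c.dom ∧
      ContDiffAt ℝ ∞ (GradedMetric.curveCoord c σ) t) :
    ∃ γ : SuperCurve I M, γ.base = σ ∧ ∀ (c : SuperChart M n m) α t,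
      t ∈ preimageOpens γ.base c.dom → γ.oddCoord c α t = 0 := by
  obtain ⟨ch, hch⟩ : ∃ ch : M → SuperChart M n m, ∀ p, p ∈ (ch p).dom := by
    choose ch hch using hM.chart_at
    exact ⟨ch, hch⟩
  obtain ⟨P, hP⟩ : ∃ P : ∀ (W : Opens M) (t : ℝ), t ∈ preimageOpens σ W → M.O W →ₐ[ℝ] Gr 1,
      ∀ W t ht f, P W t ht f = algebraMap ℝ (Gr 1) (M.value f (σ ⟨t, preimageOpens_le ht⟩)) :=
    ⟨fun W t ht => (Algebra.ofId ℝ (Gr 1)).comp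
      ((ch (σ ⟨t, preimageOpens_le ht⟩)).valueHom (apply_mem_of_mem_preimageOpens ht) (hch _)),
      fun W t ht f => congrArg (algebraMap ℝ (Gr 1)) (SuperChart.valueHom_apply _ _ _ f)⟩
  refine ⟨ofFamily σ P ?_ ?_ ?_, rfl, ?_⟩
  · intro W t ht i f hf
    rw [hP W t ht]
    rcases gr_parity_cases i with rfl | rfl
    · exact SetLike.algebraMap_mem_graded (grParity 1) _
    · rw [value_odd (ch _) (apply_mem_of_mem_preimageOpens ht) (hch _) hf, map_zero]
      exact Submodule.zero_mem _
  · intro W W' hW t ht ht' f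
    rw [hP W' t ht', hP W t ht, value_res (ch _) hW (apply_mem_of_mem_preimageOpens ht') (hch _)]
  · intro W t ht f
    have htI := preimageOpens_le ht
    obtain ⟨c, hc, hs⟩ := hσ t htI
    have hr := contDiffAt_rep_curveCoord c σ f htI (apply_mem_of_mem_preimageOpens ht) hc hs
    refine ⟨fun s => algebraMap ℝ (Gr 1) (body m (c.rep f (GradedMetric.curveCoord c σ s))),
      (scalarCLM 1).contDiff.contDiffAt.comp t
        ((grCLM (body m).toLinearMap).contDiff.contDiffAt.comp t hr), ?_⟩
    filter_upwards [(preimageOpens σ c.dom).isOpen.mem_nhds (mem_preimageOpens htI hc)]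
      with s hsc hs
    have hsc' := apply_mem_of_mem_preimageOpens hsc
    rw [hP W s hs, curveCoord_apply c σ (preimageOpens_le hs),
      c.rep_apply (apply_mem_of_mem_preimageOpens hs) hsc', c.value_eq _ hsc']
  · intro c α t ht
    refine (velXi_ofFamily σ P _ _ _ (c.coord (.inr α)) ht).trans ?_
    rw [hP c.dom t ht]
    erw [CliffordAlgebra.contractLeft_algebraMap]
    rw [map_zero]

/-- Supercurves that agree on overlaps glue. -/
theorem exists_glue (hM : IsSupermanifold M n m) {ι : Type*} {J : ι → Opens ℝ}
    (γ : ∀ i, SuperCurve (J i) M) (hγ : ∀ i j t, t ∈ J i → t ∈ J j → SameAt (γ i) (γ j) t)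
    (hI : ∀ t, t ∈ I ↔ ∃ i, t ∈ J i) :
    ∃ Γ : SuperCurve I M, ∀ i, ∀ t ∈ J i, SameAt Γ (γ i) t := by
  choose k hk using fun t : I => (hI t.1).1 t.2
  have hb : ∀ i t (ht : t ∈ J i) (ht' : t ∈ I),
      (γ (k ⟨t, ht'⟩)).base ⟨t, hk ⟨t, ht'⟩⟩ = (γ i).base ⟨t, ht⟩ := by
    intro i t ht ht'
    obtain ⟨_, _, h, -⟩ := hγ (k ⟨t, ht'⟩) i t (hk ⟨t, ht'⟩) ht
    exact h
  have hcont : Continuous fun t : I => (γ (k t)).base ⟨t.1, hk t⟩ := by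
    rw [continuous_iff_continuousAt]
    rintro ⟨t, ht⟩
    obtain ⟨i, hi⟩ := (hI t).1 ht
    -- on the open set `J i ∩ I` the function is the restriction of the underlying curve of `γ i`
    have hop : IsOpen {s : I | s.1 ∈ J i} := (J i).isOpen.preimage continuous_subtype_val
    have h1 : ContinuousOn (fun s : I => (γ (k s)).base ⟨s.1, hk s⟩) {s : I | s.1 ∈ J i} := by
      rw [continuousOn_iff_continuous_domRestrict]
      have : Continuous fun s : {s : I | s.1 ∈ J i} => (γ i).base ⟨s.1.1, s.2⟩ := by fun_prop
      exact this.congr fun s => (hb i s.1.1 s.2 s.1.2).symm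
    exact h1.continuousAt (hop.mem_nhds hi)
  let σ : C(I, M) := ⟨fun t : I => (γ (k t)).base ⟨t.1, hk t⟩, hcont⟩
  have hpre : ∀ W t (ht : t ∈ preimageOpens σ W),
      t ∈ preimageOpens (γ (k ⟨t, preimageOpens_le ht⟩)).base W := fun W t ht =>
    mem_preimageOpens (hk ⟨t, preimageOpens_le ht⟩) (apply_mem_of_mem_preimageOpens ht)
  have hbk : ∀ i t (ht : t ∈ J i) (ht' : t ∈ I), σ ⟨t, ht'⟩ = (γ i).base ⟨t, ht⟩ := hb
  obtain ⟨P, hP'⟩ : ∃ P : ∀ (W : Opens M) (t : ℝ), t ∈ preimageOpens σ W → M.O W →ₐ[ℝ] Gr 1,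
      ∀ W t ht f, P W t ht f
        = ((γ (k ⟨t, preimageOpens_le ht⟩)).pull W f).1 ⟨t, hpre W t ht⟩ :=
    ⟨fun W t ht => ((Pi.evalAlgHom ℝ (fun _ : (preimageOpens (γ (k ⟨t, _⟩)).base W) => Gr 1)
      ⟨t, hpre W t ht⟩).comp (grSections (OpenPartialHomeomorph.refl ℝ) 1 _).val).comp
      ((γ (k ⟨t, preimageOpens_le ht⟩)).pull W), fun _ _ _ _ => rfl⟩
  have hP : ∀ i W t (ht : t ∈ preimageOpens σ W) (ht' : t ∈ preimageOpens (γ i).base W) (f : M.O W),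
      P W t ht f = ((γ i).pull W f).1 ⟨t, ht'⟩ := fun i W t ht ht' f =>
    (hP' W t ht f).trans ((hγ _ i t (hk ⟨t, preimageOpens_le ht⟩)
      (preimageOpens_le ht')).pull_eq hM f (hpre W t ht) ht')
  clear_value σ
  refine ⟨ofFamily σ P ?_ ?_ ?_, ?_⟩
  · intro W t ht i f hf
    have : ∀ p, _ ∈ grParity 1 i := (γ (k ⟨t, preimageOpens_le ht⟩)).pull_mem W i f hf
    rw [hP' W t ht]
    exact this ⟨t, hpre W t ht⟩
  · intro W W' h t ht ht' f
    have := congrArg (fun F => F.1 ⟨t, hpre W' t ht'⟩)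
      ((γ (k ⟨t, preimageOpens_le ht'⟩)).pull_res W W' h f)
    rw [hP' W' t ht', this]
    exact (hP _ W t ht _ f).symm
  · intro W t ht f
    have h1 := (γ _).pull W f |>.2 t (hpre W t ht) trivial
    refine ⟨_, h1, ?_⟩
    filter_upwards [(preimageOpens (γ (k ⟨t, preimageOpens_le ht⟩)).base W).isOpen.mem_nhds
      (hpre W t ht)] with s hs hs'
    rw [hP _ W s hs' hs f]
    exact (coordRep_apply (x := OpenPartialHomeomorph.refl ℝ) _ hs trivial).symm
  · intro i t ht
    have htI : t ∈ I := (hI t).2 ⟨i, ht⟩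
    refine ⟨htI, ht, hbk i t ht htI, fun W f hW => ?_⟩
    have h1 : t ∈ preimageOpens σ W := mem_preimageOpens htI hW
    have h2 : t ∈ preimageOpens (γ i).base W :=
      mem_preimageOpens ht (by rw [← hbk i t ht htI]; exact hW)
    refine (velXi_ofFamily σ P _ _ _ f h1).trans (Eq.trans ?_ (superLine.reduced_dxi _ h2).symm)
    rw [hP i W t h1 h2]
    rfl

end SuperCurve

/-! ### Uniqueness of supergeodesics -/

/-- A property that propagates from a set accumulating at `t` to a neighbourhood of `t`, for each `t`
in a connected set, holds on the whole set if it holds at one of its points. -/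
theorem forall_of_frequently_imp_eventually {X : Type*} [TopologicalSpace X] {K : Set X}
    (hK : IsPreconnected K) {Q : X → Prop}
    (h : ∀ t ∈ K, (∃ᶠ s in 𝓝 t, Q s) → ∀ᶠ s in 𝓝 t, Q s) {t₀ : X} (ht₀ : t₀ ∈ K) (h₀ : Q t₀) :
    ∀ t ∈ K, Q t := by
  by_contra! hne
  obtain ⟨t, ht, hQ⟩ := hne
  obtain ⟨s, -, hs1, hs2⟩ := hK {s | ∀ᶠ r in 𝓝 s, Q r} {s | ∀ᶠ r in 𝓝 s, ¬ Q r}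
    isOpen_setOfPred_eventually_nhds isOpen_setOfPred_eventually_nhds
    (fun s hs => by
      by_cases hf : ∃ᶠ r in 𝓝 s, Q r
      · exact Or.inl (h s hs hf)
      · exact Or.inr (Filter.not_frequently.1 hf))
    ⟨t₀, ht₀, h t₀ ht₀ (Filter.frequently_iff.2 fun hU => ⟨t₀, mem_of_mem_nhds hU, h₀⟩)⟩
    ⟨t, ht, by
      by_contra hf
      exact hQ (h t ht (Filter.not_eventually.1 hf |>.mono fun _ => not_not.1)).self_of_nhds⟩
  exact (hs1.and hs2).exists.elim fun _ hr => hr.2 hr.1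

theorem contDiffAt_deriv {f : ℝ → ℝ} {t : ℝ} (hf : ContDiffAt ℝ ∞ f t) :
    ContDiffAt ℝ ∞ (deriv f) t :=
  (hf.fderiv_right (m := ∞) (by simp)).clm_apply contDiffAt_const

/-- The bodies of the Christoffel symbols as functions of the coordinates. -/
def SuperChart.christoffelRep {M : SuperSpace.{u, v}} {n m : ℕ} (c : SuperChart M n m)
    (nab : Connection M) (i j k : Fin n ⊕ Fin m) (y : Fin n → ℝ) : ℝ :=
  body m (c.rep (c.christoffel nab i j k) y)

theorem SuperChart.christoffelRep_apply {M : SuperSpace.{u, v}} {n m : ℕ} (c : SuperChart M n m)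
    (nab : Connection M) (i j k : Fin n ⊕ Fin m) {p : M} (hp : p ∈ c.dom) :
    c.christoffelRep nab i j k (c.x p) = M.value (c.christoffel nab i j k) p := by
  rw [christoffelRep, c.rep_apply hp hp, c.value_eq hp hp]

theorem SuperChart.christoffelRep_contDiffAt {M : SuperSpace.{u, v}} {n m : ℕ}
    (c : SuperChart M n m) (nab : Connection M) (i j k : Fin n ⊕ Fin m) {y : Fin n → ℝ}
    (hy : y ∈ c.x.target) : ContDiffAt ℝ ∞ (c.christoffelRep nab i j k) y := by
  have hp : c.x.symm y ∈ c.dom := c.x.map_target hy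
  have h := c.rep_contDiffAt hp hp (c.christoffel nab i j k)
  rw [c.x.right_inv hy] at h
  exact (grCLM (body m).toLinearMap).contDiff.contDiffAt.comp y h

/-- The geodesic equation as a first-order system for position and velocity. -/
def SuperChart.geodesicField {M : SuperSpace.{u, v}} {n m : ℕ} (c : SuperChart M n m)
    (nab : Connection M) (u : (Fin n → ℝ) × (Fin n → ℝ)) : (Fin n → ℝ) × (Fin n → ℝ) :=
  (u.2, fun k => -∑ i, ∑ j, u.2 j * u.2 i * c.christoffelRep nab (.inl i) (.inl j) (.inl k) u.1)

theorem SuperChart.geodesicField_contDiffAt {M : SuperSpace.{u, v}} {n m : ℕ}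
    (c : SuperChart M n m) (nab : Connection M) {u : (Fin n → ℝ) × (Fin n → ℝ)}
    (hu : u.1 ∈ c.x.target) : ContDiffAt ℝ ∞ (c.geodesicField nab) u := by
  refine contDiffAt_snd.prodMk (contDiffAt_pi.2 fun k => ContDiffAt.neg
    (ContDiffAt.sum fun i _ => ContDiffAt.sum fun j _ => ContDiffAt.mul (ContDiffAt.mul ?_ ?_) ?_))
  · exact contDiffAt_pi.1 contDiffAt_snd j
  · exact contDiffAt_pi.1 contDiffAt_snd i
  · exact (c.christoffelRep_contDiffAt nab _ _ _ hu).comp u contDiffAt_fst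

namespace SuperCurve
variable {I I' : Opens ℝ} {M : SuperSpace.{u, v}} {n m : ℕ}

/-- The reduction of `(∇/dt) dγ(∂_t)` vanishes. -/
def EvenCondition (n m : ℕ) (nab : Connection M) (γ : SuperCurve I M) : Prop :=
  ∀ c : SuperChart M n m, ReducedVanishes (covDt nab γ c (γ.velT c.dom))

theorem apply_mem_target (γ : SuperCurve I M) (c : SuperChart M n m) {t : ℝ}
    (ht : t ∈ preimageOpens γ.base c.dom) : (fun i => γ.evenCoord c i t) ∈ c.x.target := by
  simp only [γ.evenCoord_eq c ht]
  exact c.x.map_source (apply_mem_of_mem_preimageOpens ht)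

theorem christoffelRep_evenCoord (γ : SuperCurve I M) (c : SuperChart M n m) (nab : Connection M)
    (i j k : Fin n ⊕ Fin m) {t : ℝ} (ht : t ∈ preimageOpens γ.base c.dom) :
    c.christoffelRep nab i j k (fun i => γ.evenCoord c i t)
      = M.value (c.christoffel nab i j k) (γ.base ⟨t, preimageOpens_le ht⟩) := by
  simp only [γ.evenCoord_eq c ht]
  exact c.christoffelRep_apply nab i j k (apply_mem_of_mem_preimageOpens ht)

theorem EvenCondition.hasDerivAt {nab : Connection M} {γ : SuperCurve I M}
    (hγ : γ.EvenCondition n m nab) (c : SuperChart M n m) {t : ℝ}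
    (ht : t ∈ preimageOpens γ.base c.dom) :
    HasDerivAt (fun s => ((fun i => γ.evenCoord c i s), fun i => deriv (γ.evenCoord c i) s))
      (c.geodesicField nab ((fun i => γ.evenCoord c i t), fun i => deriv (γ.evenCoord c i) t)) t := by
  refine HasDerivAt.prodMk (hasDerivAt_pi.2 fun i => ?_) (hasDerivAt_pi.2 fun k => ?_)
  · exact ((γ.evenCoord_contDiffAt c ht i).differentiableAt (by simp)).hasDerivAt
  · have h := (γ.reducedVanishes_covDt_iff c nab _).1 (hγ c) t ht (.inl k)
    rw [γ.reduced_covDtCoeff_velT_inl c nab k ht] at h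
    simp only [christoffelRep_evenCoord γ c nab _ _ _ ht]
    rw [← eq_neg_of_add_eq_zero_left h]
    exact ((contDiffAt_deriv (γ.evenCoord_contDiffAt c ht k)).differentiableAt (by simp)).hasDerivAt

theorem eventually_subtype {K : Opens ℝ} {t : ℝ} (ht : t ∈ K) {P : K → Prop}
    (h : ∀ᶠ s in 𝓝 (⟨t, ht⟩ : K), P s) : ∀ᶠ s in 𝓝 t, ∀ hs, P ⟨s, hs⟩ := by
  rw [← K.isOpen.isOpenEmbedding_subtypeVal.map_nhds_eq ⟨t, ht⟩, Filter.eventually_map]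
  filter_upwards [h] with s hs _
  exact hs

/-- As `M` is Hausdorff, underlying curves that agree at parameters accumulating at `t` agree at `t`. -/
theorem samePointAt_of_frequently (hM : IsSupermanifold M n m) {γ : SuperCurve I M}
    {γ' : SuperCurve I' M} {t : ℝ} (ht : t ∈ I) (ht' : t ∈ I')
    (h : ∃ᶠ s in 𝓝 t, SamePointAt γ γ' s) : SamePointAt γ γ' t := by
  have := hM.t2
  refine ⟨ht, ht', ?_⟩
  by_contra hne
  have hop : IsOpen {s : (I ⊓ I' : Opens ℝ) | γ.base ⟨s.1, s.2.1⟩ ≠ γ'.base ⟨s.1, s.2.2⟩} :=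
    isOpen_ne_fun (by fun_prop) (by fun_prop)
  have := eventually_subtype (K := I ⊓ I') ⟨ht, ht'⟩ (hop.mem_nhds hne)
  refine h (this.mono ?_)
  rintro s hs ⟨h1, h2, h3⟩
  exact hs ⟨h1, h2⟩ h3

/-- Local uniqueness of geodesics. -/
theorem eventually_samePointAt {nab : Connection M} {γ : SuperCurve I M} {γ' : SuperCurve I' M}
    (hγ : γ.EvenCondition n m nab) (hγ' : γ'.EvenCondition n m nab) {t : ℝ}
    (hs : SamePointAt γ γ' t) (c : SuperChart M n m) (ht : t ∈ preimageOpens γ.base c.dom)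
    (hd : ∀ i, deriv (γ.evenCoord c i) t = deriv (γ'.evenCoord c i) t) :
    ∀ᶠ s in 𝓝 t, SamePointAt γ γ' s := by
  have ht' := (hs.mem_iff _).1 ht
  have h1 := (preimageOpens γ.base c.dom).isOpen.mem_nhds ht
  have h2 := (preimageOpens γ'.base c.dom).isOpen.mem_nhds ht'
  have hu := ode_unique
    ((c.geodesicField_contDiffAt nab (u := ((fun i => γ.evenCoord c i t),
      fun i => deriv (γ.evenCoord c i) t)) (γ.apply_mem_target c ht)).of_le (by simp))
    (Filter.eventually_of_mem h1 fun s hs => hγ.hasDerivAt c hs)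
    (Filter.eventually_of_mem h2 fun s hs => hγ'.hasDerivAt c hs)
    (by simp only [hd, fun i => hs.evenCoord_eq c ht i])
  filter_upwards [hu, h1, h2] with s hs h1 h2
  refine ⟨preimageOpens_le h1, preimageOpens_le h2, ?_⟩
  refine c.x.injOn (apply_mem_of_mem_preimageOpens h1) (apply_mem_of_mem_preimageOpens h2) ?_
  funext i
  rw [← γ.evenCoord_eq c h1, ← γ'.evenCoord_eq c h2]
  exact congrFun (congrArg Prod.fst hs) i

/-- Uniqueness of geodesics: the underlying curves of two supercurves with vanishing reduced covariant
acceleration agree on a connected set of parameters if they agree to first order at one of them. -/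
theorem forall_samePointAt (hM : IsSupermanifold M n m) {nab : Connection M} {γ : SuperCurve I M}
    {γ' : SuperCurve I' M} (hγ : γ.EvenCondition n m nab) (hγ' : γ'.EvenCondition n m nab)
    {K : Set ℝ} (hK : IsPreconnected K) (hI : ∀ t ∈ K, t ∈ I) (hI' : ∀ t ∈ K, t ∈ I') {t₀ : ℝ}
    (ht₀ : t₀ ∈ K) (hs : SamePointAt γ γ' t₀) (c : SuperChart M n m)
    (hc : t₀ ∈ preimageOpens γ.base c.dom)
    (hd : ∀ i, deriv (γ.evenCoord c i) t₀ = deriv (γ'.evenCoord c i) t₀) :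
    ∀ t ∈ K, SamePointAt γ γ' t := by
  have key : ∀ t ∈ K, ∀ᶠ s in 𝓝 t, SamePointAt γ γ' s := by
    refine forall_of_frequently_imp_eventually hK (fun t ht hf => ?_) ht₀
      (eventually_samePointAt hγ hγ' hs c hc hd)
    rw [eventually_eventually_nhds]
    have hst := samePointAt_of_frequently hM (hI t ht) (hI' t ht)
      (hf.mono fun _ h => h.self_of_nhds)
    obtain ⟨c, hc⟩ := hM.chart_at (γ.base ⟨t, hI t ht⟩)
    have htc : t ∈ preimageOpens γ.base c.dom := mem_preimageOpens (hI t ht) hc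
    refine eventually_samePointAt hγ hγ' hst c htc fun i => ?_
    refine tendsto_nhds_unique_of_frequently_eq
      (contDiffAt_deriv (γ.evenCoord_contDiffAt c htc i)).continuousAt
      (contDiffAt_deriv (γ'.evenCoord_contDiffAt c ((hst.mem_iff _).1 htc) i)).continuousAt ?_
    refine (hf.and_eventually ((preimageOpens γ.base c.dom).isOpen.mem_nhds htc)).mono ?_
    rintro s ⟨hs, hsc⟩
    exact (evenCoord_eventuallyEq hs c hsc i).deriv_eq
  exact fun t ht => (key t ht).self_of_nhds

/-- The coefficients of the odd geodesic equations along `γ`. -/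
def oddCoeff (γ : SuperCurve I M) (nab : Connection M) (c : SuperChart M n m) (δ β : Fin m) (t : ℝ) :
    ℝ :=
  ∑ i, deriv (γ.evenCoord c i) t
    * c.christoffelRep nab (.inl i) (.inr β) (.inr δ) (fun i => γ.evenCoord c i t)

theorem oddCoeff_contDiffAt (γ : SuperCurve I M) (nab : Connection M) (c : SuperChart M n m)
    (δ β : Fin m) {t : ℝ} (ht : t ∈ preimageOpens γ.base c.dom) :
    ContDiffAt ℝ ∞ (γ.oddCoeff nab c δ β) t := by
  refine ContDiffAt.sum fun i _ =>
    (contDiffAt_deriv (γ.evenCoord_contDiffAt c ht i)).mul ?_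
  exact ContDiffAt.comp (f := fun s i => γ.evenCoord c i s) t
    (c.christoffelRep_contDiffAt nab _ _ _ (γ.apply_mem_target c ht))
    (contDiffAt_pi.2 fun i => γ.evenCoord_contDiffAt c ht i)

theorem oddCoeff_congr {γ : SuperCurve I M} {γ' : SuperCurve I' M} {t : ℝ}
    (h : ∀ᶠ s in 𝓝 t, SamePointAt γ γ' s) (nab : Connection M) (c : SuperChart M n m)
    (ht : t ∈ preimageOpens γ.base c.dom) (δ β : Fin m) :
    γ.oddCoeff nab c δ β t = γ'.oddCoeff nab c δ β t := by
  have he := evenCoord_eventuallyEq h c ht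
  simp only [oddCoeff, fun i => (he i).deriv_eq, fun i => (he i).eq_of_nhds]

theorem reduced_covDtCoeff_velXi_inr_eq_oddCoeff (γ : SuperCurve I M) (nab : Connection M)
    (c : SuperChart M n m) (δ : Fin m) {t : ℝ} (ht : t ∈ preimageOpens γ.base c.dom) :
    superLine.reduced (covDtCoeff nab γ c (γ.velXi c.dom) (.inr δ)) t
      = deriv (γ.oddCoord c δ) t + ∑ β, γ.oddCoeff nab c δ β t * γ.oddCoord c β t := by
  rw [γ.reduced_covDtCoeff_velXi_inr c nab δ ht, Finset.sum_comm]
  congr 1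
  refine Finset.sum_congr rfl fun β _ => ?_
  rw [oddCoeff, Finset.sum_mul]
  refine Finset.sum_congr rfl fun i _ => ?_
  rw [christoffelRep_evenCoord γ c nab _ _ _ ht]
  ring

/-- The odd geodesic equations along `γ` as an autonomous system, with the parameter as an additional
unknown; it is written for a family of solutions indexed by `κ`. -/
def oddField (γ : SuperCurve I M) (nab : Connection M) (c : SuperChart M n m) (κ : Type)
    (u : ℝ × (Fin m → κ → ℝ)) : ℝ × (Fin m → κ → ℝ) :=
  (1, fun δ a => -∑ β, γ.oddCoeff nab c δ β u.1 * u.2 β a)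

theorem oddField_contDiffAt (γ : SuperCurve I M) (nab : Connection M) (c : SuperChart M n m)
    (κ : Type) [Fintype κ] {u : ℝ × (Fin m → κ → ℝ)} (hu : u.1 ∈ preimageOpens γ.base c.dom) :
    ContDiffAt ℝ ∞ (γ.oddField nab c κ) u := by
  refine contDiffAt_const.prodMk (contDiffAt_pi.2 fun δ => contDiffAt_pi.2 fun a =>
    ContDiffAt.neg (ContDiffAt.sum fun β _ => ContDiffAt.mul ?_ ?_))
  · exact (γ.oddCoeff_contDiffAt nab c δ β hu).comp u contDiffAt_fst
  · exact contDiffAt_pi.1 (contDiffAt_pi.1 contDiffAt_snd β) a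

theorem OddCondition.hasDerivAt {nab : Connection M} {γ : SuperCurve I M}
    (hγ : γ.OddCondition n m nab) {γ' : SuperCurve I' M} {t : ℝ}
    (hs : ∀ᶠ s in 𝓝 t, SamePointAt γ γ' s) (c : SuperChart M n m)
    (ht : t ∈ preimageOpens γ.base c.dom) :
    HasDerivAt (fun s => (s, fun δ (_ : Unit) => γ.oddCoord c δ s))
      (γ'.oddField nab c Unit (t, fun δ _ => γ.oddCoord c δ t)) t := by
  refine HasDerivAt.prodMk (hasDerivAt_id t) (hasDerivAt_pi.2 fun δ => hasDerivAt_pi.2 fun _ => ?_)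
  have h := (γ.reducedVanishes_covDt_iff c nab _).1 (hγ c) t ht (.inr δ)
  rw [γ.reduced_covDtCoeff_velXi_inr_eq_oddCoeff nab c δ ht] at h
  simp only [← oddCoeff_congr hs nab c ht]
  rw [← eq_neg_of_add_eq_zero_left h]
  exact ((γ.oddCoord_contDiffAt c ht δ).differentiableAt (by simp)).hasDerivAt

/-- Uniqueness for the odd geodesic equations: two supercurves over the same curve that satisfy the
odd condition agree if they agree at one parameter value. -/
theorem forall_sameAt (hM : IsSupermanifold M n m) {nab : Connection M} {γ : SuperCurve I M}
    {γ' : SuperCurve I' M} (hγ : γ.OddCondition n m nab) (hγ' : γ'.OddCondition n m nab)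
    {K : Set ℝ} (hK : IsPreconnected K) (hKo : IsOpen K) (hs : ∀ t ∈ K, SamePointAt γ γ' t) {t₀ : ℝ}
    (ht₀ : t₀ ∈ K) (h₀ : SameAt γ γ' t₀) : ∀ t ∈ K, SameAt γ γ' t := by
  refine forall_of_frequently_imp_eventually hK (fun t ht hf => ?_) ht₀ h₀
  obtain ⟨h1, h2, h3⟩ := hs t ht
  obtain ⟨c, hc⟩ := hM.chart_at (γ.base ⟨t, h1⟩)
  have htc : t ∈ preimageOpens γ.base c.dom := mem_preimageOpens h1 hc
  have htc' := ((hs t ht).mem_iff _).1 htc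
  have hst : ∀ᶠ s in 𝓝 t, SamePointAt γ γ' s := Filter.eventually_of_mem (hKo.mem_nhds ht) hs
  have n1 := (preimageOpens γ.base c.dom).isOpen.mem_nhds htc
  have n2 := (preimageOpens γ'.base c.dom).isOpen.mem_nhds htc'
  have h0 : ∀ δ, γ.oddCoord c δ t = γ'.oddCoord c δ t := fun δ =>
    tendsto_nhds_unique_of_frequently_eq (γ.oddCoord_contDiffAt c htc δ).continuousAt
      (γ'.oddCoord_contDiffAt c htc' δ).continuousAt
      ((hf.and_eventually n1).mono fun s h => h.1.oddCoord_eq c h.2 δ)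
  have hu := ode_unique (f := fun s => (s, fun δ (_ : Unit) => γ.oddCoord c δ s))
    (g := fun s => (s, fun δ (_ : Unit) => γ'.oddCoord c δ s))
    ((γ'.oddField_contDiffAt nab c Unit (u := (t, fun δ _ => γ.oddCoord c δ t)) htc').of_le (by simp))
    (by
      filter_upwards [hst.eventually_nhds, n1] with s hs hs1
      exact hγ.hasDerivAt hs c hs1)
    (by
      filter_upwards [n2] with s hs2
      refine hγ'.hasDerivAt ?_ c hs2
      filter_upwards [(preimageOpens γ'.base c.dom).isOpen.mem_nhds hs2] with r hr
      exact ⟨preimageOpens_le hr, preimageOpens_le hr, rfl⟩)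
    (by simp only [h0])
  filter_upwards [hu, hst, n1] with s hs hsp hs1
  obtain ⟨k1, k2, k3⟩ := hsp
  exact sameAt_of_coord c k1 k2 k3 (apply_mem_of_mem_preimageOpens hs1) fun δ =>
    congrFun (congrFun (congrArg Prod.snd hs) δ) ()

end SuperCurve

/-! ### Existence of supergeodesics -/

/-- The interval `(b - ε, b + ε)`. -/
def intervalAround (b ε : ℝ) : Opens ℝ := ⟨Set.Ioo (b - ε) (b + ε), isOpen_Ioo⟩

theorem mem_intervalAround {b ε t : ℝ} : t ∈ intervalAround b ε ↔ t ∈ Set.Ioo (b - ε) (b + ε) :=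
  Iff.rfl

theorem self_mem_intervalAround {b ε : ℝ} (hε : 0 < ε) : b ∈ intervalAround b ε :=
  ⟨by linarith, by linarith⟩

theorem exists_intervalAround_le {b : ℝ} {P : ℝ → Prop} (h : ∀ᶠ t in 𝓝 b, P t) :
    ∃ ε > 0, ∀ t ∈ intervalAround b ε, P t := by
  obtain ⟨ε, hε, hP⟩ := Metric.eventually_nhds_iff.1 h
  refine ⟨ε, hε, fun t ht => hP ?_⟩
  have := mem_intervalAround.1 ht
  rw [Real.dist_eq, abs_lt]
  constructor <;> linarith [this.1, this.2]

namespace SuperCurve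
variable {I I' : Opens ℝ} {M : SuperSpace.{u, v}} {n m : ℕ}

/-- It suffices to verify the even condition in one chart at each point. -/
theorem evenCondition_of_exists {nab : Connection M} {γ : SuperCurve I M}
    (h : ∀ t ∈ I, ∃ (c : SuperChart M n m) (ht : t ∈ preimageOpens γ.base c.dom),
      ∀ k, deriv (deriv (γ.evenCoord c k)) t = -∑ i, ∑ j, deriv (γ.evenCoord c j) t *
        deriv (γ.evenCoord c i) t * M.value (c.christoffel nab (.inl i) (.inl j) (.inl k))
          (γ.base ⟨t, preimageOpens_le ht⟩)) : γ.EvenCondition n m nab := by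
  refine covDt_of_forall_exists γ.isField_velT nab fun t ht => ?_
  obtain ⟨c, htc, h⟩ := h t ht
  refine ⟨c, htc, ?_⟩
  rintro (k | δ)
  · rw [γ.reduced_covDtCoeff_velT_inl c nab k htc, h k]
    exact neg_add_cancel _
  · exact γ.reduced_covDtCoeff_velT_inr c nab δ htc

theorem EvenCondition.congr (hM : IsSupermanifold M n m) {nab : Connection M} {γ : SuperCurve I M}
    {γ' : SuperCurve I' M} (hγ : γ.EvenCondition n m nab)
    (h : ∀ t ∈ I', ∀ᶠ s in 𝓝 t, SamePointAt γ' γ s) : γ'.EvenCondition n m nab := by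
  refine covDt_of_forall_exists γ'.isField_velT nab fun t ht => ?_
  obtain ⟨c, hc⟩ := hM.chart_at (γ'.base ⟨t, ht⟩)
  have htc : t ∈ preimageOpens γ'.base c.dom := mem_preimageOpens ht hc
  have htc' := ((h t ht).self_of_nhds.mem_iff _).1 htc
  refine ⟨c, htc, fun k => ?_⟩
  rw [covDtCoeff_velT_congr (h t ht) nab c htc htc']
  exact (γ.reducedVanishes_covDt_iff c nab _).1 (hγ c) t htc' k

/-- Local existence of geodesics of `M_red`, as supercurves. -/
theorem exists_evenCondition (hM : IsSupermanifold M n m) (nab : Connection M)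
    (c : SuperChart M n m) {p : M} (hp : p ∈ c.dom) (w : Fin n → ℝ) :
    ∃ (ε : ℝ) (hε : 0 < ε) (γ : SuperCurve (intervalAround 0 ε) M), γ.EvenCondition n m nab ∧
      γ.base ⟨0, self_mem_intervalAround hε⟩ = p ∧ ∀ i, deriv (γ.evenCoord c i) 0 = w i := by
  obtain ⟨ε, hε, α, h0, hα, hd⟩ := ode_exists (F := c.geodesicField nab) (s := c.x.target ×ˢ Set.univ)
    (c.x.open_target.prod isOpen_univ)
    (fun u hu => (c.geodesicField_contDiffAt nab hu.1).contDiffWithinAt)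
    (u₀ := (c.x p, w)) ⟨c.x.map_source hp, trivial⟩ 0
  have hK : ∀ t : intervalAround 0 ε, (α t).1 ∈ c.x.target := fun t => (hd t.1 t.2).1.1
  obtain ⟨σ, hσx⟩ : ∃ σ : C(intervalAround 0 ε, M), ∀ t, σ t = c.x.symm (α t).1 :=
    ⟨⟨fun t => c.x.symm (α t).1, by
      refine c.x.continuousOn_symm.comp_continuous ?_ hK
      refine continuous_fst.comp ?_
      exact hα.continuousOn.comp_continuous continuous_subtype_val fun t => t.2⟩, fun _ => rfl⟩
  have hσc : ∀ t, σ t ∈ c.dom := fun t => by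
    rw [hσx]
    exact c.x.map_target (hK t)
  have hσ : ∀ t ∈ intervalAround 0 ε, GradedMetric.curveCoord c σ t = (α t).1 := fun t ht => by
    rw [curveCoord_apply c σ ht, hσx]
    exact c.x.right_inv (hK ⟨t, ht⟩)
  have hσ' : ∀ t ∈ intervalAround 0 ε, GradedMetric.curveCoord c σ =ᶠ[𝓝 t] fun s => (α s).1 :=
    fun t ht => Filter.eventually_of_mem ((intervalAround 0 ε).isOpen.mem_nhds ht) hσ
  obtain ⟨γ, hγ, -⟩ := exists_lift hM σ fun t ht => ⟨c, hσc _, by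
    refine ContDiffAt.congr_of_eventuallyEq ?_ (hσ' t ht)
    exact contDiffAt_fst.comp t (hα.contDiffAt ((intervalAround 0 ε).isOpen.mem_nhds ht))⟩
  subst hγ
  have hpre : ∀ t ∈ intervalAround 0 ε, t ∈ preimageOpens γ.base c.dom := fun t ht =>
    mem_preimageOpens ht (hσc _)
  have he : ∀ t ∈ intervalAround 0 ε, ∀ i, γ.evenCoord c i =ᶠ[𝓝 t] fun s => (α s).1 i := by
    intro t ht i
    filter_upwards [γ.curveCoord_eventuallyEq c (hpre t ht) i, hσ' t ht] with s h1 h2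
    rw [← h1, h2]
  have hd1 : ∀ t ∈ intervalAround 0 ε, ∀ i, deriv (γ.evenCoord c i) t = (α t).2 i := by
    intro t ht i
    rw [(he t ht i).deriv_eq]
    exact (hasDerivAt_pi.1 (hd t ht).2.fst i).deriv
  refine ⟨ε, hε, γ, evenCondition_of_exists fun t ht => ⟨c, hpre t ht, fun k => ?_⟩, ?_, fun i => ?_⟩
  · have : deriv (γ.evenCoord c k) =ᶠ[𝓝 t] fun s => (α s).2 k :=
      Filter.eventually_of_mem ((intervalAround 0 ε).isOpen.mem_nhds ht) fun s hs => hd1 s hs k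
    have hx : c.x (γ.base ⟨t, ht⟩) = (α t).1 := by
      rw [← hσ t ht, curveCoord_apply c γ.base ht]
    rw [this.deriv_eq, (hasDerivAt_pi.1 (hd t ht).2.snd k).deriv]
    simp only [hd1 t ht, ← c.christoffelRep_apply nab _ _ _ (hσc ⟨t, ht⟩), hx]
    rfl
  · rw [hσx, h0]
    exact c.x.left_inv hp
  · rw [hd1 0 (self_mem_intervalAround hε), h0]

/-- Along a geodesic, the odd geodesic equations have solutions near each point, on an interval that
does not depend on the initial condition, because the equations are linear. -/
theorem exists_odd_solution (nab : Connection M) (γ : SuperCurve I M) (c : SuperChart M n m) {b : ℝ}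
    (hb : b ∈ preimageOpens γ.base c.dom) :
    ∃ ε > 0, intervalAround b ε ≤ preimageOpens γ.base c.dom ∧ ∀ t₀ ∈ intervalAround b ε,
      ∀ h₀ : Fin m → ℝ, ∃ h : Fin m → ℝ → ℝ, (∀ α, h α t₀ = h₀ α) ∧ ∀ t ∈ intervalAround b ε, ∀ α,
        ContDiffAt ℝ ∞ (h α) t ∧ deriv (h α) t = -∑ β, γ.oddCoeff nab c α β t * h β t := by
  obtain ⟨ε, hε, Ψ, h0, hΨ, hd⟩ := ode_exists (F := γ.oddField nab c (Fin m))
    (s := {u | u.1 ∈ preimageOpens γ.base c.dom})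
    ((preimageOpens γ.base c.dom).isOpen.preimage continuous_fst)
    (fun u hu => (γ.oddField_contDiffAt nab c (Fin m) hu).contDiffWithinAt)
    (u₀ := (b, fun δ a => (1 : Matrix (Fin m) (Fin m) ℝ) δ a)) hb b
  have hb' : b ∈ Set.Ioo (b - ε) (b + ε) := self_mem_intervalAround hε
  have hd1 : ∀ t ∈ Set.Ioo (b - ε) (b + ε), HasDerivAt (fun s => (Ψ s).1) 1 t := fun t ht =>
    (hd t ht).2.fst
  have ht : ∀ t ∈ Set.Ioo (b - ε) (b + ε), (Ψ t).1 = t := by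
    refine isOpen_Ioo.eqOn_of_deriv_eq isPreconnected_Ioo
      (fun t ht => (hd1 t ht).differentiableAt.differentiableWithinAt)
      differentiable_id.differentiableOn (fun t ht => ?_) hb' (congrArg Prod.fst h0)
    rw [(hd1 t ht).deriv]
    exact (deriv_id t).symm
  have hdet : ∀ᶠ t in 𝓝 b, (Matrix.of (Ψ t).2).det ≠ 0 := by
    have hc : ContinuousAt (fun t => (Matrix.of (Ψ t).2).det) b := by
      have h1 : ContinuousAt (fun t => (Ψ t).2) b :=
        continuous_snd.continuousAt.comp (hΨ.continuousOn.continuousAt (isOpen_Ioo.mem_nhds hb'))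
      have h2 : Continuous fun A : Fin m → Fin m → ℝ => (Matrix.of A).det :=
        Continuous.matrix_det continuous_id
      exact h2.continuousAt.comp h1
    refine hc.eventually_ne ?_
    rw [h0]
    change (1 : Matrix (Fin m) (Fin m) ℝ).det ≠ 0
    simp
  obtain ⟨ε', hε', hK⟩ := exists_intervalAround_le (hdet.and (isOpen_Ioo.mem_nhds hb'))
  have hle : ∀ t ∈ intervalAround b ε', t ∈ Set.Ioo (b - ε) (b + ε) := fun t ht => (hK t ht).2
  refine ⟨ε', hε', fun t htK => ?_, fun t₀ ht₀ h₀ => ?_⟩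
  · have := (hd t (hle t htK)).1
    rwa [Set.mem_ofPred_eq, ht t (hle t htK)] at this
  · -- the columns of the fundamental matrix `Ψ` span the space of solutions
    refine ⟨fun α t => ∑ a, (Ψ t).2 α a * ((Matrix.of (Ψ t₀).2)⁻¹.mulVec h₀) a, fun α => ?_,
      fun t htK α => ⟨?_, ?_⟩⟩
    · have h1 := Matrix.mul_nonsing_inv (Matrix.of (Ψ t₀).2) (isUnit_iff_ne_zero.2 (hK t₀ ht₀).1)
      have h2 : (Matrix.of (Ψ t₀).2).mulVec ((Matrix.of (Ψ t₀).2)⁻¹.mulVec h₀) = h₀ := by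
        rw [Matrix.mulVec_mulVec, h1, Matrix.one_mulVec]
      exact congrFun h2 α
    · have h1 := hΨ.contDiffAt (isOpen_Ioo.mem_nhds (hle t htK))
      exact ContDiffAt.sum fun a _ => ContDiffAt.mul
        (contDiffAt_pi.1 (contDiffAt_pi.1 h1.snd α) a) contDiffAt_const
    · have h1 : ∀ a, HasDerivAt (fun s => (Ψ s).2 α a)
          (-∑ β, γ.oddCoeff nab c α β (Ψ t).1 * (Ψ t).2 β a) t := fun a =>
        hasDerivAt_pi.1 (hasDerivAt_pi.1 (hd t (hle t htK)).2.snd α) a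
      have h2 := HasDerivAt.fun_sum (u := Finset.univ) fun a _ =>
        (h1 a).mul_const (((Matrix.of (Ψ t₀).2)⁻¹.mulVec h₀) a)
      rw [h2.deriv]
      simp only [ht t (hle t htK), neg_mul, Finset.sum_neg_distrib, Finset.sum_mul, Finset.mul_sum,
        mul_assoc]
      rw [Finset.sum_comm]

/-- Local prolongation: near each point of a geodesic there is an interval on which supergeodesics
over it with arbitrary odd initial values at arbitrary parameter values exist. -/
theorem exists_isSupergeodesic (hM : IsSupermanifold M n m) {nab : Connection M} {γ : SuperCurve I M}
    (hγ : γ.EvenCondition n m nab) (c : SuperChart M n m) {b : ℝ}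
    (hb : b ∈ preimageOpens γ.base c.dom) :
    ∃ ε > 0, intervalAround b ε ≤ preimageOpens γ.base c.dom ∧ ∀ t₀ ∈ intervalAround b ε,
      ∀ h₀ : Fin m → ℝ, ∃ γ' : SuperCurve (intervalAround b ε) M, γ'.IsSupergeodesic n m nab ∧
        (∀ t ∈ intervalAround b ε, SamePointAt γ' γ t) ∧ ∀ α, γ'.oddCoord c α t₀ = h₀ α := by
  obtain ⟨ε, hε, hle, hsol⟩ := exists_odd_solution nab γ c hb
  refine ⟨ε, hε, hle, fun t₀ ht₀ h₀ => ?_⟩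
  obtain ⟨h, hi, hh⟩ := hsol t₀ ht₀ h₀
  let γr : SuperCurve (intervalAround b ε) M := SuperMap.restrict γ (hle.trans preimageOpens_le)
  have hrc : ∀ t, γr.base t ∈ c.dom := fun t => apply_mem_of_mem_preimageOpens (hle t.2)
  obtain ⟨γ', hb', ho⟩ := exists_oddCoord_eq c γr.base hrc (fun t ht => by
    refine contDiffAt_pi.2 fun i => ?_
    have htr : t ∈ preimageOpens γr.base c.dom := mem_preimageOpens ht (hrc _)
    exact (γr.evenCoord_contDiffAt c htr i).congr_of_eventuallyEq
      (γr.curveCoord_eventuallyEq c htr i)) h fun α t ht => (hh t ht α).1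
  have hs : ∀ t ∈ intervalAround b ε, SamePointAt γ' γ t := fun t ht =>
    ⟨ht, preimageOpens_le (hle ht), by rw [hb']; rfl⟩
  have hs' : ∀ t ∈ intervalAround b ε, ∀ᶠ s in 𝓝 t, SamePointAt γ' γ s := fun t ht =>
    Filter.eventually_of_mem ((intervalAround b ε).isOpen.mem_nhds ht) hs
  have hpre : ∀ t ∈ intervalAround b ε, t ∈ preimageOpens γ'.base c.dom := fun t ht =>
    ((hs t ht).mem_iff _).2 (hle ht)
  have hodd : γ'.OddCondition n m nab := by
    refine covDt_of_forall_exists γ'.isField_velXi nab fun t ht => ⟨c, hpre t ht, ?_⟩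
    rintro (k | δ)
    · exact γ'.reduced_covDtCoeff_velXi_inl c nab k (hpre t ht)
    · have he : γ'.oddCoord c δ =ᶠ[𝓝 t] h δ :=
        Filter.eventually_of_mem ((intervalAround b ε).isOpen.mem_nhds ht) fun s hs => ho s hs δ
      rw [γ'.reduced_covDtCoeff_velXi_inr_eq_oddCoeff nab c δ (hpre t ht), he.deriv_eq,
        (hh t ht δ).2]
      simp only [oddCoeff_congr (hs' t ht) nab c (hpre t ht), ho t ht]
      exact neg_add_cancel _
  exact ⟨γ', fun c => ⟨hγ.congr hM hs' c, hodd c⟩, hs, fun α => (ho t₀ ht₀ α).trans (hi α)⟩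

theorem IsSupergeodesic.evenCondition {nab : Connection M} {γ : SuperCurve I M}
    (h : γ.IsSupergeodesic n m nab) : γ.EvenCondition n m nab := fun c => (h c).1

theorem IsSupergeodesic.oddCondition {nab : Connection M} {γ : SuperCurve I M}
    (h : γ.IsSupergeodesic n m nab) : γ.OddCondition n m nab := fun c => (h c).2

/-- Local existence of supergeodesics. -/
theorem exists_hasInitial (hM : IsSupermanifold M n m) (nab : Connection M) {p : M}
    (τ : TangentVector M p) : ∃ (ε : ℝ) (hε : 0 < ε) (γ : SuperCurve (intervalAround 0 ε) M),
      γ.IsSupergeodesic n m nab ∧ γ.HasInitial (self_mem_intervalAround hε) τ := by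
  obtain ⟨c, hc⟩ := hM.chart_at p
  obtain ⟨ε₀, hε₀, γ₀, hγ₀, hb₀, hd₀⟩ := exists_evenCondition hM nab c hc
    fun i => τ.toFun c.dom hc (c.coord (.inl i))
  have h0c : (0 : ℝ) ∈ preimageOpens γ₀.base c.dom :=
    mem_preimageOpens (self_mem_intervalAround hε₀) (by rw [hb₀]; exact hc)
  obtain ⟨ε, hε, hle, h⟩ := exists_isSupergeodesic hM hγ₀ c h0c
  obtain ⟨γ, hγ, hs, ho⟩ := h 0 (self_mem_intervalAround hε)
    fun α => τ.toFun c.dom hc (c.coord (.inr α))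
  refine ⟨ε, hε, γ, hγ, (γ.hasInitial_iff _ τ c hc).2 ⟨?_, fun i => ?_, ho⟩⟩
  · obtain ⟨_, _, h3⟩ := hs 0 (self_mem_intervalAround hε)
    rw [h3, hb₀]
  · rw [← hd₀]
    refine (evenCoord_eventuallyEq ?_ c ?_ i).deriv_eq
    · exact Filter.eventually_of_mem
        ((intervalAround 0 ε).isOpen.mem_nhds (self_mem_intervalAround hε)) hs
    · exact ((hs 0 (self_mem_intervalAround hε)).mem_iff _).2 h0c

/-- Two supergeodesics with the same initial conditions agree where both are defined. -/
theorem sameAt_of_hasInitial (hM : IsSupermanifold M n m) {nab : Connection M} {γ : SuperCurve I M}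
    {γ' : SuperCurve I' M} (hγ : γ.IsSupergeodesic n m nab) (hγ' : γ'.IsSupergeodesic n m nab)
    (hI : (I : Set ℝ).OrdConnected) (hI' : (I' : Set ℝ).OrdConnected) {h0 : (0 : ℝ) ∈ I}
    {h0' : (0 : ℝ) ∈ I'} {p : M} {τ : TangentVector M p} (hi : γ.HasInitial h0 τ)
    (hi' : γ'.HasInitial h0' τ) {t : ℝ} (ht : t ∈ I) (ht' : t ∈ I') : SameAt γ γ' t := by
  obtain ⟨c, hc⟩ := hM.chart_at p
  obtain ⟨hb, h1, h2⟩ := (γ.hasInitial_iff h0 τ c hc).1 hi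
  obtain ⟨hb', h1', h2'⟩ := (γ'.hasInitial_iff h0' τ c hc).1 hi'
  have hc0 : γ.base ⟨0, h0⟩ ∈ c.dom := by rw [hb]; exact hc
  have hK : IsPreconnected ((I : Set ℝ) ∩ I') := (hI.inter hI').isPreconnected
  have hs := forall_samePointAt hM hγ.evenCondition hγ'.evenCondition hK (fun _ h => h.1)
    (fun _ h => h.2) ⟨h0, h0'⟩ ⟨h0, h0', hb.trans hb'.symm⟩ c (mem_preimageOpens h0 hc0)
    fun i => (h1 i).trans (h1' i).symm
  exact forall_sameAt hM hγ.oddCondition hγ'.oddCondition hK (I.isOpen.inter I'.isOpen) hs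
    ⟨h0, h0'⟩ (sameAt_of_coord c h0 h0' (hb.trans hb'.symm) hc0 fun α =>
      (h2 α).trans (h2' α).symm) t ⟨ht, ht'⟩

/-- Supergeodesics that agree on overlaps glue to a supergeodesic. -/
theorem exists_glue_isSupergeodesic (hM : IsSupermanifold M n m) {nab : Connection M} {ι : Type*}
    {J : ι → Opens ℝ} (γ : ∀ i, SuperCurve (J i) M) (hg : ∀ i, (γ i).IsSupergeodesic n m nab)
    (hγ : ∀ i j t, t ∈ J i → t ∈ J j → SameAt (γ i) (γ j) t) (hI : ∀ t, t ∈ I ↔ ∃ i, t ∈ J i) :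
    ∃ Γ : SuperCurve I M, Γ.IsSupergeodesic n m nab ∧ ∀ i, ∀ t ∈ J i, SameAt Γ (γ i) t := by
  obtain ⟨Γ, hΓ⟩ := exists_glue hM γ hγ hI
  refine ⟨Γ, isSupergeodesic_of_locally hM fun t ht => ?_, hΓ⟩
  obtain ⟨i, hi⟩ := (hI t).1 ht
  exact ⟨J i, γ i, hg i, Filter.eventually_of_mem ((J i).isOpen.mem_nhds hi) (hΓ i)⟩

/-- The maximal supergeodesic is glued from all supergeodesics with the given initial data. -/
theorem exists_maximal (hM : IsSupermanifold M n m) (nab : Connection M) {p : M}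
    (τ : TangentVector M p) :
    ∃ (I : Opens ℝ) (h0 : (0 : ℝ) ∈ I) (γ : SuperCurve I M), (I : Set ℝ).OrdConnected ∧
      γ.IsSupergeodesic n m nab ∧ γ.HasInitial h0 τ ∧
      ∀ (J : Opens ℝ) (h0' : (0 : ℝ) ∈ J) (γ' : SuperCurve J M), (J : Set ℝ).OrdConnected →
        γ'.IsSupergeodesic n m nab → γ'.HasInitial h0' τ → ∃ h : J ≤ I, γ' = γ.restrict h := by
  let ι := {x : Σ J : Opens ℝ, SuperCurve J M // (x.1 : Set ℝ).OrdConnected ∧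
    x.2.IsSupergeodesic n m nab ∧ ∃ h0 : (0 : ℝ) ∈ x.1, x.2.HasInitial h0 τ}
  let J : ι → Opens ℝ := fun x => x.1.1
  let γ : ∀ i : ι, SuperCurve (J i) M := fun x => x.1.2
  have h0J : ∀ i, (0 : ℝ) ∈ J i := fun i => i.2.2.2.choose
  have hagree : ∀ i j t, t ∈ J i → t ∈ J j → SameAt (γ i) (γ j) t := fun i j t hi hj =>
    sameAt_of_hasInitial hM i.2.2.1 j.2.2.1 i.2.1 j.2.1 i.2.2.2.choose_spec j.2.2.2.choose_spec hi hj
  have hI : ∀ t, t ∈ (⨆ i, J i) ↔ ∃ i, t ∈ J i := fun t => Opens.mem_iSup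
  obtain ⟨Γ, hΓ, hs⟩ := exists_glue_isSupergeodesic hM γ (fun i => i.2.2.1) hagree hI
  obtain ⟨ε, hε, γ₀, hγ₀, hi₀⟩ := exists_hasInitial (n := n) (m := m) hM nab τ
  let i₀ : ι := ⟨⟨intervalAround 0 ε, γ₀⟩, Set.ordConnected_Ioo, hγ₀,
    self_mem_intervalAround hε, hi₀⟩
  have h0 : (0 : ℝ) ∈ ⨆ i, J i := (hI 0).2 ⟨i₀, h0J i₀⟩
  refine ⟨⨆ i, J i, h0, Γ, ?_, hΓ, ?_, ?_⟩
  · rw [Opens.coe_iSup]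
    exact (isPreconnected_iUnion ⟨0, Set.mem_iInter.2 h0J⟩
      fun i => i.2.1.isPreconnected).ordConnected
  · exact HasInitial.congr hM h0 hi₀ (Filter.eventually_of_mem
      ((J i₀).isOpen.mem_nhds (h0J i₀)) fun s hs' => (hs i₀ s hs').symm)
  · intro K h0' γ' hK hγ' hi'
    let j : ι := ⟨⟨K, γ'⟩, hK, hγ', h0', hi'⟩
    have hle : K ≤ ⨆ i, J i := fun t ht => (hI t).2 ⟨j, ht⟩
    exact ⟨hle, ext_of_sameAt hM fun t ht =>
      ((restrict_sameAt Γ hle ht).trans (hs j t ht)).symm⟩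

/-- The maximal supergeodesic is defined as long as the underlying geodesic: at a boundary point of
its domain where the geodesic continues, it could be prolonged by solving the linear odd
equations. -/
theorem le_of_isRedGeodesicFrom (hM : IsSupermanifold M n m) {G : GradedMetric M}
    {nab : Connection M} (hnab : nab.IsLeviCivita G) {p : M} {τ : TangentVector M p}
    {h0 : (0 : ℝ) ∈ I} {γ : SuperCurve I M} (hI : (I : Set ℝ).OrdConnected)
    (hγ : γ.IsSupergeodesic n m nab) (hi : γ.HasInitial h0 τ)
    (hmax : ∀ (J : Opens ℝ) (h0' : (0 : ℝ) ∈ J) (γ' : SuperCurve J M), (J : Set ℝ).OrdConnected →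
      γ'.IsSupergeodesic n m nab → γ'.HasInitial h0' τ → J ≤ I)
    {J : Opens ℝ} {h0' : (0 : ℝ) ∈ J} {σ : C(J, M)} (hJ : (J : Set ℝ).OrdConnected)
    (hσ : G.IsRedGeodesicFrom n m h0' σ τ) : J ≤ I := by
  obtain ⟨hgeo, hp, hvel⟩ := hσ
  obtain ⟨γ₀, rfl, -⟩ := exists_lift hM σ fun t ht => by
    obtain ⟨c, hc⟩ := hM.chart_at (σ ⟨t, ht⟩)
    exact ⟨c, hc, (hgeo c).1.contDiffAt
      ((preimageOpens σ c.dom).isOpen.mem_nhds (mem_preimageOpens ht hc))⟩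
  have hγ₀ : γ₀.EvenCondition n m nab := (γ₀.isRedGeodesic_iff nab hnab).1 hgeo
  -- on the common domain, `γ` lies over the given geodesic
  have hs : ∀ t ∈ (I : Set ℝ) ∩ J, SamePointAt γ γ₀ t := by
    obtain ⟨c, hc⟩ := hM.chart_at p
    obtain ⟨hb, h1, -⟩ := (γ.hasInitial_iff h0 τ c hc).1 hi
    have hc0 : γ.base ⟨0, h0⟩ ∈ c.dom := by rw [hb]; exact hc
    have hc0' : γ₀.base ⟨0, h0'⟩ ∈ c.dom := by rw [hp]; exact hc
    refine forall_samePointAt hM hγ.evenCondition hγ₀ (hI.inter hJ).isPreconnected (fun _ h => h.1)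
      (fun _ h => h.2) ⟨h0, h0'⟩ ⟨h0, h0', hb.trans hp.symm⟩ c (mem_preimageOpens h0 hc0) fun i => ?_
    rw [h1, ← hvel c hc i, (γ₀.curveCoord_eventuallyEq c (mem_preimageOpens h0' hc0') i).deriv_eq]
  refine forall_of_frequently_imp_eventually hJ.isPreconnected (fun b hb hf => ?_) h0' h0
  obtain ⟨c, hc⟩ := hM.chart_at (γ₀.base ⟨b, hb⟩)
  obtain ⟨ε, hε, hle, hex⟩ := exists_isSupergeodesic hM hγ₀ c (mem_preimageOpens hb hc)
  have hbK := (intervalAround b ε).isOpen.mem_nhds (self_mem_intervalAround hε)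
  obtain ⟨t₀, ht₀, ht₀K⟩ := (hf.and_eventually hbK).exists
  have hKJ : intervalAround b ε ≤ J := hle.trans preimageOpens_le
  obtain ⟨γ', hγ', hs', ho⟩ := hex t₀ ht₀K fun α => γ.oddCoord c α t₀
  have hsp : ∀ t ∈ (I : Set ℝ) ∩ intervalAround b ε, SamePointAt γ γ' t := fun t ht =>
    (hs t ⟨ht.1, hKJ ht.2⟩).trans (hs' t ht.2).symm
  have hsame : ∀ t ∈ (I : Set ℝ) ∩ intervalAround b ε, SameAt γ γ' t := by
    refine forall_sameAt hM hγ.oddCondition hγ'.oddCondition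
      (hI.inter Set.ordConnected_Ioo).isPreconnected (I.isOpen.inter (intervalAround b ε).isOpen)
      hsp ⟨ht₀, ht₀K⟩ ?_
    obtain ⟨k1, k2, k3⟩ := hsp t₀ ⟨ht₀, ht₀K⟩
    refine sameAt_of_coord c k1 k2 k3 ?_ fun α => (ho α).symm
    exact apply_mem_of_mem_preimageOpens (((hs t₀ ⟨ht₀, hKJ ht₀K⟩).mem_iff _).2 (hle ht₀K))
  obtain ⟨Γ, hΓ, hΓs⟩ := exists_glue_isSupergeodesic (I := I ⊔ intervalAround b ε) hM
    (J := fun i : Bool => bif i then I else intervalAround b ε)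
    (fun i => match i with
      | true => γ
      | false => γ')
    (fun i => match i with
      | true => hγ
      | false => hγ')
    (fun i j t => match i, j with
      | true, true => fun h _ => ⟨h, h, rfl, fun _ _ _ => rfl⟩
      | true, false => fun h h' => hsame t ⟨h, h'⟩
      | false, true => fun h h' => (hsame t ⟨h', h⟩).symm
      | false, false => fun h _ => ⟨h, h, rfl, fun _ _ _ => rfl⟩)
    (fun t => by simp [Opens.mem_sup, or_comm])
  have hconn : ((I ⊔ intervalAround b ε : Opens ℝ) : Set ℝ).OrdConnected := by
    rw [Opens.coe_sup]
    exact (hI.isPreconnected.union t₀ ht₀ ht₀K isPreconnected_Ioo).ordConnected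
  have h0Γ : (0 : ℝ) ∈ I ⊔ intervalAround b ε := Or.inl h0
  have := hmax _ h0Γ Γ hconn hΓ (HasInitial.congr hM h0Γ hi (Filter.eventually_of_mem
    (I.isOpen.mem_nhds h0) fun s hs => (hΓs true s hs).symm))
  exact Filter.eventually_of_mem hbK fun s hs => this (Or.inr hs)

end SuperCurve

end

end SuperGeometry

theorem mainTheorem7 (n m : ℕ) (M : SuperSpace.{u, v}) (hM : IsSupermanifold M n m)
    (G : GradedMetric M) (nab : Connection M) (hnab : nab.IsLeviCivita G) :
    -- supergeodesics are the supercurves over a geodesic that satisfy the odd condition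
    (∀ (I : Opens ℝ) (γ : SuperCurve I M),
      γ.IsSupergeodesic n m nab ↔ G.IsRedGeodesic n m γ.base ∧ γ.OddCondition n m nab) ∧
    -- the odd condition in coordinates
    (∀ (I : Opens ℝ) (γ : SuperCurve I M) (c : SuperChart M n m),
      (∀ i, ContDiffOn ℝ ∞ (γ.evenCoord c i) (preimageOpens γ.base c.dom) ∧
        ∀ t : preimageOpens γ.base c.dom, (γ.pull c.dom (c.coord (.inl i))).1 t
          = algebraMap ℝ (Gr 1) (γ.evenCoord c i t)) ∧
      (∀ α, ContDiffOn ℝ ∞ (γ.oddCoord c α) (preimageOpens γ.base c.dom) ∧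
        ∀ t : preimageOpens γ.base c.dom, (γ.pull c.dom (c.coord (.inr α))).1 t
          = γ.oddCoord c α t • superLine.xi) ∧
      (SuperCurve.ReducedVanishes (γ.covDt nab c (γ.velXi c.dom)) ↔
        ∀ (δ : Fin m), ∀ t ∈ preimageOpens γ.base c.dom,
          deriv (γ.oddCoord c δ) t + ∑ i : Fin n, ∑ β : Fin m,
            deriv (γ.evenCoord c i) t * γ.oddCoord c β t *
              superLine.reduced (γ.pull c.dom (c.christoffel nab (.inl i) (.inr β) (.inr δ))) t
            = 0)) ∧
    -- the unique maximal supergeodesic; it lives as long as the underlying geodesic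
    (∀ (p : M) (τ : TangentVector M p),
      ∃ (I : Opens ℝ) (h0 : (0 : ℝ) ∈ I) (γ : SuperCurve I M), (I : Set ℝ).OrdConnected ∧
        γ.IsSupergeodesic n m nab ∧ γ.HasInitial h0 τ ∧
        (∀ (J : Opens ℝ) (h0' : (0 : ℝ) ∈ J) (γ' : SuperCurve J M), (J : Set ℝ).OrdConnected →
          γ'.IsSupergeodesic n m nab → γ'.HasInitial h0' τ → ∃ h : J ≤ I, γ' = γ.restrict h) ∧
        (∀ (J : Opens ℝ) (h0' : (0 : ℝ) ∈ J) (σ : C(J, M)), (J : Set ℝ).OrdConnected →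
          G.IsRedGeodesicFrom n m h0' σ τ → J ≤ I)) ∧
    -- supergeodesics on all of `ℝ^{1|1}`
    (∀ (p : M) (τ : TangentVector M p),
      (∃ σ : C((⊤ : Opens ℝ), M), G.IsRedGeodesicFrom n m (Opens.mem_top 0) σ τ) →
        ∃! γ : SuperCurve ⊤ M,
          γ.IsSupergeodesic n m nab ∧ γ.HasInitial (Opens.mem_top 0) τ) := by
  refine ⟨fun I γ => γ.isSupergeodesic_iff nab hnab, fun I γ c => ⟨fun i => ⟨fun t ht =>
    (γ.evenCoord_contDiffAt c ht i).contDiffWithinAt, fun t => γ.pull_coord_inl c t.2 i⟩,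
    fun α => ⟨fun t ht => (γ.oddCoord_contDiffAt c ht α).contDiffWithinAt,
      fun t => γ.pull_coord_inr c t.2 α⟩, γ.reducedVanishes_velXi_iff c nab⟩, ?_, ?_⟩
  · intro p τ
    obtain ⟨I, h0, γ, hI, hγ, hi, hmax⟩ := SuperCurve.exists_maximal hM nab τ
    refine ⟨I, h0, γ, hI, hγ, hi, hmax, fun J h0' σ hJ hσ => ?_⟩
    exact SuperCurve.le_of_isRedGeodesicFrom hM hnab hI hγ hi
      (fun J h0' γ' hJ hγ' hi' => (hmax J h0' γ' hJ hγ' hi').1) hJ hσ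
  · rintro p τ ⟨σ, hσ⟩
    obtain ⟨I, h0, γ, hI, hγ, hi, hmax⟩ := SuperCurve.exists_maximal hM nab τ
    have htop : (⊤ : Opens ℝ) ≤ I := SuperCurve.le_of_isRedGeodesicFrom hM hnab hI hγ hi
      (fun J h0' γ' hJ hγ' hi' => (hmax J h0' γ' hJ hγ' hi').1) Set.ordConnected_univ hσ
    obtain rfl : I = ⊤ := top_le_iff.1 htop
    refine ⟨γ, ⟨hγ, hi⟩, fun γ' h => ?_⟩
    obtain ⟨_, h1⟩ := hmax ⊤ (Opens.mem_top 0) γ' hI h.1 h.2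
    obtain ⟨_, h2⟩ := hmax ⊤ (Opens.mem_top 0) γ hI hγ hi
    exact h1.trans h2.symm
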